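/- **Proposition (DML, panel data).** *Setup.* A unit has covariates $X$, binary instruments $Z_1,\dots,Z_{\mathcal T}$, exposure cohort $E=\min\{t: Z_t=1\}$ ($E=\infty$ if never exposed), potential treatments $D_t(e),D_t(\infty)\in\{0,1\}$ and potential outcomes $Y_t(d,z)$ indexed by treatment and instrument paths; observed are $X$, $Z$, $D_t=D_t(E)$ and $Y_t=Y_t(D,Z)$. Put $E_e=\mathbf 1\{E=e\}$, $Y_t(D_t(v)):=Y_t(0)+[Y_t(1)-Y_t(0)]D_t(v)$, and $\Delta V_t=V_t-V_{e-1}$. Fix a finite cohort $e$ in the support of $E$ that is not the largest element of the support, and $t\ge e$. Let $C$ be either $\mathbf 1\{E=\infty\}$ (never exposed) or $\mathbf 1\{E\ne e,Z_t=0\}$ (not yet exposed). Let $p(X)=P(E_e=1\mid X,E_e+C=1)$, $m^{trt}(X)=E[\Delta Y_t\mid X,E_e=1]$, $m(X)=E[\Delta Y_t\mid X,C=1]$, let $g^{trt},g$ be the same with $D$ in place of $Y$, and let $$LATT=E[Y_t(1)-Y_t(0)\mid E_e=1,D_t(e)>D_t(\infty)],\qquad \tau_0=\frac{E[m^{trt}(X)-m(X)\mid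 E_e=1]}{E[g^{trt}(X)-g(X)\mid E_e=1]}.$$ *Identifying assumptions.* (i) Staggered adoption: a.s. $Z_1=0$ and $Z_{s-1}=1\Rightarrow Z_s=1$. (ii) No carryover/exclusion: $Y_s(d,z)=Y_s(d_s)$ a.s. for $d,z$ in the supports of the treatment and instrument paths. (iii) Monotonicity: $P(D_s(e')\ge D_s(\infty)\mid X)=1$ a.s. for every finite cohort $e'$ in the support of $E$ other than its largest element, and all $s\ge e'$. (iv) No anticipation: for every finite cohort $e'$ with $P(E=e')>0$ and every $s<e'$, $E[D_s(e')\mid X,E=e']=E[D_s(\infty)\mid X,E=e']$ and $E[Y_s(D_s(e'))\mid X,E=e']=E[Y_s(D_s(\infty))\mid X,E=e']$. (v) Parallel trends: for $e\le s\le t$, the conditional means of $D_s(\infty)-D_{s-1}(\infty)$ and of $Y_s(D_s(\infty))-Y_{s-1}(D_{s-1}(\infty))$ given $(X,E_e=1)$ equal those given $(X,C=1)$, a.s. on $\{E_e=1\}$. (vi) Overlap: for some $\delta>0$, $P(E_e=1)>\delta$ and $p(X)<1-\delta$ a.s. on $\{E_e+C=1\}$. (vii) $P(E_e=1,D_t(e)>D_t(\infty))>0$,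 and the $Y_s(0),Y_s(1)$ have finite second moments. *Score.* For $\eta=(\rho,\rho_c,p,m,g)$ let $w^{trt}=E_e/\rho$, $w^{c}=\rho_c^{-1}\,C\,p(X)/(1-p(X))$, $$\psi_b(O;\eta)=\{w^{trt}-w^c\}\{\Delta Y_t-m(X)\},\quad \psi_a(O;\eta)=\{w^{trt}-w^c\}\{\Delta D_t-g(X)\},\quad \psi(O;\tau,\eta)=\psi_b(O;\eta)-\tau\psi_a(O;\eta);$$ the true $\eta_0$ has $\rho=E[E_e]$, $\rho_c=E[C\,p(X)/(1-p(X))]$ and the true $p,m,g$. *Estimator.* $O_1,O_2,\dots$ are i.i.d. copies of the observed panel unit. For fixed $K\ge2$ and $n=KN$, the first $n$ observations are partitioned into $K$ folds of size $N$; $P_n^k$ is the empirical mean over fold $k$. For each $k$, $\hat p^{-k},\hat m^{-k},\hat g^{-k}$ are (jointly measurable) functions of the observations outside fold $k$ and of the covariates. The denominators $\hat\rho^{-k},\hat\rho_c^{-k}$ are the empirical means of $E_e$ and $C\hat p^{-k}(X)/(1-\hat p^{-k}(X))$, taken either (A) over all observations outside fold $k$ or (B) over fold $k$, so that the weights average to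 one in sample. Let $$\hat\tau=\frac{K^{-1}\sum_kP_n^k[\psi_b(O;\hat\eta^{-k})]}{\hat J},\quad \hat J=K^{-1}\sum_kP_n^k[\psi_a(O;\hat\eta^{-k})],\quad \hat\sigma^2=\hat J^{-2}K^{-1}\sum_kP_n^k[\psi(O;\hat\tau,\hat\eta^{-k})^2].$$ *Nuisance conditions.* Let $\|\cdot\|$ be the $L^2$ norm under the law of $X$ given $E_e+C=1$. For every $k$: 1. $\big\|\tfrac{p}{1-p}-\tfrac{\hat p^{-k}}{1-\hat p^{-k}}\big\|\,\|m-\hat m^{-k}\|=o_P(n^{-1/2})$ and $\big\|\tfrac{p}{1-p}-\tfrac{\hat p^{-k}}{1-\hat p^{-k}}\big\|\,\|g-\hat g^{-k}\|=o_P(n^{-1/2})$; 2. $\big\|\tfrac{p}{1-p}-\tfrac{\hat p^{-k}}{1-\hat p^{-k}}\big\|=o_P(1)$, and $\|\psi_j(\cdot;\hat\eta^{-k})-\psi_j(\cdot;\eta_0)\|_{2,P}=o_P(1)$ for $j=a,b$; 3. in case (A) only, $\hat\rho_c^{-k}-\int C\frac{\hat p^{-k}(X)}{1-\hat p^{-k}(X)}\,dP=O_P(n^{-1/2})$,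 where $\hat p^{-k}$ is held fixed in the integral. *Conclusion.* $\tau_0=LATT$, $J_0:=E[\psi_a(O;\eta_0)]\ne0$, $E[\psi(O;\tau_0,\eta_0)^2]<\infty$, and as $n=KN\to\infty$ $$\sqrt n(\hat\tau-\tau_0)\overset d\to N(0,\sigma^2),\qquad \sigma^2=J_0^{-2}E[\psi(O;\tau_0,\eta_0)^2],\qquad \hat\sigma^2\overset P\to\sigma^2.$$ If $\sigma^2>0$, then for every $\alpha\in(0,1)$ the interval $[\hat\tau\pm\Phi^{-1}(1-\alpha/2)\hat\sigma/\sqrt n]$ contains $\tau_0$ with probability tending to $1-\alpha$, where $\Phi^{-1}$ is the standard normal quantile function. -/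

import Mathlib

open MeasureTheory ProbabilityTheory Filter Topology
open scoped ENNReal NNReal

noncomputable section

namespace IDiD

/-! ### Periods, paths, cohorts and control groups -/

/-- The periods `1, …, T`. -/
abbrev Period (T : ℕ) := {t : ℕ // t ∈ Finset.Icc 1 T}

/-- The preceding period (only ever used at periods `≥ 2`; period `1` is sent to itself). -/
def Period.prev {T : ℕ} (t : Period T) : Period T :=
  ⟨max 1 ((t : ℕ) - 1), by
    have h := Finset.mem_Icc.mp t.2
    exact Finset.mem_Icc.mpr ⟨le_max_left _ _, max_le (h.1.trans h.2) (by omega)⟩⟩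

/-- Binary (treatment or instrument) paths. -/
abbrev Path (T : ℕ) := Period T → Bool

/-- Exposure cohorts: a period, or `⊤` (that is, `∞`) for never exposed. -/
abbrev Cohort (T : ℕ) := WithTop (Period T)

/-- `E = min {t | Z_t = 1}`, with value `⊤` if the instrument never switches on. -/
def exposure {T : ℕ} (z : Path T) : Cohort T :=
  (Finset.univ.filter fun t : Period T => z t = true).min

/-- The numerical value of a binary variable. -/
def num (b : Bool) : ℝ := if b then 1 else 0

/-- The two choices of control group: never-exposed and not-yet-exposed. -/
inductive ControlGroup
  | never
  | notYet

/-- The event `C = 1` in terms of the instrument path: `E = ∞` for `C^nev`;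
`E ≠ e` and `Z_s = 0` for `C^nye_{e,s}`. -/
def IsControl {T : ℕ} (c : ControlGroup) (e s : Period T) (z : Path T) : Prop :=
  match c with
  | .never => exposure z = ⊤
  | .notYet => exposure z ≠ (e : Cohort T) ∧ z s = false

/-- `E_e = 1{E = e}`. -/
def cohortInd {T : ℕ} (e : Period T) (z : Path T) : ℝ :=
  if exposure z = (e : Cohort T) then 1 else 0

open Classical in
/-- The control indicator `C`. -/
def controlInd {T : ℕ} (c : ControlGroup) (e s : Period T) (z : Path T) : ℝ :=
  if IsControl c e s z then 1 else 0

/-! ### The population -/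

/-- Latent variables of a unit: covariates `X`, instrument `Z_t`, potential treatments `D_t(e)`
(with `e = ⊤` for `D_t(∞)`), path-indexed potential outcomes `Y_t(d, z)`, and potential outcomes
`Y_t(0)`, `Y_t(1)` indexed by the current treatment only. -/
structure Model (T : ℕ) (S 𝒳 : Type*) where
  X : S → 𝒳
  Z : Period T → S → Bool
  Dpot : Cohort T → Period T → S → Bool
  Ypath : Path T → Path T → Period T → S → ℝ
  Y : Bool → Period T → S → ℝ

/-- Panel observations `(Y_1, …, Y_T)`, `(D_1, …, D_T)`, `(Z_1, …, Z_T)`, `X`. Under staggered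
adoption the instrument path carries the same information as `(E_2, …, E_T, C^nev)`. -/
abbrev Obs (T : ℕ) (𝒳 : Type*) := (Period T → ℝ) × Path T × Path T × 𝒳

section Population

variable {T : ℕ} {S 𝒳 : Type*} [MeasurableSpace S] [MeasurableSpace 𝒳]

/-- All latent variables are random variables. -/
structure Model.IsMeasurable (M : Model T S 𝒳) : Prop where
  X : Measurable M.X
  Z : ∀ t, Measurable (M.Z t)
  Dpot : ∀ e t, Measurable (M.Dpot e t)
  Ypath : ∀ d z t, Measurable (M.Ypath d z t)
  Y : ∀ b t, Measurable (M.Y b t)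

/-- The instrument path. -/
def Model.zPath (M : Model T S 𝒳) (s : S) : Path T := fun t => M.Z t s

/-- The cohort exposure variable `E`. -/
def Model.E (M : Model T S 𝒳) (s : S) : Cohort T := exposure (M.zPath s)

/-- The event `E = v`. -/
def Model.cohortEvent (M : Model T S 𝒳) (v : Cohort T) : Set S := {s | M.E s = v}

/-- The event `C = 1`. -/
def Model.controlEvent (M : Model T S 𝒳) (c : ControlGroup) (e s : Period T) : Set S :=
  {ω | IsControl c e s (M.zPath ω)}

/-- The comparison slice `E_e + C = 1`. -/
def Model.slice (M : Model T S 𝒳) (c : ControlGroup) (e s : Period T) : Set S :=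
  M.cohortEvent e ∪ M.controlEvent c e s

/-- The observed treatment path, `D_t = D_t(∞) + ∑_e [D_t(e) - D_t(∞)] 1{E = e}`. -/
def Model.dPath (M : Model T S 𝒳) (s : S) : Path T := fun t => M.Dpot (M.E s) t s

/-- The observed outcome `Y_t = Y_t(D, Z)`. -/
def Model.yPath (M : Model T S 𝒳) (s : S) : Period T → ℝ :=
  fun t => M.Ypath (M.dPath s) (M.zPath s) t s

/-- The observed data of a unit. -/
def Model.obs (M : Model T S 𝒳) (s : S) : Obs T 𝒳 := (M.yPath s, M.dPath s, M.zPath s, M.X s)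

/-- The outcome `Y_t(D_t(v))` under exposure in cohort `v`. -/
def Model.exposedY (M : Model T S 𝒳) (v : Cohort T) (t : Period T) (s : S) : ℝ :=
  M.Y (M.Dpot v t s) t s

/-- The cohorts that can be studied: the support of `E` without its largest element. -/
def Model.cohorts (M : Model T S 𝒳) (P : Measure S) : Set (Period T) :=
  {e | P (M.cohortEvent e) ≠ 0 ∧ ∃ v : Cohort T, (e : Cohort T) < v ∧ P (M.cohortEvent v) ≠ 0}

/-- The regression function `x ↦ E[V | X = x, A]`. -/
def condMean (P : Measure S) (X : S → 𝒳) (A : Set S) (V : S → ℝ) (x : 𝒳) : ℝ :=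
  ∫ v, v ∂(condDistrib V X (P[|A]) x)

/-! ### Identifying assumptions -/

/-- Staggered adoption: `Z_1 = 0`, and `Z_{t-1} = 1` implies `Z_t = 1`. -/
def Model.StaggeredAdoption (M : Model T S 𝒳) (P : Measure S) : Prop :=
  (∀ t : Period T, (t : ℕ) = 1 → ∀ᵐ s ∂P, M.Z t s = false) ∧
  ∀ t : Period T, 2 ≤ (t : ℕ) → ∀ᵐ s ∂P, M.Z t.prev s = true → M.Z t s = true

/-- No carryover and exclusion restriction: `Y_t(d, z) = Y_t(d_t)` for all `d`, `z` in the supports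
of the treatment and instrument paths. -/
def Model.NoCarryover (M : Model T S 𝒳) (P : Measure S) : Prop :=
  ∀ z : Path T, P {s | M.zPath s = z} ≠ 0 → ∀ d : Path T, P {s | M.dPath s = d} ≠ 0 →
    ∀ t : Period T, ∀ᵐ s ∂P, M.Ypath d z t s = M.Y (d t) t s

/-- Monotonicity: `P(D_t(e) ≥ D_t(∞) | X) = 1` for all studied cohorts `e` and all `t ≥ e`. -/
def Model.Monotonicity (M : Model T S 𝒳) (P : Measure S) : Prop :=
  ∀ e ∈ M.cohorts P, ∀ t : Period T, e ≤ t →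
    P⟦{s | M.Dpot ⊤ t s ≤ M.Dpot e t s} | MeasurableSpace.comap M.X inferInstance⟧ =ᵐ[P]
      fun _ => 1

/-- No anticipation: in each finite cohort `e` of the support of `E`, before the exposure date `e`,
exposure changes neither the conditional mean of the treatment nor that of the exposed outcome. -/
def Model.NoAnticipation (M : Model T S 𝒳) (P : Measure S) : Prop :=
  ∀ e : Period T, P (M.cohortEvent e) ≠ 0 → ∀ t : Period T, t < e →
    (∀ᵐ s ∂(P[|M.cohortEvent e]),
      condMean P M.X (M.cohortEvent e) (fun s => num (M.Dpot e t s)) (M.X s) =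
        condMean P M.X (M.cohortEvent e) (fun s => num (M.Dpot ⊤ t s)) (M.X s)) ∧
    (∀ᵐ s ∂(P[|M.cohortEvent e]),
      condMean P M.X (M.cohortEvent e) (M.exposedY e t) (M.X s) =
        condMean P M.X (M.cohortEvent e) (M.exposedY ⊤ t) (M.X s))

/-- Conditional parallel trends, in the treatment and in the unexposed outcome, between cohort `e`
and the control group `C` (for `notYet`, `C = C^nye_{e,t}`), from period `e` up to period `t`. -/
def Model.ParallelTrends (M : Model T S 𝒳) (P : Measure S) (c : ControlGroup)
    (e t : Period T) : Prop :=
  ∀ u : Period T, e ≤ u → u ≤ t →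
    (∀ᵐ s ∂(P[|M.cohortEvent e]),
      condMean P M.X (M.cohortEvent e)
          (fun s => num (M.Dpot ⊤ u s) - num (M.Dpot ⊤ u.prev s)) (M.X s) =
        condMean P M.X (M.controlEvent c e t)
          (fun s => num (M.Dpot ⊤ u s) - num (M.Dpot ⊤ u.prev s)) (M.X s)) ∧
    (∀ᵐ s ∂(P[|M.cohortEvent e]),
      condMean P M.X (M.cohortEvent e)
          (fun s => M.exposedY ⊤ u s - M.exposedY ⊤ u.prev s) (M.X s) =
        condMean P M.X (M.controlEvent c e t)
          (fun s => M.exposedY ⊤ u s - M.exposedY ⊤ u.prev s) (M.X s))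

/-- The generalized propensity score `p(x) = P(E_e = 1 | X = x, E_e + C = 1)`. -/
def Model.propensity (M : Model T S 𝒳) (P : Measure S) (c : ControlGroup) (e t : Period T) :
    𝒳 → ℝ :=
  condMean P M.X (M.slice c e t) (fun s => cohortInd e (M.zPath s))

/-- Overlap: the cohort has positive probability, and the generalized propensity score is
bounded away from one on the comparison slice. -/
def Model.Overlap (M : Model T S 𝒳) (P : Measure S) (c : ControlGroup) (e t : Period T) : Prop :=
  ∃ δ : ℝ, 0 < δ ∧ δ < P.real (M.cohortEvent e) ∧
    ∀ᵐ s ∂(P[|M.slice c e t]), M.propensity P c e t (M.X s) < 1 - δ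

/-! ### Parameters -/

/-- `Δ_{t-e+1} V_t = V_t - V_{e-1}` for the observed outcome. -/
def Model.deltaY (M : Model T S 𝒳) (e t : Period T) (s : S) : ℝ := M.yPath s t - M.yPath s e.prev

/-- `Δ_{t-e+1} D_t` for the observed treatment. -/
def Model.deltaD (M : Model T S 𝒳) (e t : Period T) (s : S) : ℝ :=
  num (M.dPath s t) - num (M.dPath s e.prev)

/-- `LATT(e, t) = E[Y_t(1) - Y_t(0) | E_e = 1, D_t(e) > D_t(∞)]`. -/
def Model.LATT (M : Model T S 𝒳) (P : Measure S) (e t : Period T) : ℝ :=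
  ∫ s, (M.Y true t s - M.Y false t s)
    ∂(P[|M.cohortEvent e ∩ {s | M.Dpot ⊤ t s < M.Dpot e t s}])

/-- The mean functions `m^trt`, `g^trt`, `m^c`, `g^c`. -/
def Model.mTrt (M : Model T S 𝒳) (P : Measure S) (e t : Period T) : 𝒳 → ℝ :=
  condMean P M.X (M.cohortEvent e) (M.deltaY e t)

def Model.gTrt (M : Model T S 𝒳) (P : Measure S) (e t : Period T) : 𝒳 → ℝ :=
  condMean P M.X (M.cohortEvent e) (M.deltaD e t)

def Model.mCtl (M : Model T S 𝒳) (P : Measure S) (c : ControlGroup) (e t : Period T) : 𝒳 → ℝ :=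
  condMean P M.X (M.controlEvent c e t) (M.deltaY e t)

def Model.gCtl (M : Model T S 𝒳) (P : Measure S) (c : ControlGroup) (e t : Period T) : 𝒳 → ℝ :=
  condMean P M.X (M.controlEvent c e t) (M.deltaD e t)

/-- The identified parameter
`τ = E[m^trt(X) - m^c(X) | E_e = 1] / E[g^trt(X) - g^c(X) | E_e = 1]`. -/
def Model.tau (M : Model T S 𝒳) (P : Measure S) (c : ControlGroup) (e t : Period T) : ℝ :=
  (∫ s, (M.mTrt P e t (M.X s) - M.mCtl P c e t (M.X s)) ∂(P[|M.cohortEvent e])) /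
    (∫ s, (M.gTrt P e t (M.X s) - M.gCtl P c e t (M.X s)) ∂(P[|M.cohortEvent e]))

end Population

/-! ### The score -/

/-- A value of the nuisance: the denominators of the treated and of the control weight, the
propensity score, and the control mean functions of outcome and treatment. -/
structure Nuisance (𝒳 : Type*) where
  rhoTrt : ℝ
  rhoCtl : ℝ
  p : 𝒳 → ℝ
  m : 𝒳 → ℝ
  g : 𝒳 → ℝ

/-- The odds `p / (1 - p)`. -/
def odds (q : ℝ) : ℝ := q / (1 - q)

section Score

variable {T : ℕ} {𝒳 : Type*}

/-- The unnormalized control weight `C p(X) / (1 - p(X))`. -/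
def rawCtl (c : ControlGroup) (e t : Period T) (p : 𝒳 → ℝ) (o : Obs T 𝒳) : ℝ :=
  controlInd c e t o.2.2.1 * odds (p o.2.2.2)

/-- `w^trt - w^c`. -/
def weightDiff (c : ControlGroup) (e t : Period T) (η : Nuisance 𝒳) (o : Obs T 𝒳) : ℝ :=
  cohortInd e o.2.2.1 / η.rhoTrt - rawCtl c e t η.p o / η.rhoCtl

/-- `ψ_b = {w^trt - w^c} {Δ_{t-e+1} Y_t - m^c(X)}`. -/
def psiB (c : ControlGroup) (e t : Period T) (η : Nuisance 𝒳) (o : Obs T 𝒳) : ℝ :=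
  weightDiff c e t η o * (o.1 t - o.1 e.prev - η.m o.2.2.2)

/-- `ψ_a = {w^trt - w^c} {Δ_{t-e+1} D_t - g^c(X)}`. -/
def psiA (c : ControlGroup) (e t : Period T) (η : Nuisance 𝒳) (o : Obs T 𝒳) : ℝ :=
  weightDiff c e t η o * (num (o.2.1 t) - num (o.2.1 e.prev) - η.g o.2.2.2)

/-- The score `ψ(O; τ, η) = ψ_b(O; η) - τ ψ_a(O; η)`. -/
def psi (c : ControlGroup) (e t : Period T) (τ : ℝ) (η : Nuisance 𝒳) (o : Obs T 𝒳) : ℝ :=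
  psiB c e t η o - τ * psiA c e t η o

end Score

section Truth

variable {T : ℕ} {S 𝒳 : Type*} [MeasurableSpace S] [MeasurableSpace 𝒳]

/-- The law of the observed data. -/
def Model.law (M : Model T S 𝒳) (P : Measure S) : Measure (Obs T 𝒳) := P.map M.obs

/-- The true nuisance `η_0`. -/
def Model.eta (M : Model T S 𝒳) (P : Measure S) (c : ControlGroup) (e t : Period T) :
    Nuisance 𝒳 where
  rhoTrt := ∫ o, cohortInd e o.2.2.1 ∂(M.law P)
  rhoCtl := ∫ o, rawCtl c e t (M.propensity P c e t) o ∂(M.law P)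
  p := M.propensity P c e t
  m := M.mCtl P c e t
  g := M.gCtl P c e t

/-- `J_0 = E[ψ_a(O; η_0)]`. -/
def Model.J (M : Model T S 𝒳) (P : Measure S) (c : ControlGroup) (e t : Period T) : ℝ :=
  ∫ o, psiA c e t (M.eta P c e t) o ∂(M.law P)

/-- `σ² = J_0⁻² E[ψ(O; τ_0, η_0)²]`. -/
def Model.sigmaSq (M : Model T S 𝒳) (P : Measure S) (c : ControlGroup) (e t : Period T) : ℝ :=
  (M.J P c e t ^ 2)⁻¹ * ∫ o, psi c e t (M.tau P c e t) (M.eta P c e t) o ^ 2 ∂(M.law P)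

end Truth

/-! ### Cross-fitting -/

/-- A learner on a training sample indexed by `ι`: estimators of the propensity score and of the
two control mean functions, as measurable functions of the training data and of the covariates. -/
structure Learner (T : ℕ) (𝒳 : Type*) [MeasurableSpace 𝒳] (ι : Type) where
  p : (ι → Obs T 𝒳) → 𝒳 → ℝ
  m : (ι → Obs T 𝒳) → 𝒳 → ℝ
  g : (ι → Obs T 𝒳) → 𝒳 → ℝ
  measurable_p : Measurable (Function.uncurry p)
  measurable_m : Measurable (Function.uncurry m)
  measurable_g : Measurable (Function.uncurry g)

/-- The sample on which the denominators of the weights of fold `k` are computed: the training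
folds (all observations outside fold `k`), or the evaluation fold `k` itself. -/
inductive Normalization
  | trainingFolds
  | evaluationFold

/-- The data-splitting and learning scheme for samples of size `n = K N`, `N = 0, 1, 2, …`:
a partition into `K` folds of equal size `N`, and, for every fold, learners that are trained on the
observations outside this fold. -/
structure CrossFit (T K : ℕ) (𝒳 : Type*) [MeasurableSpace 𝒳] where
  fold : ∀ N : ℕ, Fin (K * N) → Fin K
  card_fold : ∀ (N : ℕ) (k : Fin K), (Finset.univ.filter fun i => fold N i = k).card = N
  learner : ∀ (N : ℕ) (k : Fin K), Learner T 𝒳 {i : Fin (K * N) // fold N i ≠ k}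
  normalization : Normalization

namespace CrossFit

variable {T K : ℕ} {𝒳 : Type*} [MeasurableSpace 𝒳]

/-- The training data of fold `k`. -/
def train (F : CrossFit T K 𝒳) (N : ℕ) (k : Fin K) (w : ℕ → Obs T 𝒳) :
    {i : Fin (K * N) // F.fold N i ≠ k} → Obs T 𝒳 := fun i => w i.1

/-- The empirical mean `P_n^k f` over fold `k`. -/
def foldMean (F : CrossFit T K 𝒳) (N : ℕ) (k : Fin K) (w : ℕ → Obs T 𝒳) (f : Obs T 𝒳 → ℝ) : ℝ :=
  (∑ i ∈ Finset.univ.filter (fun i => F.fold N i = k), f (w i)) / N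

/-- The empirical mean over all observations outside fold `k`. -/
def trainMean (F : CrossFit T K 𝒳) (N : ℕ) (k : Fin K) (w : ℕ → Obs T 𝒳) (f : Obs T 𝒳 → ℝ) : ℝ :=
  (∑ i ∈ Finset.univ.filter (fun i => F.fold N i ≠ k), f (w i)) /
    (Finset.univ.filter (fun i => F.fold N i ≠ k)).card

/-- The empirical mean that normalizes the weights of fold `k`. -/
def normMean (F : CrossFit T K 𝒳) (N : ℕ) (k : Fin K) (w : ℕ → Obs T 𝒳) (f : Obs T 𝒳 → ℝ) : ℝ :=
  match F.normalization with
  | .trainingFolds => F.trainMean N k w f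
  | .evaluationFold => F.foldMean N k w f

/-- The estimated nuisance `η̂^{-k}`. -/
def etaHat (F : CrossFit T K 𝒳) (c : ControlGroup) (e t : Period T) (N : ℕ) (k : Fin K)
    (w : ℕ → Obs T 𝒳) : Nuisance 𝒳 where
  rhoTrt := F.normMean N k w fun o => cohortInd e o.2.2.1
  rhoCtl := F.normMean N k w (rawCtl c e t ((F.learner N k).p (F.train N k w)))
  p := (F.learner N k).p (F.train N k w)
  m := (F.learner N k).m (F.train N k w)
  g := (F.learner N k).g (F.train N k w)

/-- `K⁻¹ ∑_k P_n^k [f(O; η̂^{-k})]`. -/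
def crossMean (F : CrossFit T K 𝒳) (c : ControlGroup) (e t : Period T) (N : ℕ)
    (w : ℕ → Obs T 𝒳) (f : Nuisance 𝒳 → Obs T 𝒳 → ℝ) : ℝ :=
  (K : ℝ)⁻¹ * ∑ k : Fin K, F.foldMean N k w (f (F.etaHat c e t N k w))

/-- `Ĵ_0`. -/
def JHat (F : CrossFit T K 𝒳) (c : ControlGroup) (e t : Period T) (N : ℕ) (w : ℕ → Obs T 𝒳) : ℝ :=
  F.crossMean c e t N w (psiA c e t)

/-- The DML2 estimator, the solution `τ` of `K⁻¹ ∑_k P_n^k [ψ(O; τ, η̂^{-k})] = 0`. -/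
def tauHat (F : CrossFit T K 𝒳) (c : ControlGroup) (e t : Period T) (N : ℕ)
    (w : ℕ → Obs T 𝒳) : ℝ :=
  F.crossMean c e t N w (psiB c e t) / F.JHat c e t N w

/-- The plug-in variance estimator `σ̂²`. -/
def sigmaSqHat (F : CrossFit T K 𝒳) (c : ControlGroup) (e t : Period T) (N : ℕ)
    (w : ℕ → Obs T 𝒳) : ℝ :=
  (F.JHat c e t N w ^ 2)⁻¹ *
    F.crossMean c e t N w fun η o => psi c e t (F.tauHat c e t N w) η o ^ 2

end CrossFit

/-- The quantile function `Φ⁻¹` of the standard normal distribution. -/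
def normalQuantile (u : ℝ) : ℝ := sInf {x : ℝ | u ≤ cdf (gaussianReal 0 1) x}

/-- The confidence interval `[τ̂ ± Φ⁻¹(1 - α/2) σ̂ / √n]` at sample size `n = K N`. -/
def CrossFit.confInt {T K : ℕ} {𝒳 : Type*} [MeasurableSpace 𝒳] (F : CrossFit T K 𝒳)
    (c : ControlGroup) (e t : Period T) (α : ℝ) (N : ℕ) (w : ℕ → Obs T 𝒳) : Set ℝ :=
  Set.Icc
    (F.tauHat c e t N w -
      normalQuantile (1 - α / 2) * √(F.sigmaSqHat c e t N w) / √((K * N : ℕ) : ℝ))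
    (F.tauHat c e t N w +
      normalQuantile (1 - α / 2) * √(F.sigmaSqHat c e t N w) / √((K * N : ℕ) : ℝ))

/-! ### Stochastic orders and conditions on the nuisance estimators -/

/-- `U_N = o_P(1)`, for nonnegative extended real random quantities. -/
def LittleOP {Ω : Type*} [MeasurableSpace Ω] (Q : Measure Ω) (U : ℕ → Ω → ℝ≥0∞) : Prop :=
  ∀ ε : ℝ≥0∞, 0 < ε → Tendsto (fun N => Q {ω | ε ≤ U N ω}) atTop (𝓝 0)

/-- `U_N = O_P(1)`. -/
def BigOP {Ω : Type*} [MeasurableSpace Ω] (Q : Measure Ω) (U : ℕ → Ω → ℝ≥0∞) : Prop :=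
  ∀ ε : ℝ≥0∞, 0 < ε → ∃ B : ℝ≥0, ∀ᶠ N in atTop, Q {ω | (B : ℝ≥0∞) < U N ω} ≤ ε

section Conditions

variable {T K : ℕ} {S 𝒳 Ω : Type*} [MeasurableSpace S] [MeasurableSpace 𝒳] [MeasurableSpace Ω]

/-- The `L²` norm of a function of the covariates under the law of `X` on the comparison slice. -/
def Model.covNorm (M : Model T S 𝒳) (P : Measure S) (c : ControlGroup) (e t : Period T)
    (f : 𝒳 → ℝ) : ℝ≥0∞ :=
  eLpNorm (fun s => f (M.X s)) 2 (P[|M.slice c e t])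

/-- `‖p/(1-p) - p̂/(1-p̂)‖` for the nuisance value `η̂`. -/
def Model.oddsError (M : Model T S 𝒳) (P : Measure S) (c : ControlGroup) (e t : Period T)
    (η : Nuisance 𝒳) : ℝ≥0∞ :=
  M.covNorm P c e t fun x => odds (M.propensity P c e t x) - odds (η.p x)

/-- The second-order rate condition, in every fold:
`‖p/(1-p) - p̂/(1-p̂)‖ ‖m - m̂‖ = o_P(n^{-1/2})` and the same with `g`. -/
def SecondOrderRate (M : Model T S 𝒳) (P : Measure S) (c : ControlGroup) (e t : Period T)
    (F : CrossFit T K 𝒳) (Q : Measure Ω) (O : ℕ → Ω → Obs T 𝒳) : Prop :=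
  ∀ k : Fin K,
    (LittleOP Q fun N ω =>
      ENNReal.ofReal √((K * N : ℕ) : ℝ) *
        (M.oddsError P c e t (F.etaHat c e t N k (O · ω)) *
          M.covNorm P c e t fun x =>
            M.mCtl P c e t x - (F.etaHat c e t N k (O · ω)).m x)) ∧
    (LittleOP Q fun N ω =>
      ENNReal.ofReal √((K * N : ℕ) : ℝ) *
        (M.oddsError P c e t (F.etaHat c e t N k (O · ω)) *
          M.covNorm P c e t fun x =>
            M.gCtl P c e t x - (F.etaHat c e t N k (O · ω)).g x))

/-- `L²` consistency, in every fold, of the estimated odds and of the two estimated score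
components. -/
def L2Consistency (M : Model T S 𝒳) (P : Measure S) (c : ControlGroup) (e t : Period T)
    (F : CrossFit T K 𝒳) (Q : Measure Ω) (O : ℕ → Ω → Obs T 𝒳) : Prop :=
  ∀ k : Fin K,
    (LittleOP Q fun N ω => M.oddsError P c e t (F.etaHat c e t N k (O · ω))) ∧
    (LittleOP Q fun N ω =>
      eLpNorm (fun o => psiA c e t (F.etaHat c e t N k (O · ω)) o -
        psiA c e t (M.eta P c e t) o) 2 (M.law P)) ∧
    (LittleOP Q fun N ω =>
      eLpNorm (fun o => psiB c e t (F.etaHat c e t N k (O · ω)) o -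
        psiB c e t (M.eta P c e t) o) 2 (M.law P))

/-- The empirical denominator of the control weight fluctuates by `O_P(n^{-1/2})` around the
expectation of the estimated unnormalized control weight, in every fold. -/
def WeightFluctuation (M : Model T S 𝒳) (P : Measure S) (c : ControlGroup) (e t : Period T)
    (F : CrossFit T K 𝒳) (Q : Measure Ω) (O : ℕ → Ω → Obs T 𝒳) : Prop :=
  ∀ k : Fin K, BigOP Q fun N ω =>
    ENNReal.ofReal (√((K * N : ℕ) : ℝ) *
      |(F.etaHat c e t N k (O · ω)).rhoCtl -
        ∫ o, rawCtl c e t (F.etaHat c e t N k (O · ω)).p o ∂(M.law P)|)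

end Conditions

end IDiD

end

open IDiD

/-! Identification. Let W_u(v) be either the potential treatment in period u under exposure in
cohort v, or the outcome that this treatment induces. By no anticipation, the observed variable of
cohort v has, in every period before v, the conditional mean of W_u(∞). Under staggered adoption the
control group is almost surely a union of cohorts later than t, so its observed change from e-1 to t
has the regression of the change of W(∞). Parallel trends, telescoped over the periods e, ..., t,
carry this regression over to cohort e. The integrated difference of the two regressions is
therefore the mean of W_t(e) - W_t(∞) in cohort e (`setIntegral_condMean_diff`). By monotonicity
this is the probability of the compliers for the treatment, and the integral of Y_t(1) - Y_t(0) over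
the compliers for the outcome; the ratio is LATT (`tau_eq_LATT`).

Orthogonality. Let G and C be the group indicators, r the odds, V the change of outcome or
treatment, f its control regression, and q, u the estimates of r, f. Odds weighting gives E[G h(X)]
= E[C r(X) h(X)] (`setLIntegral_odds`), so both weights have the same population denominator ρ.
Within C the residual V - f is orthogonal to functions of X. Hence replacing (r, f) by (q, u) biases
the control term by E[G (f - u)] + E[C (q - r)(f - u)] (`Regression.integral_sub_eq`). The second
summand is a product of errors. The first is also the bias of the treated term and cancels against
it, except that the two are divided by different estimated denominators. These differ by
O_P(n^{-1/2}) plus at most the odds error, and they multiply the vanishing E[G (f - u)], so the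
remainder is again o_P(n^{-1/2}) (`FittedRegression.tendsto_sqrt_bias`).

Cross-fitting. Given the training folds, the estimated terms are fixed functions that are L²-close
to the true ones, and Chebyshev's inequality removes their centred empirical means
(`Split.tendsto_sqrt_avg_sub_integral`). The denominators may depend on the evaluation fold, so they
stay outside as scalar factors. Replacing them by ρ costs nothing to first order, because C r (V -
f) has mean zero, and so does G (V - f) once τ times its treatment analogue is subtracted
(`tendsto_sqrt_avg_score_sub`).

Conclusion. The ratio estimator is asymptotically linear, and the central limit theorem and
Slutsky's lemma give normality (`OrthogonalMoments.tendstoInDistribution_ratio`). Closeness of the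
scores in empirical L² together with the law of large numbers gives the variance
(`OrthogonalMoments.tendsto_variance`), and the coverage follows by continuous mapping
(`tendsto_coverage`). Throughout, o_P statements are limits along the filter `inProb`, so that they
combine by ordinary limit algebra. -/

namespace IDiD

/-! ### Convergence in probability as convergence along a filter -/

section InProb

variable {Ω : Type*} [MeasurableSpace Ω] {Q : Measure Ω}

/-- The filter of the sets `S ⊆ ℕ × Ω` whose sections have outer probability tending to one.
Convergence in probability is convergence along this filter. -/
def inProb (Q : Measure Ω) : Filter (ℕ × Ω) where
  sets := {S | Tendsto (fun N => Q {ω | (N, ω) ∉ S}) atTop (𝓝 0)}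
  univ_sets := by simp
  sets_of_superset {A B} hA hAB := by
    refine tendsto_of_tendsto_of_tendsto_of_le_of_le tendsto_const_nhds hA (fun _ => zero_le)
      fun N => measure_mono fun ω hω h => hω (hAB h)
  inter_sets {A B} hA hB := by
    have h := Tendsto.add hA hB
    rw [add_zero] at h
    refine tendsto_of_tendsto_of_tendsto_of_le_of_le tendsto_const_nhds h (fun _ => zero_le)
      fun N => (measure_mono fun ω hω => ?_).trans (measure_union_le _ _)
    by_cases h : (N, ω) ∈ A
    · exact Or.inr fun h' => hω ⟨h, h'⟩
    · exact Or.inl h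

lemma eventually_inProb {p : ℕ × Ω → Prop} :
    (∀ᶠ x in inProb Q, p x) ↔ Tendsto (fun N => Q {ω | ¬ p (N, ω)}) atTop (𝓝 0) := Iff.rfl

lemma tendsto_fst_inProb : Tendsto (Prod.fst : ℕ × Ω → ℕ) (inProb Q) atTop := by
  refine tendsto_atTop.2 fun b => eventually_inProb.2 ?_
  refine tendsto_const_nhds.congr' ?_
  filter_upwards [eventually_ge_atTop b] with N hN
  simp [hN]

lemma littleOP_iff_tendsto {U : ℕ → Ω → ℝ≥0∞} :
    LittleOP Q U ↔ Tendsto (fun x : ℕ × Ω => U x.1 x.2) (inProb Q) (𝓝 0) := by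
  constructor
  · intro h
    rw [ENNReal.tendsto_nhds_zero]
    intro ε hε
    refine eventually_inProb.2 (tendsto_of_tendsto_of_tendsto_of_le_of_le tendsto_const_nhds
      (h ε hε) (fun _ => zero_le) fun N => measure_mono fun ω hω => ?_)
    exact (not_le.1 hω).le
  · intro h ε hε
    have h1 := (tendsto_order.1 h).2 ε hε
    refine (eventually_inProb.1 h1).congr fun N => ?_
    simp

lemma tendstoInMeasure_iff_inProb {f : ℕ → Ω → ℝ} {a : ℝ} :
    TendstoInMeasure Q f atTop (fun _ => a) ↔
      Tendsto (fun x : ℕ × Ω => f x.1 x.2) (inProb Q) (𝓝 a) := by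
  rw [tendsto_iff_edist_tendsto_0]
  exact littleOP_iff_tendsto (U := fun N ω => edist (f N ω) a)

/-- Boundedness in probability. -/
def StochBdd (Q : Measure Ω) (f : ℕ × Ω → ℝ) : Prop :=
  ∀ ε : ℝ≥0∞, 0 < ε → ∃ B : ℝ, ∀ᶠ N in atTop, Q {ω | B < |f (N, ω)|} ≤ ε

/-- The rule O_P(1) · o_P(1) = o_P(1). Outside an event of small probability |f| is at most B, and
then the product can reach η only if |g| reaches η / B. -/
lemma StochBdd.mul_tendsto_zero {f g : ℕ × Ω → ℝ} (hf : StochBdd Q f)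
    (hg : Tendsto g (inProb Q) (𝓝 0)) : Tendsto (fun x => f x * g x) (inProb Q) (𝓝 0) := by
  rw [Metric.tendsto_nhds]
  intro η hη
  refine eventually_inProb.2 ?_
  rw [ENNReal.tendsto_nhds_zero]
  intro ε hε
  obtain ⟨B, hB⟩ := hf (ε / 2) (ENNReal.half_pos hε.ne')
  -- The bound B may fail to be positive, so it is raised to at least 1 before dividing by it.
  have hB' : 0 < max B 1 := lt_max_of_lt_right one_pos
  have h1 := eventually_inProb.1 ((Metric.tendsto_nhds.1 hg) (η / max B 1) (by positivity))
  filter_upwards [hB, ENNReal.tendsto_nhds_zero.1 h1 (ε / 2) (ENNReal.half_pos hε.ne')]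
    with N hN1 hN2
  calc _ ≤ Q ({ω | B < |f (N, ω)|} ∪ {ω | ¬ dist (g (N, ω)) 0 < η / max B 1}) := by
        refine measure_mono fun ω hω => ?_
        by_contra hcon
        simp only [Set.mem_union, Set.mem_ofPred_eq, not_or, not_lt, dist_zero_right,
          Real.norm_eq_abs] at hcon hω
        refine absurd hω (not_le.2 ?_)
        rw [abs_mul]
        calc |f (N, ω)| * |g (N, ω)| ≤ max B 1 * |g (N, ω)| := by
              gcongr; exact hcon.1.trans (le_max_left _ _)
          _ < max B 1 * (η / max B 1) := by gcongr; exact not_le.1 hcon.2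
          _ = η := by field_simp
    _ ≤ ε / 2 + ε / 2 := (measure_union_le _ _).trans (add_le_add hN1 hN2)
    _ = ε := ENNReal.add_halves ε

lemma StochBdd.mono {f g : ℕ × Ω → ℝ} (hg : StochBdd Q g) (h : ∀ x, |f x| ≤ |g x|) :
    StochBdd Q f := fun ε hε => by
  obtain ⟨B, hB⟩ := hg ε hε
  refine ⟨B, hB.mono fun N hN => (measure_mono fun ω hω => ?_).trans hN⟩
  exact lt_of_lt_of_le hω (h _)

lemma StochBdd.add {f g : ℕ × Ω → ℝ} (hf : StochBdd Q f) (hg : StochBdd Q g) :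
    StochBdd Q (fun x => f x + g x) := fun ε hε => by
  obtain ⟨B, hB⟩ := hf (ε / 2) (ENNReal.half_pos hε.ne')
  obtain ⟨B', hB'⟩ := hg (ε / 2) (ENNReal.half_pos hε.ne')
  refine ⟨B + B', ?_⟩
  filter_upwards [hB, hB'] with N h1 h2
  calc _ ≤ Q ({ω | B < |f (N, ω)|} ∪ {ω | B' < |g (N, ω)|}) := by
        refine measure_mono fun ω hω => ?_
        by_contra hcon
        simp only [Set.mem_union, Set.mem_ofPred_eq, not_or, not_lt] at hcon hω
        linarith [abs_add_le (f (N, ω)) (g (N, ω))]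
    _ ≤ ε / 2 + ε / 2 := (measure_union_le _ _).trans (add_le_add h1 h2)
    _ = ε := ENNReal.add_halves ε

lemma StochBdd.const_mul {f : ℕ × Ω → ℝ} (hf : StochBdd Q f) (a : ℝ) :
    StochBdd Q (fun x => a * f x) := fun ε hε => by
  obtain ⟨B, hB⟩ := hf ε hε
  refine ⟨|a| * B, hB.mono fun N hN => (measure_mono fun ω hω => ?_).trans hN⟩
  simp only [Set.mem_ofPred_eq, abs_mul] at hω ⊢
  exact lt_of_mul_lt_mul_left hω (abs_nonneg a)

lemma stochBdd_of_tendsto {f : ℕ × Ω → ℝ} {a : ℝ} (hf : Tendsto f (inProb Q) (𝓝 a)) :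
    StochBdd Q f := fun ε hε => by
  refine ⟨|a| + 1, ?_⟩
  have h := eventually_inProb.1 ((Metric.tendsto_nhds.1 hf) 1 one_pos)
  filter_upwards [ENNReal.tendsto_nhds_zero.1 h ε hε] with N hN
  refine (measure_mono fun ω hω => ?_).trans hN
  simp only [Set.mem_ofPred_eq, not_lt, Real.dist_eq] at hω ⊢
  linarith [abs_sub_abs_le_abs_sub (f (N, ω)) a]

lemma stochBdd_of_bigOP {f : ℕ × Ω → ℝ} :
    BigOP Q (fun N ω => ENNReal.ofReal |f (N, ω)|) → StochBdd Q f := fun h ε hε => by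
  obtain ⟨B, hB⟩ := h ε hε
  refine ⟨B, hB.mono fun N hN => (measure_mono fun ω hω => ?_).trans hN⟩
  simp only [Set.mem_ofPred_eq] at hω ⊢
  rw [← ENNReal.ofReal_coe_nnreal]
  exact (ENNReal.ofReal_lt_ofReal_iff_of_nonneg B.2).2 hω

/-- Bounds of Markov type yield boundedness in probability. -/
lemma stochBdd_of_measure_le {f : ℕ × Ω → ℝ} {C : ℝ≥0∞} (hC : C ≠ ∞)
    (h : ∀ N, ∀ a : ℝ, 0 < a → Q {ω | a ≤ |f (N, ω)|} ≤ C / ENNReal.ofReal a) :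
    StochBdd Q f := fun ε hε => by
  have h1 : Tendsto (fun a : ℝ => C / ENNReal.ofReal a) atTop (𝓝 (C / ∞)) := by
    have := (ENNReal.tendsto_ofReal_atTop)
    exact ENNReal.Tendsto.const_div this (Or.inr hC)
  rw [ENNReal.div_top] at h1
  obtain ⟨a, ha, ha0⟩ :=
    ((ENNReal.tendsto_nhds_zero.1 h1 ε hε).and (eventually_gt_atTop 0)).exists
  exact ⟨a, Eventually.of_forall fun N =>
    (measure_mono fun ω (hω : a < |f (N, ω)|) => hω.le).trans ((h N a ha0).trans ha)⟩

/-- A random quantity with a `√N`-bounded fluctuation converges in probability. -/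
lemma tendsto_of_stochBdd_sqrt_mul {f : ℕ × Ω → ℝ}
    (h : StochBdd Q fun x => √(x.1 : ℝ) * f x) : Tendsto f (inProb Q) (𝓝 0) := by
  have h1 : Tendsto (fun x : ℕ × Ω => (√(x.1 : ℝ))⁻¹) (inProb Q) (𝓝 0) :=
    (tendsto_inv_atTop_zero.comp
      (Real.tendsto_sqrt_atTop.comp tendsto_natCast_atTop_atTop)).comp tendsto_fst_inProb
  refine (h.mul_tendsto_zero h1).congr' ?_
  filter_upwards [tendsto_fst_inProb.eventually (eventually_gt_atTop 0)] with x hx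
  have : √(x.1 : ℝ) ≠ 0 := (Real.sqrt_pos.2 (by exact_mod_cast hx)).ne'
  field_simp

end InProb

/-! ### Empirical means of independent observations -/

section Empirical

variable {Ω 𝒪 : Type*}

/-- The empirical mean of `f` over the observations with index in `s`. -/
noncomputable def avg (s : Finset ℕ) (w : ℕ → 𝒪) (f : 𝒪 → ℝ) : ℝ := (∑ i ∈ s, f (w i)) / s.card

lemma avg_add (s : Finset ℕ) (w : ℕ → 𝒪) (f g : 𝒪 → ℝ) :
    avg s w (fun o => f o + g o) = avg s w f + avg s w g := by
  simp [avg, Finset.sum_add_distrib, add_div]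

lemma avg_sub (s : Finset ℕ) (w : ℕ → 𝒪) (f g : 𝒪 → ℝ) :
    avg s w (fun o => f o - g o) = avg s w f - avg s w g := by
  simp [avg, Finset.sum_sub_distrib, sub_div]

lemma avg_const_mul (s : Finset ℕ) (w : ℕ → 𝒪) (a : ℝ) (f : 𝒪 → ℝ) :
    avg s w (fun o => a * f o) = a * avg s w f := by
  simp [avg, ← Finset.mul_sum, mul_div_assoc]

lemma avg_nonneg (s : Finset ℕ) (w : ℕ → 𝒪) {f : 𝒪 → ℝ} (hf : ∀ o, 0 ≤ f o) :
    0 ≤ avg s w f := div_nonneg (Finset.sum_nonneg fun _ _ => hf _) (Nat.cast_nonneg _)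

lemma avg_mono (s : Finset ℕ) (w : ℕ → 𝒪) {f g : 𝒪 → ℝ} (hf : ∀ o, f o ≤ g o) :
    avg s w f ≤ avg s w g := by
  unfold avg; gcongr; exact hf _

lemma sum_attach_val (s : Finset ℕ) (w : ℕ → 𝒪) (f : 𝒪 → ℝ) :
    ∑ i : s, f (w i) = ∑ i ∈ s, f (w i) :=
  Finset.sum_coe_sort s fun i => f (w i)

variable [MeasurableSpace Ω] [MeasurableSpace 𝒪] {Q : Measure Ω} {ν : Measure 𝒪}

lemma sq_eLpNorm_two {α : Type*} [MeasurableSpace α] (μ : Measure α) (f : α → ℝ) :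
    eLpNorm f 2 μ ^ 2 = ∫⁻ o, ‖f o‖ₑ ^ 2 ∂μ := by
  have := eLpNorm_nnreal_pow_eq_lintegral (f := f) (μ := μ) (p := 2) two_ne_zero
  simpa using this

lemma ofReal_integral_sq {α : Type*} [MeasurableSpace α] {μ : Measure α} {f : α → ℝ}
    (hf : MemLp f 2 μ) : ENNReal.ofReal (∫ o, f o ^ 2 ∂μ) = eLpNorm f 2 μ ^ 2 := by
  rw [sq_eLpNorm_two, ofReal_integral_eq_lintegral_ofReal hf.integrable_sq
    (ae_of_all _ fun o => sq_nonneg _)]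
  refine lintegral_congr fun o => ?_
  rw [← enorm_pow, Real.enorm_eq_ofReal (sq_nonneg _)]

variable {O : ℕ → Ω → 𝒪}

lemma memLp_obs (hO : ∀ i, Measurable (O i)) (hlaw : ∀ i, Q.map (O i) = ν) {f : 𝒪 → ℝ}
    {p : ℝ≥0∞} (hf : MemLp f p ν) (i : ℕ) : MemLp (fun ω => f (O i ω)) p Q := by
  have : MemLp f p (Q.map (O i)) := by rwa [hlaw i]
  exact this.comp_of_map (hO i).aemeasurable

lemma integral_obs (hO : ∀ i, Measurable (O i)) (hlaw : ∀ i, Q.map (O i) = ν) {f : 𝒪 → ℝ}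
    (hf : Measurable f) (i : ℕ) : ∫ ω, f (O i ω) ∂Q = ∫ o, f o ∂ν := by
  rw [← hlaw i, integral_map (hO i).aemeasurable hf.aestronglyMeasurable]

/-- Chebyshev's inequality for empirical means. -/
lemma measure_avg_sub_integral_ge [IsProbabilityMeasure Q]
    (hO : ∀ i, Measurable (O i)) (hindep : iIndepFun O Q)
    (hlaw : ∀ i, Q.map (O i) = ν) {f : 𝒪 → ℝ} (hfm : Measurable f) (hf : MemLp f 2 ν)
    (s : Finset ℕ) {a : ℝ} (ha : 0 < a) :
    Q {ω | a ≤ |√(s.card : ℝ) * (avg s (O · ω) f - ∫ o, f o ∂ν)|} ≤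
      eLpNorm f 2 ν ^ 2 / ENNReal.ofReal a ^ 2 := by
  -- For an empty sample the scaled deviation carries the factor √0, so the event is empty.
  rcases s.eq_empty_or_nonempty with rfl | hs
  · simp [not_le.2 ha]
  have hcard : (0 : ℝ) < s.card := by exact_mod_cast hs.card_pos
  set X : ℕ → Ω → ℝ := fun i ω => f (O i ω)
  have hX : ∀ i, MemLp (X i) 2 Q := memLp_obs hO hlaw hf
  have hint : ∀ i, ∫ ω, X i ω ∂Q = ∫ o, f o ∂ν := integral_obs hO hlaw hfm
  -- The second moment replaces the variance so that the final bound is an L² norm, the quantity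
  -- that the consistency hypotheses control.
  have hvar : ∀ i, variance (X i) Q ≤ ∫ o, f o ^ 2 ∂ν := fun i => by
    refine (variance_le_expectation_sq (hX i).1).trans_eq ?_
    exact integral_obs hO hlaw (hfm.pow_const 2) i
  have hsum : MemLp (∑ i ∈ s, X i) 2 Q := memLp_finsetSum' s fun i _ => hX i
  have hmean : ∫ ω, (∑ i ∈ s, X i) ω ∂Q = s.card * ∫ o, f o ∂ν := by
    simp only [Finset.sum_apply]
    rw [integral_finsetSum _ fun i _ => (hX i).integrable one_le_two]
    simp [hint]
  have hvarsum : variance (∑ i ∈ s, X i) Q ≤ s.card * ∫ o, f o ^ 2 ∂ν := by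
    rw [IndepFun.variance_sum (fun i _ => hX i)
      fun i _ j _ hij => (hindep.indepFun hij).comp hfm hfm]
    exact (Finset.sum_le_sum fun i _ => hvar i).trans (by simp)
  have hset : {ω | a ≤ |√(s.card : ℝ) * (avg s (O · ω) f - ∫ o, f o ∂ν)|} =
      {ω | a * √(s.card : ℝ) ≤ |(∑ i ∈ s, X i) ω - ∫ ω, (∑ i ∈ s, X i) ω ∂Q|} := by
    ext ω
    have : (∑ i ∈ s, X i) ω - ∫ ω, (∑ i ∈ s, X i) ω ∂Q =
        √(s.card : ℝ) * (√(s.card : ℝ) * (avg s (O · ω) f - ∫ o, f o ∂ν)) := by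
      rw [hmean, ← mul_assoc, Real.mul_self_sqrt hcard.le, avg, Finset.sum_apply]
      field_simp
      rfl
    rw [Set.mem_ofPred_eq, Set.mem_ofPred_eq, this, abs_mul (√(s.card : ℝ)) (√(s.card : ℝ) * _),
      abs_of_nonneg (Real.sqrt_nonneg _), mul_comm a]
    exact (mul_le_mul_iff_right₀ (Real.sqrt_pos.2 hcard)).symm
  rw [hset]
  refine (meas_ge_le_variance_div_sq hsum (by positivity)).trans ?_
  rw [← ofReal_integral_sq hf, ← ENNReal.ofReal_pow ha.le,
    ← ENNReal.ofReal_div_of_pos (by positivity)]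
  refine ENNReal.ofReal_le_ofReal ?_
  rw [mul_pow, Real.sq_sqrt hcard.le, div_le_div_iff₀ (by positivity) (by positivity)]
  nlinarith [mul_le_mul_of_nonneg_right hvarsum (sq_nonneg a)]

/-- Markov's inequality for empirical means. -/
lemma measure_avg_abs_ge (hO : ∀ i, Measurable (O i))
    (hlaw : ∀ i, Q.map (O i) = ν) {f : 𝒪 → ℝ} (hfm : Measurable f)
    (s : Finset ℕ) {a : ℝ} (ha : 0 < a) :
    Q {ω | a ≤ avg s (O · ω) fun o => |f o|} ≤ (∫⁻ o, ‖f o‖ₑ ∂ν) / ENNReal.ofReal a := by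
  rcases s.eq_empty_or_nonempty with rfl | hs
  · simp [avg, not_le.2 ha]
  have hcard : (0 : ℝ) < s.card := by exact_mod_cast hs.card_pos
  have hmeas : Measurable fun ω => ∑ i ∈ s, ‖f (O i ω)‖ₑ :=
    Finset.measurable_fun_sum _ fun i _ => (hfm.comp (hO i)).enorm
  have hle : ∀ ω, a ≤ avg s (O · ω) (fun o => |f o|) →
      (s.card : ℝ≥0∞) * ENNReal.ofReal a ≤ ∑ i ∈ s, ‖f (O i ω)‖ₑ := fun ω hω => by
    rw [avg, le_div_iff₀ hcard, mul_comm] at hω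
    have : ∑ i ∈ s, ‖f (O i ω)‖ₑ = ENNReal.ofReal (∑ i ∈ s, |f (O i ω)|) := by
      rw [ENNReal.ofReal_sum_of_nonneg fun i _ => abs_nonneg _]
      exact Finset.sum_congr rfl fun i _ => by rw [← Real.norm_eq_abs, ofReal_norm]
    rw [this, ← ENNReal.ofReal_natCast, ← ENNReal.ofReal_mul hcard.le]
    exact ENNReal.ofReal_le_ofReal hω
  have hint : ∫⁻ ω, ∑ i ∈ s, ‖f (O i ω)‖ₑ ∂Q = s.card * ∫⁻ o, ‖f o‖ₑ ∂ν := by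
    rw [lintegral_finsetSum s (f := fun i ω => ‖f (O i ω)‖ₑ)
      fun i _ => (hfm.comp (hO i)).enorm]
    have : ∀ i, ∫⁻ ω, ‖f (O i ω)‖ₑ ∂Q = ∫⁻ o, ‖f o‖ₑ ∂ν := fun i => by
      rw [← hlaw i, lintegral_map hfm.enorm (hO i)]
    simp [this]
  have hc0 : (s.card : ℝ≥0∞) ≠ 0 := by exact_mod_cast hs.card_pos.ne'
  have ha0 : ENNReal.ofReal a ≠ 0 := by simpa using ha
  calc _ ≤ Q {ω | (s.card : ℝ≥0∞) * ENNReal.ofReal a ≤ ∑ i ∈ s, ‖f (O i ω)‖ₑ} :=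
        measure_mono hle
    _ ≤ (s.card * ∫⁻ o, ‖f o‖ₑ ∂ν) / (s.card * ENNReal.ofReal a) := by
        rw [← hint]
        exact meas_ge_le_lintegral_div hmeas.aemeasurable (mul_ne_zero hc0 ha0)
          (ENNReal.mul_ne_top (ENNReal.natCast_ne_top _) ENNReal.ofReal_ne_top)
    _ = _ := ENNReal.mul_div_mul_left _ _ hc0 (ENNReal.natCast_ne_top _)

/-- Sections of small probability: if `W` and `V` are independent and the sections of `S` over `G`
have probability at most `a`, then so has the event `W ∈ G`, `(W, V) ∈ S`. -/
lemma measure_section_le {α β : Type*} [MeasurableSpace α] [MeasurableSpace β]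
    [IsProbabilityMeasure Q] {W : Ω → α} {V : Ω → β} (hW : Measurable W) (hV : Measurable V)
    (hWV : IndepFun W V Q) {S : Set (α × β)} (hS : MeasurableSet S) {G : Set α}
    (hG : MeasurableSet G) {a : ℝ≥0∞} (h : ∀ w ∈ G, Q {ω | (w, V ω) ∈ S} ≤ a) :
    Q {ω | W ω ∈ G ∧ (W ω, V ω) ∈ S} ≤ a := by
  have hprod := (indepFun_iff_map_prod_eq_prod_map_map hW.aemeasurable hV.aemeasurable).1 hWV
  have : IsProbabilityMeasure (Q.map W) := Measure.isProbabilityMeasure_map hW.aemeasurable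
  have : IsProbabilityMeasure (Q.map V) := Measure.isProbabilityMeasure_map hV.aemeasurable
  have hmeas : MeasurableSet (Prod.fst ⁻¹' G ∩ S) := (measurable_fst hG).inter hS
  have h1 : Q {ω | W ω ∈ G ∧ (W ω, V ω) ∈ S} =
      Q.map (fun ω => (W ω, V ω)) (Prod.fst ⁻¹' G ∩ S) := by
    rw [Measure.map_apply (hW.prodMk hV) hmeas]; rfl
  -- By independence the joint law is a product, so the probability is the average over W of the
  -- section probabilities; sections outside G are empty.
  rw [h1, hprod, Measure.prod_apply hmeas]
  calc _ ≤ ∫⁻ _, a ∂(Q.map W) := by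
        refine lintegral_mono fun w => ?_
        by_cases hw : w ∈ G
        · rw [Measure.map_apply hV (measurable_prodMk_left hmeas)]
          exact (measure_mono fun ω hω => hω.2).trans (h w hw)
        · have : Prod.mk w ⁻¹' (Prod.fst ⁻¹' G ∩ S) = ∅ := by ext v; simp [hw]
          simp [this]
    _ = a := by simp

/-- Only a lower bound on the sample size is required, so the same statement serves a single fold,
its complement and the full sample. -/
lemma stochBdd_sqrt_avg_sub_integral [IsProbabilityMeasure Q] (hO : ∀ i, Measurable (O i))
    (hindep : iIndepFun O Q)
    (hlaw : ∀ i, Q.map (O i) = ν) {f : 𝒪 → ℝ} (hfm : Measurable f) (hf : MemLp f 2 ν)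
    {s : ℕ → Finset ℕ} (hs : ∀ N, N ≤ (s N).card) :
    StochBdd Q fun x => √(x.1 : ℝ) * (avg (s x.1) (O · x.2) f - ∫ o, f o ∂ν) := by
  have h1 : StochBdd Q fun x : ℕ × Ω =>
      √((s x.1).card : ℝ) * (avg (s x.1) (O · x.2) f - ∫ o, f o ∂ν) := by
    intro ε hε
    have h1 : Tendsto (fun a : ℝ => eLpNorm f 2 ν ^ 2 / ENNReal.ofReal a ^ 2) atTop (𝓝 0) := by
      have h2 : Tendsto (fun a : ℝ => ENNReal.ofReal a ^ 2) atTop (𝓝 ∞) := by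
        have := ENNReal.tendsto_ofReal_atTop.comp (tendsto_pow_atTop (α := ℝ) two_ne_zero)
        refine this.congr' ?_
        filter_upwards [eventually_ge_atTop 0] with a ha
        simp [ENNReal.ofReal_pow ha]
      have := ENNReal.Tendsto.const_div h2 (a := eLpNorm f 2 ν ^ 2)
        (Or.inr (ENNReal.pow_ne_top hf.2.ne))
      rwa [ENNReal.div_top] at this
    obtain ⟨a, ha, ha0⟩ :=
      ((ENNReal.tendsto_nhds_zero.1 h1 ε hε).and (eventually_gt_atTop 0)).exists
    refine ⟨a, Eventually.of_forall fun N => le_trans (measure_mono fun ω hω => ?_)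
      ((measure_avg_sub_integral_ge hO hindep hlaw hfm hf (s N) ha0).trans ha)⟩
    exact le_of_lt (Set.mem_ofPred_eq ▸ hω)
  refine h1.mono fun x => ?_
  rw [abs_mul, abs_mul, abs_of_nonneg (Real.sqrt_nonneg _), abs_of_nonneg (Real.sqrt_nonneg _)]
  gcongr
  exact hs x.1

lemma stochBdd_avg_abs (hO : ∀ i, Measurable (O i))
    (hlaw : ∀ i, Q.map (O i) = ν) {f : 𝒪 → ℝ} (hfm : Measurable f) (hf : Integrable f ν)
    (s : ℕ → Finset ℕ) :
    StochBdd Q fun x => avg (s x.1) (O · x.2) fun o => |f o| := by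
  refine stochBdd_of_measure_le hf.2.ne fun N a ha => ?_
  have h : ∀ ω, |avg (s N) (O · ω) (fun o => |f o|)| = avg (s N) (O · ω) (fun o => |f o|) :=
    fun ω => abs_of_nonneg (avg_nonneg _ _ fun o => abs_nonneg _)
  simp only [h]
  exact measure_avg_abs_ge hO hlaw hfm (s N) ha

/-! ### Empirical means of functions fitted on independent training data. -/

/-- A sequence of evaluation samples `s N` together with training data `W N` that are independent
of the observations in `s N`. -/
structure Split (Q : Measure Ω) (O : ℕ → Ω → 𝒪) (s : ℕ → Finset ℕ) (𝒲 : ℕ → Type*)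
    [∀ N, MeasurableSpace (𝒲 N)] (W : ∀ N, Ω → 𝒲 N) : Prop where
  card : ∀ N, (s N).card = N
  measurable : ∀ N, Measurable (W N)
  indep : ∀ N, IndepFun (W N) (fun ω (i : s N) => O i ω) Q

variable {s : ℕ → Finset ℕ} {𝒲 : ℕ → Type*} [∀ N, MeasurableSpace (𝒲 N)] {W : ∀ N, Ω → 𝒲 N}
  {φ : ∀ N, 𝒲 N → 𝒪 → ℝ} [IsProbabilityMeasure Q] [IsProbabilityMeasure ν]

/-- Makes the set of training data with small L² error measurable, as `measure_section_le` requires.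
-/
lemma measurable_eLpNorm_section {α : Type*} [MeasurableSpace α] {f : α → 𝒪 → ℝ}
    (hf : Measurable (Function.uncurry f)) :
    Measurable fun w => eLpNorm (f w) 2 ν := by
  have h : ∀ w, eLpNorm (f w) 2 ν = (∫⁻ o, ‖f w o‖ₑ ^ 2 ∂ν) ^ ((1 : ℝ) / 2) := fun w => by
    rw [← sq_eLpNorm_two, ← ENNReal.rpow_natCast, ← ENNReal.rpow_mul]
    simp
  simp_rw [h]
  have : Measurable fun w => ∫⁻ o, ‖f w o‖ₑ ^ 2 ∂ν :=
    (hf.enorm.pow_const 2).lintegral_prod_right'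
  exact this.pow_const _

lemma measurable_uncurry_avg {α : Type*} [MeasurableSpace α] {f : α → 𝒪 → ℝ}
    (hf : Measurable (Function.uncurry f)) (s : Finset ℕ) :
    Measurable fun x : α × (s → 𝒪) => (∑ i : s, f x.1 (x.2 i)) / (s.card : ℝ) := by
  refine Measurable.div_const (Finset.measurable_fun_sum _ fun i _ => ?_) _
  exact hf.comp (measurable_fst.prodMk ((measurable_pi_apply i).comp measurable_snd))

/-- Conditionally on the training data, a score that is small in `L²` has a negligible empirical
process. -/
lemma Split.tendsto_sqrt_avg_sub_integral (hsp : Split Q O s 𝒲 W)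
    (hO : ∀ i, Measurable (O i)) (hindep : iIndepFun O Q) (hlaw : ∀ i, Q.map (O i) = ν)
    (hφ : ∀ N, Measurable (Function.uncurry (φ N)))
    (h : Tendsto (fun x : ℕ × Ω => eLpNorm (φ x.1 (W x.1 x.2)) 2 ν) (inProb Q) (𝓝 0)) :
    Tendsto (fun x : ℕ × Ω => √(x.1 : ℝ) * (avg (s x.1) (O · x.2) (φ x.1 (W x.1 x.2)) -
      ∫ o, φ x.1 (W x.1 x.2) o ∂ν)) (inProb Q) (𝓝 0) := by
  rw [Metric.tendsto_nhds]
  intro a ha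
  refine eventually_inProb.2 ?_
  rw [ENNReal.tendsto_nhds_zero]
  intro ε hε
  have ha' : ENNReal.ofReal a ≠ 0 := by simpa using ha
  -- A function of L² norm at most η has Chebyshev bound η² / a²; η is chosen to make this at most ε
  -- / 2.
  obtain ⟨η, hη, hηle⟩ : ∃ η : ℝ≥0∞, 0 < η ∧ η ≠ ∞ ∧ η ^ 2 / ENNReal.ofReal a ^ 2 ≤ ε / 2 := by
    have h1 : Tendsto (fun η : ℝ≥0∞ => η ^ 2 / ENNReal.ofReal a ^ 2) (𝓝 0) (𝓝 0) := by
      have := ENNReal.Tendsto.div_const (((ENNReal.continuous_pow 2).tendsto 0))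
        (b := ENNReal.ofReal a ^ 2) (Or.inr (pow_ne_zero 2 ha'))
      simpa using this
    have h2 := ENNReal.tendsto_nhds_zero.1 h1 (ε / 2) (ENNReal.half_pos hε.ne')
    obtain ⟨δ, hδ, hδ'⟩ := (ENNReal.nhds_zero_basis_Iic.mem_iff).1 h2
    -- The cap 1 keeps η finite, so that every section over the good set lies in L².
    refine ⟨min δ 1, lt_min hδ one_pos, ?_, hδ' (Set.mem_Iic.2 (min_le_left δ 1))⟩
    exact ((min_le_right δ 1).trans_lt ENNReal.one_lt_top).ne
  have h1 := eventually_inProb.1 (ENNReal.tendsto_nhds_zero.1 h η hη)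
  filter_upwards [ENNReal.tendsto_nhds_zero.1 h1 (ε / 2) (ENNReal.half_pos hε.ne')] with N hN
  -- The event is written as a set in (training data, evaluation sample), so that independence
  -- allows the training data to be frozen.
  let S : Set (𝒲 N × (s N → 𝒪)) := {x | a ≤ |√(N : ℝ) *
    ((∑ i : s N, φ N x.1 (x.2 i)) / ((s N).card : ℝ) - ∫ o, φ N x.1 o ∂ν)|}
  have hint : Measurable fun w => ∫ o, φ N w o ∂ν :=
    ((hφ N).stronglyMeasurable.integral_prod_right (ν := ν)).measurable
  have hS : MeasurableSet S := by
    refine measurableSet_le measurable_const (Measurable.abs ?_)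
    exact (((measurable_uncurry_avg (hφ N) (s N)).sub (hint.comp measurable_fst))).const_mul _
  let G : Set (𝒲 N) := {w | eLpNorm (φ N w) 2 ν ≤ η}
  have hG : MeasurableSet G :=
    measurableSet_le (measurable_eLpNorm_section (hφ N)) measurable_const
  have hV : Measurable fun ω (i : s N) => O i ω := measurable_pi_lambda _ fun i => hO i
  have hsec := measure_section_le (hsp.measurable N) hV (hsp.indep N) hS hG
    (a := η ^ 2 / ENNReal.ofReal a ^ 2) fun w hw => by
      have hm : Measurable (φ N w) := (hφ N).comp measurable_prodMk_left
      have hL : MemLp (φ N w) 2 ν := ⟨hm.aestronglyMeasurable, hw.trans_lt hηle.1.lt_top⟩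
      have := measure_avg_sub_integral_ge hO hindep hlaw hm hL (s N) ha
      rw [hsp.card N] at this
      refine le_trans (le_of_eq ?_) (this.trans ?_)
      · congr 1
        ext ω
        simp only [S, Set.mem_ofPred_eq, avg, sum_attach_val (s N) (O · ω) (φ N w)]
      · gcongr; exact hw
  calc _ ≤ Q ({ω | ¬ eLpNorm (φ N (W N ω)) 2 ν ≤ η} ∪
        {ω | W N ω ∈ G ∧ (W N ω, fun i : s N => O i ω) ∈ S}) := by
        refine measure_mono fun ω hω => ?_
        by_cases hw : eLpNorm (φ N (W N ω)) 2 ν ≤ η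
        · refine Or.inr ⟨hw, ?_⟩
          simp only [Set.mem_ofPred_eq, not_lt, dist_zero_right, Real.norm_eq_abs, avg] at hω
          simp only [S, Set.mem_ofPred_eq]
          rw [sum_attach_val (s N) (O · ω) (φ N (W N ω))]
          exact hω
        · exact Or.inl hw
    _ ≤ ε / 2 + ε / 2 := (measure_union_le _ _).trans (add_le_add hN (hsec.trans hηle.2))
    _ = ε := ENNReal.add_halves ε

/-- Conditionally on the training data, a function that is small in `L²` has a small empirical
second moment. -/
lemma Split.tendsto_avg_sq (hsp : Split Q O s 𝒲 W)
    (hO : ∀ i, Measurable (O i)) (hlaw : ∀ i, Q.map (O i) = ν)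
    (hφ : ∀ N, Measurable (Function.uncurry (φ N)))
    (h : Tendsto (fun x : ℕ × Ω => eLpNorm (φ x.1 (W x.1 x.2)) 2 ν) (inProb Q) (𝓝 0)) :
    Tendsto (fun x : ℕ × Ω => avg (s x.1) (O · x.2) fun o => φ x.1 (W x.1 x.2) o ^ 2)
      (inProb Q) (𝓝 0) := by
  rw [Metric.tendsto_nhds]
  intro a ha
  refine eventually_inProb.2 ?_
  rw [ENNReal.tendsto_nhds_zero]
  intro ε hε
  have ha' : ENNReal.ofReal a ≠ 0 := by simpa using ha
  obtain ⟨η, hη, hηle⟩ : ∃ η : ℝ≥0∞, 0 < η ∧ η ^ 2 / ENNReal.ofReal a ≤ ε / 2 := by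
    have h1 : Tendsto (fun η : ℝ≥0∞ => η ^ 2 / ENNReal.ofReal a) (𝓝 0) (𝓝 0) := by
      have := ENNReal.Tendsto.div_const (((ENNReal.continuous_pow 2).tendsto 0))
        (b := ENNReal.ofReal a) (Or.inr ha')
      simpa using this
    have h2 := ENNReal.tendsto_nhds_zero.1 h1 (ε / 2) (ENNReal.half_pos hε.ne')
    obtain ⟨δ, hδ, hδ'⟩ := (ENNReal.nhds_zero_basis_Iic.mem_iff).1 h2
    exact ⟨δ, hδ, hδ' (Set.mem_Iic.2 le_rfl)⟩
  have h1 := eventually_inProb.1 (ENNReal.tendsto_nhds_zero.1 h η hη)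
  filter_upwards [ENNReal.tendsto_nhds_zero.1 h1 (ε / 2) (ENNReal.half_pos hε.ne')] with N hN
  have hφ2 : Measurable (Function.uncurry fun w o => φ N w o ^ 2) := (hφ N).pow_const 2
  let S : Set (𝒲 N × (s N → 𝒪)) := {x | a ≤ (∑ i : s N, φ N x.1 (x.2 i) ^ 2) / ((s N).card : ℝ)}
  have hS : MeasurableSet S := measurableSet_le measurable_const (measurable_uncurry_avg hφ2 (s N))
  let G : Set (𝒲 N) := {w | eLpNorm (φ N w) 2 ν ≤ η}
  have hG : MeasurableSet G :=
    measurableSet_le (measurable_eLpNorm_section (hφ N)) measurable_const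
  have hV : Measurable fun ω (i : s N) => O i ω := measurable_pi_lambda _ fun i => hO i
  have hsec := measure_section_le (hsp.measurable N) hV (hsp.indep N) hS hG
    (a := η ^ 2 / ENNReal.ofReal a) fun w hw => by
      have hm : Measurable fun o => φ N w o ^ 2 := hφ2.comp measurable_prodMk_left
      refine le_trans (le_of_eq ?_) ((measure_avg_abs_ge hO hlaw hm (s N) ha).trans ?_)
      · congr 1
        ext ω
        simp only [S, Set.mem_ofPred_eq, avg, abs_pow, sq_abs,
          sum_attach_val (s N) (O · ω) fun o => φ N w o ^ 2]
      · have : ∫⁻ o, ‖φ N w o ^ 2‖ₑ ∂ν = eLpNorm (φ N w) 2 ν ^ 2 := by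
          rw [sq_eLpNorm_two]; simp
        rw [this]
        gcongr; exact hw
  calc _ ≤ Q ({ω | ¬ eLpNorm (φ N (W N ω)) 2 ν ≤ η} ∪
        {ω | W N ω ∈ G ∧ (W N ω, fun i : s N => O i ω) ∈ S}) := by
        refine measure_mono fun ω hω => ?_
        by_cases hw : eLpNorm (φ N (W N ω)) 2 ν ≤ η
        · refine Or.inr ⟨hw, ?_⟩
          simp only [Set.mem_ofPred_eq, not_lt, dist_zero_right, Real.norm_eq_abs] at hω
          rw [abs_of_nonneg (avg_nonneg _ _ fun o => sq_nonneg _), avg] at hω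
          simp only [S, Set.mem_ofPred_eq]
          rw [sum_attach_val (s N) (O · ω) fun o => φ N (W N ω) o ^ 2]
          exact hω
        · exact Or.inl hw
    _ ≤ ε / 2 + ε / 2 := (measure_union_le _ _).trans (add_le_add hN (hsec.trans hηle))
    _ = ε := ENNReal.add_halves ε

end Empirical

end IDiD

namespace IDiD

/-! ### `L²` tools -/

section Tools

variable {α : Type*} [MeasurableSpace α] {μ : Measure α}

lemma eLpNorm_lincomb_le {f g : α → ℝ} (hf : AEStronglyMeasurable f μ)
    (hg : AEStronglyMeasurable g μ) (a b : ℝ) :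
    eLpNorm (fun o => a * f o + b * g o) 2 μ ≤ ‖a‖ₑ * eLpNorm f 2 μ + ‖b‖ₑ * eLpNorm g 2 μ := by
  rw [← eLpNorm_const_smul a f, ← eLpNorm_const_smul b g]
  exact eLpNorm_add_le (hf.const_smul a) (hg.const_smul b) one_le_two

lemma lintegral_enorm_mul_le {f g : α → ℝ} (hf : AEStronglyMeasurable f μ)
    (hg : AEStronglyMeasurable g μ) :
    ∫⁻ o, ‖f o * g o‖ₑ ∂μ ≤ eLpNorm f 2 μ * eLpNorm g 2 μ := by
  have h := eLpNorm_smul_le_mul_eLpNorm (p := 2) (q := 2) (r := 1) hg hf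
  rwa [eLpNorm_one_eq_lintegral_enorm] at h

lemma lintegral_enorm_le_eLpNorm_two [IsProbabilityMeasure μ] {f : α → ℝ}
    (hf : AEStronglyMeasurable f μ) : ∫⁻ o, ‖f o‖ₑ ∂μ ≤ eLpNorm f 2 μ := by
  rw [← eLpNorm_one_eq_lintegral_enorm]
  exact eLpNorm_le_eLpNorm_of_exponent_le one_le_two hf

lemma sq_sub_add_sub_le (a b c d : ℝ) :
    (a - b + c - d) ^ 2 ≤ 4 * (a ^ 2 + b ^ 2 + (c ^ 2 + d ^ 2)) := by
  nlinarith [sq_nonneg (a + b), sq_nonneg (a - c), sq_nonneg (a + d), sq_nonneg (b + c),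
    sq_nonneg (b - d), sq_nonneg (c + d)]

variable {β : Type*} {l : Filter β}

lemma tendsto_zero_of_enorm_le {f : β → ℝ} {U : β → ℝ≥0∞} (hU : Tendsto U l (𝓝 0))
    (h : ∀ᶠ x in l, ‖f x‖ₑ ≤ U x) : Tendsto f l (𝓝 0) := by
  rw [tendsto_zero_iff_enorm_tendsto_zero]
  exact tendsto_of_tendsto_of_tendsto_of_le_of_le' tendsto_const_nhds hU
    (Eventually.of_forall fun _ => zero_le) h

lemma tendsto_enorm_mul_zero {a : β → ℝ} {a₀ : ℝ} {U : β → ℝ≥0∞} (ha : Tendsto a l (𝓝 a₀))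
    (hU : Tendsto U l (𝓝 0)) : Tendsto (fun x => ‖a x‖ₑ * U x) l (𝓝 0) := by
  have := ENNReal.Tendsto.mul (ha.enorm) (Or.inr ENNReal.zero_ne_top) hU (Or.inr enorm_ne_top)
  simpa using this

lemma tendsto_enorm_zero_mul {a : β → ℝ} {u : ℝ≥0∞} (ha : Tendsto a l (𝓝 0)) (hu : u ≠ ∞) :
    Tendsto (fun x => ‖a x‖ₑ * u) l (𝓝 0) := by
  have := ENNReal.Tendsto.mul (ha.enorm) (Or.inr hu) (tendsto_const_nhds (x := u))
    (Or.inr enorm_ne_top)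
  simpa using this

end Tools

/-! ### Balancing weights and control regressions -/

section Score

variable {𝒪 𝒳 : Type*} [MeasurableSpace 𝒪] [MeasurableSpace 𝒳]

/-- Indicators `G`, `C` of disjoint groups and a weight `r` of the covariates such that `C r`
balances the covariates of group `C` with those of group `G`. -/
structure Balanced (ν : Measure 𝒪) (G C : 𝒪 → ℝ) (cov : 𝒪 → 𝒳) (r : 𝒳 → ℝ) (B ρ : ℝ) :
    Prop where
  measurable_G : Measurable G
  measurable_C : Measurable C
  measurable_cov : Measurable cov
  measurable_r : Measurable r
  G_eq : ∀ o, G o = 0 ∨ G o = 1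
  C_eq : ∀ o, C o = 0 ∨ C o = 1
  disjoint : ∀ o, G o = 0 ∨ C o = 0
  nonneg : ∀ᵐ o ∂ν, 0 ≤ C o * r (cov o)
  le : ∀ᵐ o ∂ν, C o * r (cov o) ≤ B
  lintegral_eq : ∀ h : 𝒳 → ℝ≥0∞, Measurable h →
    ∫⁻ o, ENNReal.ofReal (G o) * h (cov o) ∂ν =
      ∫⁻ o, ENNReal.ofReal (C o * r (cov o)) * h (cov o) ∂ν
  pos : 0 < ρ
  integral_G : ∫ o, G o ∂ν = ρ

/-- `f` is the regression of `V` on the covariates in group `C`. -/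
structure Regression (ν : Measure 𝒪) (G C : 𝒪 → ℝ) (cov : 𝒪 → 𝒳) (V : 𝒪 → ℝ) (f : 𝒳 → ℝ) :
    Prop where
  measurable_V : Measurable V
  measurable_f : Measurable f
  memLp_G : MemLp (fun o => G o * (V o - f (cov o))) 2 ν
  memLp_C : MemLp (fun o => C o * (V o - f (cov o))) 2 ν
  orthogonal : ∀ h : 𝒳 → ℝ, Measurable h → MemLp (fun o => C o * h (cov o)) 2 ν →
    ∫ o, C o * h (cov o) * (V o - f (cov o)) ∂ν = 0

variable {ν : Measure 𝒪} {G C : 𝒪 → ℝ} {cov : 𝒪 → 𝒳} {r : 𝒳 → ℝ} {B ρ : ℝ} {V : 𝒪 → ℝ}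
  {f : 𝒳 → ℝ}

namespace Balanced

lemma G_nonneg (hb : Balanced ν G C cov r B ρ) (o : 𝒪) : 0 ≤ G o := by
  rcases hb.G_eq o with h | h <;> simp [h]

lemma abs_G_le (hb : Balanced ν G C cov r B ρ) (o : 𝒪) : |G o| ≤ 1 := by
  rcases hb.G_eq o with h | h <;> simp [h]

lemma abs_C_le (hb : Balanced ν G C cov r B ρ) (o : 𝒪) : |C o| ≤ 1 := by
  rcases hb.C_eq o with h | h <;> simp [h]

lemma G_mul_self (hb : Balanced ν G C cov r B ρ) (o : 𝒪) : G o * G o = G o := by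
  rcases hb.G_eq o with h | h <;> simp [h]

lemma C_mul_self (hb : Balanced ν G C cov r B ρ) (o : 𝒪) : C o * C o = C o := by
  rcases hb.C_eq o with h | h <;> simp [h]

lemma G_mul_C (hb : Balanced ν G C cov r B ρ) (o : 𝒪) : G o * C o = 0 := by
  rcases hb.disjoint o with h | h <;> simp [h]

lemma abs_weight_le (hb : Balanced ν G C cov r B ρ) : ∀ᵐ o ∂ν, |C o * r (cov o)| ≤ B := by
  filter_upwards [hb.nonneg, hb.le] with o h1 h2
  rwa [abs_of_nonneg h1]

lemma measurable_weight (hb : Balanced ν G C cov r B ρ) : Measurable fun o => C o * r (cov o) :=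
  hb.measurable_C.mul (hb.measurable_r.comp hb.measurable_cov)

lemma lintegral_enorm_eq (hb : Balanced ν G C cov r B ρ) {h : 𝒳 → ℝ} (hh : Measurable h) :
    ∫⁻ o, ‖C o * r (cov o) * h (cov o)‖ₑ ∂ν = ∫⁻ o, ‖G o * h (cov o)‖ₑ ∂ν := by
  have := hb.lintegral_eq (fun x => ‖h x‖ₑ) hh.enorm
  calc _ = ∫⁻ o, ENNReal.ofReal (C o * r (cov o)) * ‖h (cov o)‖ₑ ∂ν := by
        refine lintegral_congr_ae ?_
        filter_upwards [hb.nonneg] with o ho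
        rw [enorm_mul, Real.enorm_eq_ofReal ho]
    _ = _ := by
        rw [← this]
        exact lintegral_congr fun o => by rw [enorm_mul, Real.enorm_eq_ofReal (hb.G_nonneg o)]

lemma integrable_weight_mul (hb : Balanced ν G C cov r B ρ) {h : 𝒳 → ℝ} (hh : Measurable h)
    (hi : Integrable (fun o => G o * h (cov o)) ν) :
    Integrable (fun o => C o * r (cov o) * h (cov o)) ν := by
  refine ⟨(hb.measurable_weight.mul (hh.comp hb.measurable_cov)).aestronglyMeasurable, ?_⟩
  rw [HasFiniteIntegral, hb.lintegral_enorm_eq hh]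
  exact hi.2

/-- Balance is given for nonnegative functions only; it passes to integrable ones through positive
and negative parts. -/
lemma integral_weight_mul (hb : Balanced ν G C cov r B ρ) {h : 𝒳 → ℝ} (hh : Measurable h)
    (hi : Integrable (fun o => G o * h (cov o)) ν) :
    ∫ o, C o * r (cov o) * h (cov o) ∂ν = ∫ o, G o * h (cov o) ∂ν := by
  have key : ∀ k : 𝒳 → ℝ, Measurable k →
      ∫⁻ o, ENNReal.ofReal (C o * r (cov o) * k (cov o)) ∂ν =
        ∫⁻ o, ENNReal.ofReal (G o * k (cov o)) ∂ν := fun k hk => by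
    calc _ = ∫⁻ o, ENNReal.ofReal (C o * r (cov o)) * ENNReal.ofReal (k (cov o)) ∂ν := by
          refine lintegral_congr_ae ?_
          filter_upwards [hb.nonneg] with o ho
          rw [ENNReal.ofReal_mul ho]
      _ = ∫⁻ o, ENNReal.ofReal (G o) * ENNReal.ofReal (k (cov o)) ∂ν :=
          (hb.lintegral_eq (fun x => ENNReal.ofReal (k x)) hk.ennreal_ofReal).symm
      _ = _ := lintegral_congr fun o => by rw [ENNReal.ofReal_mul (hb.G_nonneg o)]
  rw [integral_eq_lintegral_pos_part_sub_lintegral_neg_part hi,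
    integral_eq_lintegral_pos_part_sub_lintegral_neg_part (hb.integrable_weight_mul hh hi), key h hh]
  have := key (fun x => -h x) hh.neg
  simp only [mul_neg] at this
  rw [this]

variable [IsProbabilityMeasure ν]

lemma memLp_G (hb : Balanced ν G C cov r B ρ) : MemLp G 2 ν :=
  MemLp.of_bound hb.measurable_G.aestronglyMeasurable 1 (ae_of_all _ hb.abs_G_le)

lemma memLp_weight (hb : Balanced ν G C cov r B ρ) : MemLp (fun o => C o * r (cov o)) 2 ν :=
  MemLp.of_bound hb.measurable_weight.aestronglyMeasurable B hb.abs_weight_le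

/-- Balance tested on h = 1. This is why one constant ρ normalizes both the treated and the control
weight. -/
lemma integral_weight (hb : Balanced ν G C cov r B ρ) : ∫ o, C o * r (cov o) ∂ν = ρ := by
  have := hb.integral_weight_mul (h := fun _ => 1) measurable_const
    (by simpa using hb.memLp_G.integrable one_le_two)
  simpa [hb.integral_G] using this

end Balanced

namespace Regression

lemma measurable_residual (hb : Balanced ν G C cov r B ρ) (hr : Regression ν G C cov V f) :
    Measurable fun o => V o - f (cov o) :=
  hr.measurable_V.sub (hr.measurable_f.comp hb.measurable_cov)

lemma memLp_weight (hb : Balanced ν G C cov r B ρ) (hr : Regression ν G C cov V f) :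
    MemLp (fun o => C o * r (cov o) * (V o - f (cov o))) 2 ν := by
  refine MemLp.of_le_mul (c := B) hr.memLp_C
    (hb.measurable_weight.mul (measurable_residual hb hr)).aestronglyMeasurable ?_
  filter_upwards [hb.abs_weight_le] with o ho
  -- C = C² separates the bounded weight C r from the square-integrable residual C (V - f).
  have : C o * r (cov o) * (V o - f (cov o)) =
      C o * r (cov o) * (C o * (V o - f (cov o))) := by
    linear_combination -(r (cov o) * (V o - f (cov o))) * hb.C_mul_self o
  rw [this, norm_mul]
  gcongr
  exact ho

/-- Orthogonality of the residual, tested on the odds r themselves. Centredness of this term is what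
makes the score insensitive to the control denominator. -/
lemma integral_weight (hb : Balanced ν G C cov r B ρ) (hr : Regression ν G C cov V f)
    [IsProbabilityMeasure ν] :
    ∫ o, C o * r (cov o) * (V o - f (cov o)) ∂ν = 0 :=
  hr.orthogonal r hb.measurable_r hb.memLp_weight

/-- The bias identity: the bias of the estimated control term is that of the treated term up to a
product of errors. -/
lemma integral_sub_eq [IsProbabilityMeasure ν]
    (hb : Balanced ν G C cov r B ρ) (hr : Regression ν G C cov V f)
    {q u : 𝒳 → ℝ} (hq : Measurable q) (hu : Measurable u)
    (h1 : eLpNorm (fun o => C o * (q (cov o) - r (cov o))) 2 ν ≠ ∞)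
    (h2 : eLpNorm (fun o => G o * (f (cov o) - u (cov o))) 2 ν ≠ ∞)
    (h3 : eLpNorm (fun o => C o * (q (cov o) - r (cov o))) 2 ν *
      eLpNorm (fun o => C o * (f (cov o) - u (cov o))) 2 ν ≠ ∞) :
    ∫ o, (C o * q (cov o) * (V o - u (cov o)) - C o * r (cov o) * (V o - f (cov o))) ∂ν =
      ∫ o, G o * (f (cov o) - u (cov o)) ∂ν +
        ∫ o, C o * (q (cov o) - r (cov o)) * (C o * (f (cov o) - u (cov o))) ∂ν := by
  have mC := hb.measurable_C
  have mG := hb.measurable_G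
  have mcov := hb.measurable_cov
  have mdq : Measurable fun x => q x - r x := hq.sub hb.measurable_r
  have mdu : Measurable fun x => f x - u x := hr.measurable_f.sub hu
  have mCq : Measurable fun o => C o * (q (cov o) - r (cov o)) := mC.mul (mdq.comp mcov)
  have mCu : Measurable fun o => C o * (f (cov o) - u (cov o)) := mC.mul (mdu.comp mcov)
  have mGu : Measurable fun o => G o * (f (cov o) - u (cov o)) := mG.mul (mdu.comp mcov)
  have L1 : MemLp (fun o => C o * (q (cov o) - r (cov o))) 2 ν :=
    ⟨mCq.aestronglyMeasurable, h1.lt_top⟩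
  have iG : Integrable (fun o => G o * (f (cov o) - u (cov o))) ν :=
    (MemLp.integrable (q := 2) one_le_two ⟨mGu.aestronglyMeasurable, h2.lt_top⟩)
  have i1 : Integrable (fun o => C o * (q (cov o) - r (cov o)) * (V o - f (cov o))) ν := by
    refine (L1.integrable_mul hr.memLp_C).congr (ae_of_all _ fun o => ?_)
    simp only [Pi.mul_apply]
    linear_combination ((q (cov o) - r (cov o)) * (V o - f (cov o))) * hb.C_mul_self o
  -- Only the product of the two norms is assumed finite, so integrability is read off the
  -- Cauchy–Schwarz bound rather than from both factors lying in L².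
  have i2 : Integrable (fun o => C o * (q (cov o) - r (cov o)) *
      (C o * (f (cov o) - u (cov o)))) ν :=
    ⟨(mCq.mul mCu).aestronglyMeasurable, (lintegral_enorm_mul_le mCq.aestronglyMeasurable
      mCu.aestronglyMeasurable).trans_lt h3.lt_top⟩
  have i3 := hb.integrable_weight_mul mdu iG
  have e1 := hr.orthogonal (fun x => q x - r x) mdq L1
  have e3 := hb.integral_weight_mul mdu iG
  rw [← e3]
  -- q (V - u) - r (V - f) = (q - r)(V - f) + r (f - u) + (q - r)(f - u). The first term vanishes by
  -- orthogonality, the second is moved to group G by balance, the third is the second-order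
  -- remainder.
  have : (fun o => C o * q (cov o) * (V o - u (cov o)) - C o * r (cov o) * (V o - f (cov o))) =
      fun o => C o * (q (cov o) - r (cov o)) * (V o - f (cov o)) +
        (C o * r (cov o) * (f (cov o) - u (cov o)) +
        C o * (q (cov o) - r (cov o)) * (C o * (f (cov o) - u (cov o)))) := by
    ext o
    linear_combination -(q (cov o) - r (cov o)) * (f (cov o) - u (cov o)) * hb.C_mul_self o
  rw [this, integral_add i1 (by exact i3.add i2), integral_add i3 i2, e1, zero_add]

end Regression

/-! ### Cross-fitted scores in one fold -/

variable {Ω : Type*} [MeasurableSpace Ω] {Q : Measure Ω} {O : ℕ → Ω → 𝒪} {s : ℕ → Finset ℕ}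
  {𝒲 : ℕ → Type*} [∀ N, MeasurableSpace (𝒲 N)] {W : ∀ N, Ω → 𝒲 N}
  {q u : ∀ N, 𝒲 N → 𝒳 → ℝ} {ρ₁ ρ₂ : ℕ × Ω → ℝ}

/-- The score `(G / ρ₁ - C q / ρ₂) (V - u)`. -/
noncomputable def score (G C : 𝒪 → ℝ) (cov : 𝒪 → 𝒳) (V : 𝒪 → ℝ) (ρ₁ ρ₂ : ℝ) (q u : 𝒳 → ℝ)
    (o : 𝒪) : ℝ :=
  (G o / ρ₁ - C o * q (cov o) / ρ₂) * (V o - u (cov o))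

/-- Estimated weights: `q` estimates `r` from the training data `W`, and `ρ₁`, `ρ₂` estimate the
normalizing constants. -/
structure FittedWeights (Q : Measure Ω) (ν : Measure 𝒪) (O : ℕ → Ω → 𝒪) (s : ℕ → Finset ℕ)
    (𝒲 : ℕ → Type*) [∀ N, MeasurableSpace (𝒲 N)] (W : ∀ N, Ω → 𝒲 N) (G C : 𝒪 → ℝ)
    (cov : 𝒪 → 𝒳) (r : 𝒳 → ℝ) (B ρ : ℝ) (q : ∀ N, 𝒲 N → 𝒳 → ℝ) (ρ₁ ρ₂ : ℕ × Ω → ℝ) : Prop where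
  split : Split Q O s 𝒲 W
  measurable_obs : ∀ i, Measurable (O i)
  indep : iIndepFun O Q
  law : ∀ i, Q.map (O i) = ν
  balanced : Balanced ν G C cov r B ρ
  measurable_q : ∀ N, Measurable (Function.uncurry (q N))
  tendsto_q : Tendsto (fun x : ℕ × Ω =>
    eLpNorm (fun o => C o * (q x.1 (W x.1 x.2) (cov o) - r (cov o))) 2 ν) (inProb Q) (𝓝 0)
  bdd_treated : StochBdd Q fun x => √(x.1 : ℝ) * (ρ₁ x - ρ)
  bdd_control : StochBdd Q fun x =>
    √(x.1 : ℝ) * (ρ₂ x - ∫ o, C o * q x.1 (W x.1 x.2) (cov o) ∂ν)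

/-- `u` estimates the control regression `f` of `V` from the training data `W`. -/
structure FittedRegression (Q : Measure Ω) (ν : Measure 𝒪)
    (𝒲 : ℕ → Type*) [∀ N, MeasurableSpace (𝒲 N)] (W : ∀ N, Ω → 𝒲 N) (G C : 𝒪 → ℝ)
    (cov : 𝒪 → 𝒳) (r : 𝒳 → ℝ) (ρ : ℝ) (q : ∀ N, 𝒲 N → 𝒳 → ℝ) (ρ₁ ρ₂ : ℕ × Ω → ℝ)
    (V : 𝒪 → ℝ) (f : 𝒳 → ℝ) (u : ∀ N, 𝒲 N → 𝒳 → ℝ) : Prop where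
  regression : Regression ν G C cov V f
  measurable_u : ∀ N, Measurable (Function.uncurry (u N))
  tendsto_score : Tendsto (fun x : ℕ × Ω => eLpNorm (fun o =>
    score G C cov V (ρ₁ x) (ρ₂ x) (q x.1 (W x.1 x.2)) (u x.1 (W x.1 x.2)) o -
      score G C cov V ρ ρ r f o) 2 ν) (inProb Q) (𝓝 0)
  rate_treated : Tendsto (fun x : ℕ × Ω => ENNReal.ofReal √(x.1 : ℝ) *
    (eLpNorm (fun o => C o * (q x.1 (W x.1 x.2) (cov o) - r (cov o))) 2 ν *
      eLpNorm (fun o => G o * (f (cov o) - u x.1 (W x.1 x.2) (cov o))) 2 ν)) (inProb Q) (𝓝 0)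
  rate_control : Tendsto (fun x : ℕ × Ω => ENNReal.ofReal √(x.1 : ℝ) *
    (eLpNorm (fun o => C o * (q x.1 (W x.1 x.2) (cov o) - r (cov o))) 2 ν *
      eLpNorm (fun o => C o * (f (cov o) - u x.1 (W x.1 x.2) (cov o))) 2 ν)) (inProb Q) (𝓝 0)

namespace FittedWeights

variable (hw : FittedWeights Q ν O s 𝒲 W G C cov r B ρ q ρ₁ ρ₂)
include hw

lemma measurable_q_apply (N : ℕ) (w : 𝒲 N) : Measurable (q N w) :=
  (hw.measurable_q N).comp measurable_prodMk_left

lemma measurable_diff (N : ℕ) (w : 𝒲 N) :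
    Measurable fun o => C o * (q N w (cov o) - r (cov o)) :=
  hw.balanced.measurable_C.mul (((hw.measurable_q_apply N w).sub hw.balanced.measurable_r).comp
    hw.balanced.measurable_cov)

lemma tendsto_treated : Tendsto ρ₁ (inProb Q) (𝓝 ρ) := by
  have := tendsto_of_stochBdd_sqrt_mul hw.bdd_treated
  simpa using this.add_const ρ

lemma tendsto_inv_treated : Tendsto (fun x => (ρ₁ x)⁻¹) (inProb Q) (𝓝 ρ⁻¹) :=
  hw.tendsto_treated.inv₀ hw.balanced.pos.ne'

lemma eventually_ne_top : ∀ᶠ x in inProb Q,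
    eLpNorm (fun o => C o * (q x.1 (W x.1 x.2) (cov o) - r (cov o))) 2 ν ≠ ∞ :=
  (hw.tendsto_q.eventually_lt_const ENNReal.zero_lt_top).mono fun _ h => h.ne

variable [IsProbabilityMeasure ν]

/-- Since ρ = ∫ C r, the difference is ∫ C (q - r). It is of the order of the odds error, not of
n^{-1/2}, which is why it must later be paired with a regression error. -/
lemma enorm_integral_sub_le (N : ℕ) (w : 𝒲 N)
    (h : eLpNorm (fun o => C o * (q N w (cov o) - r (cov o))) 2 ν ≠ ∞) :
    ‖∫ o, C o * q N w (cov o) ∂ν - ρ‖ₑ ≤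
      eLpNorm (fun o => C o * (q N w (cov o) - r (cov o))) 2 ν := by
  have hm := (hw.measurable_diff N w).aestronglyMeasurable (μ := ν)
  have hL : MemLp (fun o => C o * (q N w (cov o) - r (cov o))) 2 ν := ⟨hm, h.lt_top⟩
  have heq : ∫ o, C o * q N w (cov o) ∂ν - ρ = ∫ o, C o * (q N w (cov o) - r (cov o)) ∂ν := by
    have h1 := hL.integrable one_le_two
    have h2 := hw.balanced.memLp_weight.integrable one_le_two
    have h3 : (fun o => C o * q N w (cov o)) =
        fun o => C o * (q N w (cov o) - r (cov o)) + C o * r (cov o) := by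
      ext o; ring
    rw [h3, integral_add h1 h2, hw.balanced.integral_weight]
    ring
  rw [heq]
  exact (enorm_integral_le_lintegral_enorm _).trans (lintegral_enorm_le_eLpNorm_two hm)

lemma tendsto_integral : Tendsto (fun x : ℕ × Ω => ∫ o, C o * q x.1 (W x.1 x.2) (cov o) ∂ν)
    (inProb Q) (𝓝 ρ) := by
  have h := tendsto_zero_of_enorm_le hw.tendsto_q
    (f := fun x : ℕ × Ω => ∫ o, C o * q x.1 (W x.1 x.2) (cov o) ∂ν - ρ)
    (hw.eventually_ne_top.mono fun x hx => hw.enorm_integral_sub_le x.1 _ hx)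
  simpa using h.add_const ρ

lemma tendsto_control : Tendsto ρ₂ (inProb Q) (𝓝 ρ) := by
  have := (tendsto_of_stochBdd_sqrt_mul hw.bdd_control).add hw.tendsto_integral
  simpa using this

lemma tendsto_inv_control : Tendsto (fun x => (ρ₂ x)⁻¹) (inProb Q) (𝓝 ρ⁻¹) :=
  hw.tendsto_control.inv₀ hw.balanced.pos.ne'

end FittedWeights

namespace FittedRegression

variable (hw : FittedWeights Q ν O s 𝒲 W G C cov r B ρ q ρ₁ ρ₂)
  (hr : FittedRegression Q ν 𝒲 W G C cov r ρ q ρ₁ ρ₂ V f u)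
include hw hr

lemma measurable_treated (N : ℕ) : Measurable (Function.uncurry fun (w : 𝒲 N) o =>
    G o * (f (cov o) - u N w (cov o))) := by
  have hcov := hw.balanced.measurable_cov.comp (measurable_snd : Measurable (Prod.snd : 𝒲 N × 𝒪 → 𝒪))
  exact (hw.balanced.measurable_G.comp measurable_snd).mul
    ((hr.regression.measurable_f.comp hcov).sub
      ((hr.measurable_u N).comp (measurable_fst.prodMk hcov)))

lemma measurable_control (N : ℕ) : Measurable (Function.uncurry fun (w : 𝒲 N) o =>
    C o * q N w (cov o) * (V o - u N w (cov o)) - C o * r (cov o) * (V o - f (cov o))) := by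
  have hcov := hw.balanced.measurable_cov.comp (measurable_snd : Measurable (Prod.snd : 𝒲 N × 𝒪 → 𝒪))
  have hq := (hw.measurable_q N).comp (measurable_fst.prodMk hcov)
  have hu := (hr.measurable_u N).comp (measurable_fst.prodMk hcov)
  have hC := hw.balanced.measurable_C.comp (measurable_snd : Measurable (Prod.snd : 𝒲 N × 𝒪 → 𝒪))
  have hV := hr.regression.measurable_V.comp (measurable_snd : Measurable (Prod.snd : 𝒲 N × 𝒪 → 𝒪))
  exact ((hC.mul hq).mul (hV.sub hu)).sub ((hC.mul (hw.balanced.measurable_r.comp hcov)).mul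
    (hV.sub (hr.regression.measurable_f.comp hcov)))

lemma measurable_score_sub (N : ℕ) (w : 𝒲 N) (a b : ℝ) : Measurable fun o =>
    score G C cov V a b (q N w) (u N w) o - score G C cov V ρ ρ r f o := by
  have hcov := hw.balanced.measurable_cov
  have hq := (hw.measurable_q_apply N w).comp hcov
  have hu := ((hr.measurable_u N).comp (measurable_prodMk_left (x := w))).comp hcov
  have hC := hw.balanced.measurable_C
  have hG := hw.balanced.measurable_G
  have hV := hr.regression.measurable_V
  exact (((hG.div_const _).sub ((hC.mul hq).div_const _)).mul (hV.sub hu)).sub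
    (((hG.div_const _).sub ((hC.mul (hw.balanced.measurable_r.comp hcov)).div_const _)).mul
      (hV.sub (hr.regression.measurable_f.comp hcov)))

/-- Multiplying by G kills the control weight, which gives G (f - u) = ρ₁ G (score - true score) +
(ρ₁/ρ - 1) G (V - f). Consistency of u on group G is thus a consequence of consistency of the score.
-/
lemma tendsto_eLpNorm_treated : Tendsto (fun x : ℕ × Ω =>
    eLpNorm (fun o => G o * (f (cov o) - u x.1 (W x.1 x.2) (cov o))) 2 ν) (inProb Q) (𝓝 0) := by
  have hρ := hw.balanced.pos
  have h1 := tendsto_enorm_mul_zero hw.tendsto_treated hr.tendsto_score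
  have h2 : Tendsto (fun x => ρ₁ x / ρ - 1) (inProb Q) (𝓝 0) := by
    have := (hw.tendsto_treated.div_const ρ).sub_const 1
    rwa [div_self hρ.ne', sub_self] at this
  have h3 := tendsto_enorm_zero_mul h2 hr.regression.memLp_G.2.ne
  have h4 := h1.add h3
  rw [add_zero] at h4
  refine tendsto_of_tendsto_of_tendsto_of_le_of_le' tendsto_const_nhds h4
    (Eventually.of_forall fun _ => zero_le) ?_
  filter_upwards [hw.tendsto_treated.eventually_ne hρ.ne'] with x hx
  have hm := hr.measurable_score_sub hw x.1 (W x.1 x.2) (ρ₁ x) (ρ₂ x)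
  refine le_trans (le_of_eq ?_) ((eLpNorm_lincomb_le
    (hw.balanced.measurable_G.mul hm).aestronglyMeasurable
    hr.regression.memLp_G.1 (ρ₁ x) (ρ₁ x / ρ - 1)).trans ?_)
  · congr 1
    ext o
    have e1 := hw.balanced.G_mul_self o
    have e2 := hw.balanced.G_mul_C o
    simp only [score, Pi.mul_apply]
    rcases hw.balanced.G_eq o with hG | hG
    · simp [hG]
    · have hC : C o = 0 := by simpa [hG] using e2
      rw [hG, hC]
      field_simp
      ring
  · gcongr
    refine eLpNorm_mono fun o => ?_
    rw [Pi.mul_apply, norm_mul]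
    exact mul_le_of_le_one_left (norm_nonneg _) (hw.balanced.abs_G_le o)

variable [IsProbabilityMeasure ν]

/-- The counterpart of `tendsto_eLpNorm_treated`: multiplying by C kills the treated weight, and the
factor -ρ₂ isolates the control term. -/
lemma tendsto_eLpNorm_control : Tendsto (fun x : ℕ × Ω =>
    eLpNorm (fun o => C o * q x.1 (W x.1 x.2) (cov o) * (V o - u x.1 (W x.1 x.2) (cov o)) -
      C o * r (cov o) * (V o - f (cov o))) 2 ν) (inProb Q) (𝓝 0) := by
  have hρ := hw.balanced.pos
  have h1 := tendsto_enorm_mul_zero hw.tendsto_control.neg hr.tendsto_score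
  have h2 : Tendsto (fun x => ρ₂ x / ρ - 1) (inProb Q) (𝓝 0) := by
    have := (hw.tendsto_control.div_const ρ).sub_const 1
    rwa [div_self hρ.ne', sub_self] at this
  have hL := Regression.memLp_weight hw.balanced hr.regression
  have h3 := tendsto_enorm_zero_mul h2 hL.2.ne
  have h4 := h1.add h3
  rw [add_zero] at h4
  refine tendsto_of_tendsto_of_tendsto_of_le_of_le' tendsto_const_nhds h4
    (Eventually.of_forall fun _ => zero_le) ?_
  filter_upwards [hw.tendsto_control.eventually_ne hρ.ne'] with x hx
  have hm := hr.measurable_score_sub hw x.1 (W x.1 x.2) (ρ₁ x) (ρ₂ x)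
  refine le_trans (le_of_eq ?_) ((eLpNorm_lincomb_le
    (hw.balanced.measurable_C.mul hm).aestronglyMeasurable
    hL.1 (-ρ₂ x) (ρ₂ x / ρ - 1)).trans ?_)
  · congr 1
    ext o
    have e2 := hw.balanced.G_mul_C o
    simp only [score, Pi.mul_apply]
    rcases hw.balanced.C_eq o with hC | hC
    · simp [hC]
    · have hG : G o = 0 := by simpa [hC] using e2
      rw [hG, hC]
      field_simp
      ring
  · gcongr
    refine eLpNorm_mono fun o => ?_
    rw [Pi.mul_apply, norm_mul]
    exact mul_le_of_le_one_left (norm_nonneg _) (hw.balanced.abs_C_le o)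

/-- The bias of the estimated score, with estimated normalizing constants, is of second order. -/
lemma tendsto_sqrt_bias : Tendsto (fun x : ℕ × Ω => √(x.1 : ℝ) *
    ((ρ₁ x)⁻¹ * ∫ o, G o * (f (cov o) - u x.1 (W x.1 x.2) (cov o)) ∂ν -
      (ρ₂ x)⁻¹ * ∫ o, (C o * q x.1 (W x.1 x.2) (cov o) * (V o - u x.1 (W x.1 x.2) (cov o)) -
        C o * r (cov o) * (V o - f (cov o))) ∂ν)) (inProb Q) (𝓝 0) := by
  have hρ := hw.balanced.pos
  set b : ℕ × Ω → ℝ := fun x => ∫ o, G o * (f (cov o) - u x.1 (W x.1 x.2) (cov o)) ∂ν with hbdef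
  set R : ℕ × Ω → ℝ := fun x => ∫ o, C o * (q x.1 (W x.1 x.2) (cov o) - r (cov o)) *
    (C o * (f (cov o) - u x.1 (W x.1 x.2) (cov o))) ∂ν with hRdef
  set c : ℕ × Ω → ℝ := fun x => ∫ o, C o * q x.1 (W x.1 x.2) (cov o) ∂ν with hcdef
  have mG : ∀ x : ℕ × Ω, AEStronglyMeasurable
      (fun o => G o * (f (cov o) - u x.1 (W x.1 x.2) (cov o))) ν := fun x =>
    ((hr.measurable_treated hw x.1).comp (measurable_prodMk_left (x := W x.1 x.2))).aestronglyMeasurable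
  have mCu : ∀ x : ℕ × Ω, AEStronglyMeasurable
      (fun o => C o * (f (cov o) - u x.1 (W x.1 x.2) (cov o))) ν := fun x =>
    (hw.balanced.measurable_C.mul ((hr.regression.measurable_f.sub ((hr.measurable_u x.1).comp
      (measurable_prodMk_left (x := W x.1 x.2)))).comp hw.balanced.measurable_cov)).aestronglyMeasurable
  have mCq : ∀ x : ℕ × Ω, AEStronglyMeasurable
      (fun o => C o * (q x.1 (W x.1 x.2) (cov o) - r (cov o))) ν := fun x =>
    (hw.measurable_diff x.1 (W x.1 x.2)).aestronglyMeasurable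
  have htG := hr.tendsto_eLpNorm_treated hw
  have hb0 : Tendsto b (inProb Q) (𝓝 0) := tendsto_zero_of_enorm_le htG
    (Eventually.of_forall fun x => (enorm_integral_le_lintegral_enorm _).trans
      (lintegral_enorm_le_eLpNorm_two (mG x)))
  have hR : Tendsto (fun x => √(x.1 : ℝ) * R x) (inProb Q) (𝓝 0) := by
    refine tendsto_zero_of_enorm_le hr.rate_control (Eventually.of_forall fun x => ?_)
    rw [enorm_mul, Real.enorm_eq_ofReal (Real.sqrt_nonneg _)]
    gcongr
    exact (enorm_integral_le_lintegral_enorm _).trans (lintegral_enorm_mul_le (mCq x) (mCu x))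
  -- The error c - ρ of the mean estimated weight has no rate of its own; it is bounded by the odds
  -- error, and together with b it falls under the product rate.
  have hbc : Tendsto (fun x => √(x.1 : ℝ) * ((c x - ρ) * b x)) (inProb Q) (𝓝 0) := by
    refine tendsto_zero_of_enorm_le hr.rate_treated ?_
    filter_upwards [hw.eventually_ne_top] with x hx
    rw [enorm_mul, enorm_mul, Real.enorm_eq_ofReal (Real.sqrt_nonneg _)]
    gcongr
    · exact hw.enorm_integral_sub_le x.1 _ hx
    · exact (enorm_integral_le_lintegral_enorm _).trans (lintegral_enorm_le_eLpNorm_two (mG x))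
  -- Both denominators fluctuate by O_P(N^{-1/2}), and b tends to zero without any rate being
  -- needed.
  have t1 := hw.bdd_treated.mul_tendsto_zero hb0
  have t2 := hw.bdd_control.mul_tendsto_zero hb0
  have hi1 := hw.tendsto_inv_treated
  have hi2 := hw.tendsto_inv_control
  -- The control bias is b + R, and b/ρ₁ - (b + R)/ρ₂ = (ρ₁ρ₂)⁻¹ [(ρ₂ - c) + (c - ρ) - (ρ₁ - ρ)] b -
  -- R/ρ₂.
  have main := ((hi1.mul hi2).mul ((t2.add hbc).sub t1)).sub (hi2.mul hR)
  simp only [add_zero, sub_zero, mul_zero] at main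
  refine main.congr' ?_
  -- The rate condition forces the product of norms to be finite once N > 0; at N = 0 it would be
  -- hidden by 0 · ∞ = 0.
  have hprod : ∀ᶠ x : ℕ × Ω in inProb Q,
      eLpNorm (fun o => C o * (q x.1 (W x.1 x.2) (cov o) - r (cov o))) 2 ν *
        eLpNorm (fun o => C o * (f (cov o) - u x.1 (W x.1 x.2) (cov o))) 2 ν ≠ ∞ := by
    filter_upwards [hr.rate_control.eventually_lt_const ENNReal.zero_lt_top,
      tendsto_fst_inProb.eventually (eventually_gt_atTop 0)] with x hx hx0 htop
    have : ENNReal.ofReal √(x.1 : ℝ) ≠ 0 := by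
      simpa using hx0
    rw [htop, ENNReal.mul_top this] at hx
    exact lt_irrefl _ hx
  filter_upwards [hw.tendsto_treated.eventually_ne hρ.ne',
    hw.tendsto_control.eventually_ne hρ.ne', hw.eventually_ne_top, hprod,
    htG.eventually_lt_const ENNReal.zero_lt_top] with x h1 h2 h3 h4 h5
  have heq := Regression.integral_sub_eq hw.balanced hr.regression
    (hw.measurable_q_apply x.1 (W x.1 x.2))
    ((hr.measurable_u x.1).comp (measurable_prodMk_left (x := W x.1 x.2))) h3 h5.ne h4
  have heq' : ∫ o, (C o * q x.1 (W x.1 x.2) (cov o) * (V o - u x.1 (W x.1 x.2) (cov o)) -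
        C o * r (cov o) * (V o - f (cov o))) ∂ν = b x + R x := heq
  rw [heq']
  field_simp
  ring

variable [IsProbabilityMeasure Q]

/-- First-order expansion of the cross-fitted score of one fold. -/
lemma tendsto_sqrt_avg_score : Tendsto (fun x : ℕ × Ω => √(x.1 : ℝ) *
    (avg (s x.1) (O · x.2) (score G C cov V (ρ₁ x) (ρ₂ x) (q x.1 (W x.1 x.2))
        (u x.1 (W x.1 x.2))) -
      ((ρ₁ x)⁻¹ * avg (s x.1) (O · x.2) (fun o => G o * (V o - f (cov o))) -
        (ρ₂ x)⁻¹ * avg (s x.1) (O · x.2) (fun o => C o * r (cov o) * (V o - f (cov o))))))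
    (inProb Q) (𝓝 0) := by
  -- The treated and the control term depend on the sample only through the training data, so the
  -- conditional argument applies to each. It would not apply to the whole score, whose denominators
  -- may use the evaluation fold.
  have e1 := hw.split.tendsto_sqrt_avg_sub_integral hw.measurable_obs hw.indep hw.law
    (hr.measurable_treated hw) (hr.tendsto_eLpNorm_treated hw)
  have e2 := hw.split.tendsto_sqrt_avg_sub_integral hw.measurable_obs hw.indep hw.law
    (hr.measurable_control hw) (hr.tendsto_eLpNorm_control hw)
  have main := ((hw.tendsto_inv_treated.mul e1).sub (hw.tendsto_inv_control.mul e2)).add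
    (hr.tendsto_sqrt_bias hw)
  simp only [mul_zero, sub_zero, add_zero] at main
  refine main.congr fun x => ?_
  have hs : avg (s x.1) (O · x.2) (score G C cov V (ρ₁ x) (ρ₂ x) (q x.1 (W x.1 x.2))
        (u x.1 (W x.1 x.2))) =
      (ρ₁ x)⁻¹ * (avg (s x.1) (O · x.2) (fun o => G o * (V o - f (cov o))) +
        avg (s x.1) (O · x.2) (fun o => G o * (f (cov o) - u x.1 (W x.1 x.2) (cov o)))) -
      (ρ₂ x)⁻¹ * (avg (s x.1) (O · x.2) (fun o => C o * r (cov o) * (V o - f (cov o))) +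
        avg (s x.1) (O · x.2) (fun o =>
          C o * q x.1 (W x.1 x.2) (cov o) * (V o - u x.1 (W x.1 x.2) (cov o)) -
            C o * r (cov o) * (V o - f (cov o)))) := by
    rw [← avg_add, ← avg_add, ← avg_const_mul, ← avg_const_mul, ← avg_sub]
    congr 1
    ext o
    simp only [score]
    ring
  rw [hs]
  ring

/-- The estimated score is close to the true score in empirical `L²`. -/
lemma tendsto_avg_sq_score_sub : Tendsto (fun x : ℕ × Ω =>
    avg (s x.1) (O · x.2) fun o =>
      (score G C cov V (ρ₁ x) (ρ₂ x) (q x.1 (W x.1 x.2)) (u x.1 (W x.1 x.2)) o -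
        score G C cov V ρ ρ r f o) ^ 2) (inProb Q) (𝓝 0) := by
  have hb := hw.balanced
  have e1 := hw.split.tendsto_avg_sq hw.measurable_obs hw.law
    (hr.measurable_treated hw) (hr.tendsto_eLpNorm_treated hw)
  have e2 := hw.split.tendsto_avg_sq hw.measurable_obs hw.law
    (hr.measurable_control hw) (hr.tendsto_eLpNorm_control hw)
  have mres := Regression.measurable_residual hb hr.regression
  have b1 := stochBdd_avg_abs (ν := ν) hw.measurable_obs hw.law
    ((hb.measurable_G.mul mres).pow_const 2) hr.regression.memLp_G.integrable_sq s
  have b2 := stochBdd_avg_abs (ν := ν) hw.measurable_obs hw.law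
    ((hb.measurable_weight.mul mres).pow_const 2)
    (Regression.memLp_weight hb hr.regression).integrable_sq s
  have hi1 := hw.tendsto_inv_treated
  have hi2 := hw.tendsto_inv_control
  have z1 : Tendsto (fun x => ((ρ₁ x)⁻¹ - ρ⁻¹) ^ 2) (inProb Q) (𝓝 0) := by
    simpa using (hi1.sub_const ρ⁻¹).pow 2
  have z2 : Tendsto (fun x => ((ρ₂ x)⁻¹ - ρ⁻¹) ^ 2) (inProb Q) (𝓝 0) := by
    simpa using (hi2.sub_const ρ⁻¹).pow 2
  have main := ((((hi1.pow 2).mul e1).add ((hi2.pow 2).mul e2)).add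
    ((b1.mul_tendsto_zero z1).add (b2.mul_tendsto_zero z2))).const_mul 4
  simp only [mul_zero, add_zero] at main
  refine squeeze_zero (fun x => avg_nonneg _ _ fun o => sq_nonneg _) (fun x => ?_) main
  simp only [abs_pow, sq_abs]
  rw [mul_comm (avg _ _ _) (((ρ₁ x)⁻¹ - ρ⁻¹) ^ 2), mul_comm (avg _ _ _) (((ρ₂ x)⁻¹ - ρ⁻¹) ^ 2)]
  simp only [← avg_const_mul, ← avg_add]
  refine avg_mono _ _ fun o => ?_
  simp only [score, Pi.mul_apply]
  set A := G o * (f (cov o) - u x.1 (W x.1 x.2) (cov o)) with hA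
  set A' := C o * q x.1 (W x.1 x.2) (cov o) * (V o - u x.1 (W x.1 x.2) (cov o)) -
    C o * r (cov o) * (V o - f (cov o)) with hA'
  set D := G o * (V o - f (cov o)) with hD
  set D' := C o * r (cov o) * (V o - f (cov o)) with hD'
  have : (G o / ρ₁ x - C o * q x.1 (W x.1 x.2) (cov o) / ρ₂ x) *
      (V o - u x.1 (W x.1 x.2) (cov o)) - (G o / ρ - C o * r (cov o) / ρ) * (V o - f (cov o)) =
      (ρ₁ x)⁻¹ * A - (ρ₂ x)⁻¹ * A' + ((ρ₁ x)⁻¹ - ρ⁻¹) * D - ((ρ₂ x)⁻¹ - ρ⁻¹) * D' := by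
    rw [hA, hA', hD, hD']; ring
  rw [this]
  exact (sq_sub_add_sub_le _ _ _ _).trans_eq (by ring)

end FittedRegression

end Score

end IDiD

namespace IDiD

/-! ### Regression functions given an event -/

section CondMean

variable {S 𝒳 : Type*} [MeasurableSpace S] [MeasurableSpace 𝒳] {P : Measure S}
  [IsProbabilityMeasure P] {X : S → 𝒳} {A : Set S}

lemma restrict_eq_smul_cond (P : Measure S) [IsProbabilityMeasure P] (A : Set S) :
    P.restrict A = P A • P[|A] := by
  rcases eq_or_ne (P A) 0 with h | h
  · rw [Measure.restrict_eq_zero.2 h, h, zero_smul]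
  · rw [ProbabilityTheory.cond, smul_smul, ENNReal.mul_inv_cancel h (measure_ne_top _ _), one_smul]

lemma ae_cond_iff {p : S → Prop} : (∀ᵐ s ∂P[|A], p s) ↔ ∀ᵐ s ∂P.restrict A, p s := by
  constructor
  · intro h
    rw [restrict_eq_smul_cond P A]
    exact Measure.ae_smul_measure h _
  · intro h
    exact Measure.ae_smul_measure h _

omit [IsProbabilityMeasure P] in
lemma integrable_cond {V : S → ℝ} (hV : Integrable V P) : Integrable V (P[|A]) := by
  rcases eq_or_ne (P A) 0 with h | h
  · rw [ProbabilityTheory.cond_eq_zero_of_meas_eq_zero h]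
    exact integrable_zero_measure
  · exact hV.restrict.smul_measure (ENNReal.inv_ne_top.2 h)

lemma integral_restrict_eq (V : S → ℝ) : ∫ s in A, V s ∂P = P.real A * ∫ s, V s ∂P[|A] := by
  rw [restrict_eq_smul_cond P A, integral_smul_measure]; rfl

omit [IsProbabilityMeasure P] in
lemma measurable_condMean (V : S → ℝ) : Measurable (condMean P X A V) :=
  (StronglyMeasurable.integral_condDistrib measurable_snd.stronglyMeasurable (μ := P[|A]) (X := X)
    (Y := V)).measurable

omit [IsProbabilityMeasure P] in
lemma condMean_ae_eq (hX : Measurable X) {V : S → ℝ} (hV : Integrable V P) :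
    (P[|A])[V | MeasurableSpace.comap X inferInstance] =ᵐ[P[|A]]
      fun s => condMean P X A V (X s) :=
  condExp_ae_eq_integral_condDistrib' hX (integrable_cond hV)

lemma integrableOn_condMean (hX : Measurable X) {V : S → ℝ} (hV : Integrable V P) :
    IntegrableOn (fun s => condMean P X A V (X s)) A P := by
  rw [IntegrableOn, restrict_eq_smul_cond P A]
  exact (integrable_condExp.congr (condMean_ae_eq hX hV)).smul_measure (measure_ne_top _ _)

lemma memLp_condMean (hX : Measurable X) {V : S → ℝ} (hV : MemLp V 2 P) :
    MemLp (fun s => condMean P X A V (X s)) 2 (P.restrict A) := by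
  rw [restrict_eq_smul_cond P A]
  refine MemLp.smul_measure ?_ (measure_ne_top _ _)
  have h : MemLp V 2 (P[|A]) := by
    rcases eq_or_ne (P A) 0 with h | h
    · rw [ProbabilityTheory.cond_eq_zero_of_meas_eq_zero h]
      exact ⟨aestronglyMeasurable_zero_measure _, by simp⟩
    · exact (hV.restrict A).smul_measure (ENNReal.inv_ne_top.2 h)
  exact (h.condExp one_le_two).ae_eq (condMean_ae_eq hX (hV.integrable one_le_two))

/-- The defining property of the regression function. -/
lemma setIntegral_mul_condMean (hX : Measurable X) {V : S → ℝ} (hV : Integrable V P)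
    {h : 𝒳 → ℝ} (hh : Measurable h) (hi : IntegrableOn (fun s => h (X s) * V s) A P) :
    ∫ s in A, h (X s) * condMean P X A V (X s) ∂P = ∫ s in A, h (X s) * V s ∂P := by
  rcases eq_or_ne (P A) 0 with h0 | h0
  · rw [Measure.restrict_eq_zero.2 h0]; simp
  rw [integral_restrict_eq, integral_restrict_eq]
  congr 1
  have hi' : Integrable (fun s => h (X s) * V s) (P[|A]) :=
    Integrable.smul_measure hi (ENNReal.inv_ne_top.2 h0)
  have hm : StronglyMeasurable[MeasurableSpace.comap X inferInstance] fun s => h (X s) :=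
    (hh.comp (Measurable.of_comap_le le_rfl)).stronglyMeasurable
  have h1 := condExp_mul_of_stronglyMeasurable_left hm hi' (integrable_cond hV)
  rw [← integral_condExp hX.comap_le (μ := P[|A]) (f := fun s => h (X s) * V s)]
  refine integral_congr_ae ?_
  filter_upwards [h1, condMean_ae_eq (A := A) hX hV] with s hs1 hs2
  rw [← hs2]
  exact hs1.symm

lemma setIntegral_preimage_condMean (hX : Measurable X) {V : S → ℝ} (hV : Integrable V P)
    {D : Set 𝒳} (hD : MeasurableSet D) :
    ∫ s in A ∩ X ⁻¹' D, condMean P X A V (X s) ∂P = ∫ s in A ∩ X ⁻¹' D, V s ∂P := by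
  have key : ∀ U : S → ℝ, ∫ s in A ∩ X ⁻¹' D, U s ∂P =
      ∫ s in A, D.indicator (fun _ => (1 : ℝ)) (X s) * U s ∂P := fun U => by
    rw [Set.inter_comm, ← Measure.restrict_restrict (hX hD), ← integral_indicator (hX hD)]
    refine integral_congr_ae (ae_of_all _ fun s => ?_)
    by_cases hs : X s ∈ D <;> simp [Set.indicator, hs]
  rw [key, key]
  refine setIntegral_mul_condMean hX hV (measurable_const.indicator hD) ?_
  refine (hV.restrict (s := A)).bdd_mul (c := 1)
    ((measurable_const.indicator hD).comp hX).aestronglyMeasurable (ae_of_all _ fun s => ?_)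
  by_cases hs : X s ∈ D <;> simp [Set.indicator, hs]

/-- The regression function depends only on the integrals over events of the covariates. -/
lemma condMean_congr (hX : Measurable X) {V V' : S → ℝ}
    (hV : Integrable V P) (hV' : Integrable V' P)
    (h : ∀ D : Set 𝒳, MeasurableSet D → ∫ s in A ∩ X ⁻¹' D, V s ∂P = ∫ s in A ∩ X ⁻¹' D, V' s ∂P) :
    ∀ᵐ s ∂P.restrict A, condMean P X A V (X s) = condMean P X A V' (X s) := by
  have hle : MeasurableSpace.comap X inferInstance ≤ (inferInstance : MeasurableSpace S) :=
    hX.comap_le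
  rw [← ae_cond_iff]
  refine (condMean_ae_eq hX hV).symm.trans (EventuallyEq.trans ?_ (condMean_ae_eq hX hV'))
  refine ae_eq_condExp_of_forall_setIntegral_eq hle (integrable_cond hV')
    (fun _ _ _ => integrable_condExp.integrableOn) ?_ stronglyMeasurable_condExp.aestronglyMeasurable
  rintro _ ⟨D, hD, rfl⟩ -
  rw [setIntegral_condExp hle (integrable_cond hV) ⟨D, hD, rfl⟩]
  have key : ∀ U : S → ℝ, ∫ s in X ⁻¹' D, U s ∂P[|A] =
      (P A)⁻¹.toReal * ∫ s in A ∩ X ⁻¹' D, U s ∂P := fun U => by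
    rw [ProbabilityTheory.cond, Measure.restrict_smul, integral_smul_measure,
      Measure.restrict_restrict (hX hD), Set.inter_comm]
    rfl
  rw [key, key, h D hD]

/-- Converse of `condMean_congr`. Together they trade identities of regressions for identities of
integrals, which, unlike regressions, add up over disjoint cohorts. -/
lemma setIntegral_eq_of_condMean_eq (hX : Measurable X) {V V' : S → ℝ}
    (hV : Integrable V P) (hV' : Integrable V' P)
    (h : ∀ᵐ s ∂P.restrict A, condMean P X A V (X s) = condMean P X A V' (X s))
    {D : Set 𝒳} (hD : MeasurableSet D) :
    ∫ s in A ∩ X ⁻¹' D, V s ∂P = ∫ s in A ∩ X ⁻¹' D, V' s ∂P := by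
  rw [← setIntegral_preimage_condMean hX hV hD, ← setIntegral_preimage_condMean hX hV' hD]
  exact integral_congr_ae (ae_restrict_of_ae_restrict_of_subset Set.inter_subset_left h)

lemma condMean_add (hX : Measurable X) {V V' : S → ℝ}
    (hV : Integrable V P) (hV' : Integrable V' P) :
    ∀ᵐ s ∂P.restrict A, condMean P X A (fun s => V s + V' s) (X s) =
      condMean P X A V (X s) + condMean P X A V' (X s) := by
  rw [← ae_cond_iff]
  filter_upwards [condMean_ae_eq (A := A) hX (hV.add hV'), condMean_ae_eq (A := A) hX hV,
    condMean_ae_eq (A := A) hX hV', condExp_add (integrable_cond hV) (integrable_cond hV')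
      (MeasurableSpace.comap X inferInstance)] with s h1 h2 h3 h4
  rw [← h2, ← h3]
  exact h1.symm.trans h4

lemma condMean_nonneg (hX : Measurable X) {V : S → ℝ} (hV : Integrable V P) (h0 : ∀ s, 0 ≤ V s) :
    ∀ᵐ s ∂P.restrict A, 0 ≤ condMean P X A V (X s) := by
  rw [← ae_cond_iff]
  filter_upwards [condMean_ae_eq (A := A) hX hV, condExp_nonneg (ae_of_all (P[|A]) h0)
    (m := MeasurableSpace.comap X inferInstance)] with s h1 h2
  rw [← h1]
  exact h2

/-! ### Change of group by odds weighting -/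

/-- If `g (X)` integrates over covariate events of `A` to their probability in `D`, it is the
density of the covariates in `D` with respect to those in `A`. -/
lemma setLIntegral_eq_of_density (hX : Measurable X) {D : Set S}
    {g : 𝒳 → ℝ} (hg : Measurable g) (hgi : IntegrableOn (fun s => g (X s)) A P)
    (hg0 : ∀ᵐ s ∂P.restrict A, 0 ≤ g (X s))
    (h : ∀ F : Set 𝒳, MeasurableSet F → P.real (D ∩ X ⁻¹' F) = ∫ s in A ∩ X ⁻¹' F, g (X s) ∂P)
    {k : 𝒳 → ℝ≥0∞} (hk : Measurable k) :
    ∫⁻ s in D, k (X s) ∂P = ∫⁻ s in A, ENNReal.ofReal (g (X s)) * k (X s) ∂P := by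
  have hmeas : (P.restrict D).map X =
      ((P.restrict A).map X).withDensity fun x => ENNReal.ofReal (g x) := by
    ext F hF
    rw [Measure.map_apply hX hF, Measure.restrict_apply (hX hF), withDensity_apply _ hF,
      setLIntegral_map hF hg.ennreal_ofReal hX, Measure.restrict_restrict (hX hF),
      Set.inter_comm _ D, Set.inter_comm _ A, ← ofReal_measureReal, h F hF,
      ofReal_integral_eq_lintegral_ofReal (hgi.mono_set Set.inter_subset_left)
        (ae_restrict_of_ae_restrict_of_subset Set.inter_subset_left hg0)]
  rw [← lintegral_map hk hX, hmeas, lintegral_withDensity_eq_lintegral_mul _ hg.ennreal_ofReal hk,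
    lintegral_map (hg.ennreal_ofReal.mul hk) hX]
  rfl

/-- Weighting the comparison group `C` by the odds of the propensity score of `E` within `E ∪ C`
balances its covariates with those of `E`. -/
lemma setLIntegral_odds (hX : Measurable X) {E C : Set S} (hE : MeasurableSet E)
    (hC : MeasurableSet C) (hEC : Disjoint E C) {p : 𝒳 → ℝ}
    (hp : p = condMean P X (E ∪ C) (E.indicator fun _ => (1 : ℝ)))
    (hlt : ∀ᵐ s ∂P.restrict (E ∪ C), p (X s) < 1) {k : 𝒳 → ℝ≥0∞} (hk : Measurable k) :
    ∫⁻ s in E, k (X s) ∂P = ∫⁻ s in C, ENNReal.ofReal (odds (p (X s))) * k (X s) ∂P := by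
  have hV : Integrable (E.indicator fun _ => (1 : ℝ)) P := (integrable_const _).indicator hE
  have hpm : Measurable p := hp ▸ measurable_condMean _
  have hpi : IntegrableOn (fun s => p (X s)) (E ∪ C) P := hp ▸ integrableOn_condMean hX hV
  have hp0 : ∀ᵐ s ∂P.restrict (E ∪ C), 0 ≤ p (X s) := by
    rw [hp]
    exact condMean_nonneg hX hV fun s => Set.indicator_nonneg (fun _ _ => zero_le_one) s
  -- Relative to the covariates in E ∪ C, those in E have density p and, by `hint'`, those in C have
  -- density 1 - p; the ratio of the two is the odds.
  have hint : ∀ F : Set 𝒳, MeasurableSet F →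
      P.real (E ∩ X ⁻¹' F) = ∫ s in (E ∪ C) ∩ X ⁻¹' F, p (X s) ∂P := fun F hF => by
    rw [hp, setIntegral_preimage_condMean hX hV hF, integral_indicator hE,
      Measure.restrict_restrict hE]
    have : E ∩ ((E ∪ C) ∩ X ⁻¹' F) = E ∩ X ⁻¹' F := by
      ext s; simp only [Set.mem_inter_iff, Set.mem_union]; tauto
    rw [this]
    simp
  have hint' : ∀ F : Set 𝒳, MeasurableSet F →
      P.real (C ∩ X ⁻¹' F) = ∫ s in (E ∪ C) ∩ X ⁻¹' F, (1 - p (X s)) ∂P := fun F hF => by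
    rw [integral_sub (integrable_const _) (hpi.mono_set Set.inter_subset_left), ← hint F hF,
      Set.union_inter_distrib_right]
    simp only [integral_const, smul_eq_mul, mul_one, measureReal_restrict_apply_univ]
    rw [measureReal_union (hEC.mono Set.inter_subset_left Set.inter_subset_left)
      (hC.inter (hX hF))]
    ring
  have hodds : Measurable fun x => odds (p x) := hpm.div (measurable_const.sub hpm)
  rw [setLIntegral_eq_of_density hX hpm hpi hp0 hint hk,
    setLIntegral_eq_of_density (D := C) hX (g := fun x => 1 - p x) (measurable_const.sub hpm)
      ((integrable_const _).sub hpi) (by filter_upwards [hlt] with s hs; linarith) hint'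
      (k := fun x => ENNReal.ofReal (odds (p x)) * k x) (hodds.ennreal_ofReal.mul hk)]
  refine lintegral_congr_ae ?_
  filter_upwards [hlt] with s hs
  rw [← mul_assoc, ← ENNReal.ofReal_mul (by linarith), odds,
    mul_div_cancel₀ _ (by linarith : 1 - p (X s) ≠ 0)]

omit [IsProbabilityMeasure P] in
-- The covariate law in E is absolutely continuous with respect to that in C. Identities for control
-- regressions, known only almost surely on C, can thereby be used on the cohort.
lemma ae_of_setLIntegral_odds {E C : Set S} (hX : Measurable X) {w : 𝒳 → ℝ≥0∞}
    (h : ∀ k : 𝒳 → ℝ≥0∞, Measurable k → ∫⁻ s in E, k (X s) ∂P = ∫⁻ s in C, w (X s) * k (X s) ∂P)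
    {q : 𝒳 → Prop} (hq : MeasurableSet {x | q x}) (hC : ∀ᵐ s ∂P.restrict C, q (X s)) :
    ∀ᵐ s ∂P.restrict E, q (X s) := by
  have hk : Measurable ({x | q x}ᶜ.indicator fun _ => (1 : ℝ≥0∞)) :=
    measurable_const.indicator hq.compl
  have h0 : ∫⁻ s in E, {x | q x}ᶜ.indicator (fun _ => (1 : ℝ≥0∞)) (X s) ∂P = 0 := by
    rw [h _ hk]
    refine lintegral_eq_zero_of_ae_eq_zero ?_
    filter_upwards [hC] with s hs
    simp [hs]
  rw [lintegral_eq_zero_iff (f := fun s => {x | q x}ᶜ.indicator (fun _ => (1 : ℝ≥0∞)) (X s))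
    (hk.comp hX)] at h0
  filter_upwards [h0] with s hs
  by_contra hcon
  simp [hcon] at hs

end CondMean

end IDiD

namespace IDiD

/-! ### Exposure cohorts -/

section Exposure

variable {T : ℕ} {S 𝒳 : Type*} {M : Model T S 𝒳} {c : ControlGroup} {e t : Period T}

lemma prev_val (u : Period T) : (u.prev : ℕ) = max 1 ((u : ℕ) - 1) := rfl

lemma prev_le (u : Period T) : u.prev ≤ u := by
  have := (Finset.mem_Icc.1 u.2).1
  rw [← Subtype.coe_le_coe, prev_val]
  omega

lemma prev_lt {u : Period T} (h : 2 ≤ (u : ℕ)) : u.prev < u := by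
  rw [← Subtype.coe_lt_coe, prev_val]
  omega

lemma exposure_eq_coe {z : Path T} {u : Period T} (h : exposure z = (u : Cohort T)) :
    z u = true := (Finset.mem_filter.1 (Finset.mem_of_min h)).2

lemma exposure_le {z : Path T} {u : Period T} (h : z u = true) : exposure z ≤ (u : Cohort T) :=
  Finset.min_le (Finset.mem_filter.2 ⟨Finset.mem_univ _, h⟩)

lemma cohortInd_eq_indicator (M : Model T S 𝒳) (e : Period T) :
    (fun s => cohortInd e (M.zPath s)) = (M.cohortEvent e).indicator fun _ => (1 : ℝ) := by
  ext s
  by_cases h : exposure (M.zPath s) = (e : Cohort T) <;>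
    simp [cohortInd, Model.cohortEvent, Model.E, Set.indicator, h]

lemma controlInd_eq_indicator (M : Model T S 𝒳) (c : ControlGroup) (e t : Period T) :
    (fun s => controlInd c e t (M.zPath s)) =
      (M.controlEvent c e t).indicator fun _ => (1 : ℝ) := by
  ext s
  by_cases h : IsControl c e t (M.zPath s) <;>
    simp [controlInd, Model.controlEvent, Set.indicator, h]

lemma not_isControl {z : Path T} (h : exposure z = (e : Cohort T)) : ¬ IsControl c e t z := by
  cases c
  · simp [IsControl, h]
  · simp [IsControl, h]

lemma disjoint_events (M : Model T S 𝒳) (c : ControlGroup) (e t : Period T) :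
    Disjoint (M.cohortEvent e) (M.controlEvent c e t) :=
  Set.disjoint_left.2 fun _ h => not_isControl h

/-- The cohorts that make up a control group under staggered adoption. -/
def controlCohorts (c : ControlGroup) (t : Period T) : Set (Cohort T) :=
  match c with
  | .never => {⊤}
  | .notYet => {v | (t : Cohort T) < v}

lemma lt_of_mem_controlCohorts {v : Cohort T} (h : v ∈ controlCohorts c t) :
    (t : Cohort T) < v := by
  cases c
  · rw [Set.mem_singleton_iff.1 h]; exact WithTop.coe_lt_top t
  · exact h

variable [MeasurableSpace S] {P : Measure S}

lemma ae_monotone_instrument (hstag : M.StaggeredAdoption P) :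
    ∀ᵐ s ∂P, ∀ u v : Period T, u ≤ v → M.Z u s = true → M.Z v s = true := by
  have h2 : ∀ᵐ s ∂P, ∀ u : Period T, 2 ≤ (u : ℕ) → M.Z u.prev s = true → M.Z u s = true :=
    ae_all_iff.2 fun u => by
      by_cases hu : 2 ≤ (u : ℕ)
      · filter_upwards [hstag.2 u hu] with s hs _ using hs
      · exact ae_of_all _ fun s h => absurd h hu
  filter_upwards [h2] with s hs u v huv hu
  induction' hn : (v : ℕ) - u with n ih generalizing v
  · have : u = v := Subtype.ext (by have : (u : ℕ) ≤ v := huv; omega)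
    exact this ▸ hu
  · have h1 := (Finset.mem_Icc.1 u.2).1
    refine hs v (by omega) (ih v.prev ?_ ?_)
    · rw [← Subtype.coe_le_coe, prev_val]; omega
    · rw [prev_val]; omega

/-- The instrument never switches off, so Z_t = 0 says that exposure comes after t; as e ≤ t, the
clause E ≠ e is then automatic. -/
lemma ae_isControl_iff (hstag : M.StaggeredAdoption P) (het : e ≤ t) :
    ∀ᵐ s ∂P, IsControl c e t (M.zPath s) ↔ M.E s ∈ controlCohorts c t := by
  filter_upwards [ae_monotone_instrument hstag] with s hs
  cases c
  · rfl
  · constructor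
    · rintro ⟨-, h0⟩
      refine lt_of_not_ge (α := Cohort T) fun hle => ?_
      obtain ⟨u, hu, hut⟩ := WithTop.le_coe_iff.1 hle
      have := hs u t hut (exposure_eq_coe hu)
      rw [show M.Z t s = false from h0] at this
      exact Bool.false_ne_true this
    · intro h
      have h' : (t : Cohort T) < exposure (M.zPath s) := h
      refine ⟨fun heq => ?_, ?_⟩
      · rw [heq] at h'
        exact absurd het (not_le.2 (WithTop.coe_lt_coe.1 h'))
      · by_contra hne
        exact absurd (exposure_le (by simpa using hne)) (not_le.2 h')

/-- Nobody is exposed in period 1. Hence `e.prev` really is e - 1, and the default value of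
`Period.prev` at period 1 plays no role. -/
lemma two_le_of_cohortEvent (hstag : M.StaggeredAdoption P) (he : P (M.cohortEvent e) ≠ 0) :
    2 ≤ (e : ℕ) := by
  by_contra hlt
  have h1 : (e : ℕ) = 1 := by have := (Finset.mem_Icc.1 e.2).1; omega
  refine he (measure_mono_null (fun s hs => ?_) (ae_iff.1 (hstag.1 e h1)))
  have : M.Z e s = true := exposure_eq_coe hs
  simp [this]

/-- `NoCarryover` concerns fixed paths in the supports. There are finitely many paths and those of
probability zero are almost surely not realized, so the random observed paths may be inserted. -/
lemma ae_yPath_eq (hcarry : M.NoCarryover P) :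
    ∀ᵐ s ∂P, ∀ u, M.yPath s u = M.exposedY (M.E s) u s := by
  have h : ∀ᵐ s ∂P, ∀ (z d : Path T) (u : Period T), M.zPath s = z → M.dPath s = d →
      M.Ypath d z u s = M.Y (d u) u s := by
    refine ae_all_iff.2 fun z => ae_all_iff.2 fun d => ae_all_iff.2 fun u => ?_
    by_cases hz : P {s | M.zPath s = z} = 0
    · have : ∀ᵐ s ∂P, M.zPath s ≠ z := by rw [ae_iff]; simpa using hz
      filter_upwards [this] with s hs h
      exact absurd h hs
    by_cases hd : P {s | M.dPath s = d} = 0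
    · have : ∀ᵐ s ∂P, M.dPath s ≠ d := by rw [ae_iff]; simpa using hd
      filter_upwards [this] with s hs _ h
      exact absurd h hs
    filter_upwards [hcarry z hz d hd u] with s hs _ _
    exact hs
  filter_upwards [h] with s hs u
  exact hs _ _ u rfl rfl

/-! ### Measurability -/

variable [MeasurableSpace 𝒳]

lemma measurable_select {ι β : Type*} [Countable ι] [MeasurableSpace β] {k : S → ι}
    (hk : ∀ i, MeasurableSet {s | k s = i}) {f : ι → S → β} (hf : ∀ i, Measurable (f i)) :
    Measurable fun s => f (k s) s := by
  intro D hD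
  have : (fun s => f (k s) s) ⁻¹' D = ⋃ i, {s | k s = i} ∩ f i ⁻¹' D := by
    ext s; simp
  rw [this]
  exact MeasurableSet.iUnion fun i => (hk i).inter (hf i hD)

lemma measurable_num : Measurable num := measurable_from_top

namespace Model.IsMeasurable

variable (hM : M.IsMeasurable)
include hM

lemma zPath : Measurable M.zPath := measurable_pi_lambda _ hM.Z

lemma measurableSet_zPath (D : Set (Path T)) : MeasurableSet (M.zPath ⁻¹' D) :=
  hM.zPath (Set.toFinite D).measurableSet

lemma cohortEvent (v : Cohort T) : MeasurableSet (M.cohortEvent v) :=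
  hM.measurableSet_zPath {z | exposure z = v}

lemma controlEvent (c : ControlGroup) (e t : Period T) : MeasurableSet (M.controlEvent c e t) :=
  hM.measurableSet_zPath {z | IsControl c e t z}

lemma dPath : Measurable M.dPath :=
  measurable_pi_lambda _ fun u => measurable_select (k := M.E) hM.cohortEvent fun v => hM.Dpot v u

lemma yPath : Measurable M.yPath := by
  refine measurable_pi_lambda _ fun u => ?_
  refine measurable_select (k := fun s => (M.dPath s, M.zPath s))
    (f := fun x s => M.Ypath x.1 x.2 u s) (fun x => ?_) fun x => hM.Ypath _ _ _
  exact (hM.dPath.prodMk hM.zPath) (measurableSet_singleton x)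

lemma obs : Measurable M.obs := hM.yPath.prodMk (hM.dPath.prodMk (hM.zPath.prodMk hM.X))

lemma exposedY (v : Cohort T) (u : Period T) : Measurable (M.exposedY v u) :=
  measurable_select (k := M.Dpot v u) (f := fun b s => M.Y b u s)
    (fun b => hM.Dpot v u (measurableSet_singleton b)) fun b => hM.Y b u

end Model.IsMeasurable

lemma memLp_exposedY (hM : M.IsMeasurable)
    (hmom : ∀ (b : Bool) (u : Period T), MemLp (M.Y b u) 2 P) (v : Cohort T) (u : Period T) :
    MemLp (M.exposedY v u) 2 P := by
  refine MemLp.mono' (((hmom true u).norm).add ((hmom false u).norm))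
    (hM.exposedY v u).aestronglyMeasurable (ae_of_all _ fun s => ?_)
  simp only [Model.exposedY, Pi.add_apply]
  cases M.Dpot v u s
  · exact le_add_of_nonneg_left (norm_nonneg _)
  · exact le_add_of_nonneg_right (norm_nonneg _)

lemma memLp_yPath (hM : M.IsMeasurable) (hcarry : M.NoCarryover P)
    (hmom : ∀ (b : Bool) (u : Period T), MemLp (M.Y b u) 2 P) (u : Period T) :
    MemLp (fun s => M.yPath s u) 2 P := by
  refine MemLp.mono' (((hmom true u).norm).add ((hmom false u).norm))
    ((measurable_pi_apply u).comp hM.yPath).aestronglyMeasurable ?_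
  filter_upwards [ae_yPath_eq hcarry] with s hs
  rw [hs u]
  simp only [Model.exposedY, Pi.add_apply]
  cases M.Dpot (M.E s) u s
  · exact le_add_of_nonneg_left (norm_nonneg _)
  · exact le_add_of_nonneg_right (norm_nonneg _)

lemma abs_num_le (b : Bool) : |num b| ≤ 1 := by cases b <;> simp [num]

lemma memLp_num [IsFiniteMeasure P] {D : S → Bool} (hD : Measurable D) :
    MemLp (fun s => num (D s)) 2 P :=
  MemLp.of_bound (measurable_num.comp hD).aestronglyMeasurable 1 (ae_of_all _ fun _ => abs_num_le _)

/-! ### Identification by differences in differences -/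

variable [IsProbabilityMeasure P] {W : Cohort T → Period T → S → ℝ} {V : Period T → S → ℝ}

/-- `W` stands for the potential treatment or for the exposed outcome, and `V` for its observed
version, so both are handled at once. In cohort v the observed value is `W v`, which no anticipation
exchanges for `W ⊤` before v. -/
lemma setIntegral_cohort_eq (hM : M.IsMeasurable) (hW : ∀ v u, Integrable (W v u) P)
    (hV : ∀ u, ∀ᵐ s ∂P, V u s = W (M.E s) u s)
    (hanti : ∀ e : Period T, P (M.cohortEvent e) ≠ 0 → ∀ u : Period T, u < e →
      ∀ᵐ s ∂(P[|M.cohortEvent e]), condMean P M.X (M.cohortEvent e) (W e u) (M.X s) =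
        condMean P M.X (M.cohortEvent e) (W ⊤ u) (M.X s))
    {v : Cohort T} {u : Period T} (huv : (u : Cohort T) < v) {D : Set 𝒳} (hD : MeasurableSet D) :
    ∫ s in M.cohortEvent v ∩ M.X ⁻¹' D, V u s ∂P =
      ∫ s in M.cohortEvent v ∩ M.X ⁻¹' D, W ⊤ u s ∂P := by
  have h1 : ∫ s in M.cohortEvent v ∩ M.X ⁻¹' D, V u s ∂P =
      ∫ s in M.cohortEvent v ∩ M.X ⁻¹' D, W v u s ∂P := by
    refine setIntegral_congr_ae ((hM.cohortEvent v).inter (hM.X hD)) ?_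
    filter_upwards [hV u] with s hs hmem
    rw [hs, show M.E s = v from hmem.1]
  rw [h1]
  induction v using WithTop.recTopCoe with
  | top => rfl
  | coe v =>
    by_cases h0 : P (M.cohortEvent v) = 0
    · rw [Measure.restrict_eq_zero.2 (measure_mono_null Set.inter_subset_left h0)]
      simp
    · exact setIntegral_eq_of_condMean_eq hM.X (hW _ _) (hW _ _)
        (ae_cond_iff.1 (hanti v h0 u (WithTop.coe_lt_coe.1 huv))) hD

/-- No anticipation holds cohort by cohort, whereas the control group is, up to a null set, a finite
disjoint union of cohorts later than t. Working with integrals allows summation over them. -/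
lemma setIntegral_control_eq (hM : M.IsMeasurable) (hstag : M.StaggeredAdoption P) (het : e ≤ t)
    (hW : ∀ v u, Integrable (W v u) P) (hVi : ∀ u, Integrable (V u) P)
    (hV : ∀ u, ∀ᵐ s ∂P, V u s = W (M.E s) u s)
    (hanti : ∀ e : Period T, P (M.cohortEvent e) ≠ 0 → ∀ u : Period T, u < e →
      ∀ᵐ s ∂(P[|M.cohortEvent e]), condMean P M.X (M.cohortEvent e) (W e u) (M.X s) =
        condMean P M.X (M.cohortEvent e) (W ⊤ u) (M.X s))
    {u : Period T} (hut : u ≤ t) {D : Set 𝒳} (hD : MeasurableSet D) :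
    ∫ s in M.controlEvent c e t ∩ M.X ⁻¹' D, V u s ∂P =
      ∫ s in M.controlEvent c e t ∩ M.X ⁻¹' D, W ⊤ u s ∂P := by
  classical
  let I : Finset (Cohort T) := Finset.univ.filter (· ∈ controlCohorts c t)
  have hset : (M.controlEvent c e t ∩ M.X ⁻¹' D : Set S) =ᵐ[P]
      (⋃ v ∈ I, M.cohortEvent v ∩ M.X ⁻¹' D : Set S) := by
    filter_upwards [ae_isControl_iff (c := c) hstag het] with s hs
    refine propext ?_
    change (IsControl c e t (M.zPath s) ∧ s ∈ M.X ⁻¹' D) ↔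
      s ∈ ⋃ v ∈ I, M.cohortEvent v ∩ M.X ⁻¹' D
    simp only [I, Set.mem_iUnion, Finset.mem_filter, Finset.mem_univ, true_and, hs]
    constructor
    · rintro ⟨h1, h2⟩
      exact ⟨M.E s, h1, rfl, h2⟩
    · rintro ⟨v, h1, h2, h3⟩
      exact ⟨(show M.E s = v from h2) ▸ h1, h3⟩
  have hsum : ∀ U : S → ℝ, Integrable U P → ∫ s in M.controlEvent c e t ∩ M.X ⁻¹' D, U s ∂P =
      ∑ v ∈ I, ∫ s in M.cohortEvent v ∩ M.X ⁻¹' D, U s ∂P := fun U hU => by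
    rw [setIntegral_congr_set hset, integral_biUnion_finset]
    · exact fun v _ => (hM.cohortEvent v).inter (hM.X hD)
    · intro v _ v' _ hvv'
      refine Set.disjoint_left.2 fun s hs hs' => hvv' ?_
      exact (show M.E s = v from hs.1).symm.trans hs'.1
    · exact fun v _ => hU.integrableOn
  rw [hsum _ (hVi u), hsum _ (hW ⊤ u)]
  refine Finset.sum_congr rfl fun v hv => ?_
  refine setIntegral_cohort_eq hM hW hV hanti (lt_of_le_of_lt (WithTop.coe_le_coe.2 hut) ?_) hD
  exact lt_of_mem_controlCohorts (Finset.mem_filter.1 hv).2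

/-- Telescoping of one-period parallel trends, by induction on u - e. Additivity of the control
regression holds only on the control group, and `hac` carries it to cohort e. -/
lemma condMean_trend (hM : M.IsMeasurable)
    (hac : ∀ q : 𝒳 → Prop, MeasurableSet {x | q x} →
      (∀ᵐ s ∂P.restrict (M.controlEvent c e t), q (M.X s)) →
      ∀ᵐ s ∂P.restrict (M.cohortEvent e), q (M.X s))
    (he2 : 2 ≤ (e : ℕ)) (hW : ∀ u, Integrable (W ⊤ u) P)
    (htrend : ∀ u : Period T, e ≤ u → u ≤ t → ∀ᵐ s ∂(P[|M.cohortEvent e]),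
      condMean P M.X (M.cohortEvent e) (fun s => W ⊤ u s - W ⊤ u.prev s) (M.X s) =
        condMean P M.X (M.controlEvent c e t) (fun s => W ⊤ u s - W ⊤ u.prev s) (M.X s))
    (u : Period T) (heu : e ≤ u) (hut : u ≤ t) :
    ∀ᵐ s ∂P.restrict (M.cohortEvent e),
      condMean P M.X (M.cohortEvent e) (fun s => W ⊤ u s - W ⊤ e.prev s) (M.X s) =
        condMean P M.X (M.controlEvent c e t) (fun s => W ⊤ u s - W ⊤ e.prev s) (M.X s) := by
  induction' hn : (u : ℕ) - e with n ih generalizing u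
  · have : e = u := Subtype.ext (by have : (e : ℕ) ≤ u := heu; omega)
    subst this
    exact ae_cond_iff.1 (htrend e le_rfl hut)
  · have h1 : e ≤ u.prev := by rw [← Subtype.coe_le_coe, prev_val]; omega
    have h2 := ih u.prev h1 ((prev_le u).trans hut) (by rw [prev_val]; omega)
    have h3 := ae_cond_iff.1 (htrend u heu hut)
    have hs : (fun s => W ⊤ u s - W ⊤ e.prev s) =
        fun s => (W ⊤ u s - W ⊤ u.prev s) + (W ⊤ u.prev s - W ⊤ e.prev s) := by
      ext s; ring
    rw [hs]
    have hi1 : Integrable (fun s => W ⊤ u s - W ⊤ u.prev s) P := (hW u).sub (hW u.prev)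
    have hi2 : Integrable (fun s => W ⊤ u.prev s - W ⊤ e.prev s) P := (hW u.prev).sub (hW e.prev)
    have h5 := hac _ (measurableSet_eq_fun (measurable_condMean _)
      ((measurable_condMean _).add (measurable_condMean _)))
      (condMean_add (A := M.controlEvent c e t) hM.X hi1 hi2)
    filter_upwards [h2, h3, condMean_add (A := M.cohortEvent e) hM.X hi1 hi2, h5]
      with s g2 g3 g4 g5
    rw [g4, g2, g3]
    exact g5.symm

/-- The covariate-adjusted difference in differences identifies the mean effect of exposure in
cohort `e`. -/
lemma setIntegral_condMean_diff (hM : M.IsMeasurable) (hstag : M.StaggeredAdoption P)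
    (het : e ≤ t) (he : P (M.cohortEvent e) ≠ 0)
    (hac : ∀ q : 𝒳 → Prop, MeasurableSet {x | q x} →
      (∀ᵐ s ∂P.restrict (M.controlEvent c e t), q (M.X s)) →
      ∀ᵐ s ∂P.restrict (M.cohortEvent e), q (M.X s))
    (hW : ∀ v u, Integrable (W v u) P) (hVi : ∀ u, Integrable (V u) P)
    (hV : ∀ u, ∀ᵐ s ∂P, V u s = W (M.E s) u s)
    (hanti : ∀ e : Period T, P (M.cohortEvent e) ≠ 0 → ∀ u : Period T, u < e →
      ∀ᵐ s ∂(P[|M.cohortEvent e]), condMean P M.X (M.cohortEvent e) (W e u) (M.X s) =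
        condMean P M.X (M.cohortEvent e) (W ⊤ u) (M.X s))
    (htrend : ∀ u : Period T, e ≤ u → u ≤ t → ∀ᵐ s ∂(P[|M.cohortEvent e]),
      condMean P M.X (M.cohortEvent e) (fun s => W ⊤ u s - W ⊤ u.prev s) (M.X s) =
        condMean P M.X (M.controlEvent c e t) (fun s => W ⊤ u s - W ⊤ u.prev s) (M.X s)) :
    ∫ s in M.cohortEvent e,
      (condMean P M.X (M.cohortEvent e) (fun s => V t s - V e.prev s) (M.X s) -
        condMean P M.X (M.controlEvent c e t) (fun s => V t s - V e.prev s) (M.X s)) ∂P =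
      ∫ s in M.cohortEvent e, (W e t s - W ⊤ t s) ∂P := by
  have he2 := two_le_of_cohortEvent hstag he
  have hsub : ∀ {A : Set S} {U U' : S → ℝ}, Integrable U P → Integrable U' P →
      ∫ s in A, (U s - U' s) ∂P = ∫ s in A, U s ∂P - ∫ s in A, U' s ∂P := fun hU hU' =>
    integral_sub hU.integrableOn hU'.integrableOn
  have hiV : Integrable (fun s => V t s - V e.prev s) P := (hVi t).sub (hVi e.prev)
  have hi0 : Integrable (fun s => W ⊤ t s - W ⊤ e.prev s) P := (hW ⊤ t).sub (hW ⊤ e.prev)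
  have hi1 : Integrable (fun s => W e t s - W ⊤ e.prev s) P := (hW e t).sub (hW ⊤ e.prev)
  -- Controls are unexposed at both t and e - 1, so both ends of the difference may be replaced by
  -- `W ⊤`.
  have hC : ∀ᵐ s ∂P.restrict (M.controlEvent c e t),
      condMean P M.X (M.controlEvent c e t) (fun s => V t s - V e.prev s) (M.X s) =
      condMean P M.X (M.controlEvent c e t) (fun s => W ⊤ t s - W ⊤ e.prev s) (M.X s) := by
    refine condMean_congr hM.X hiV hi0 fun D hD => ?_
    rw [hsub (hVi t) (hVi _), hsub (hW ⊤ t) (hW ⊤ _),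
      setIntegral_control_eq hM hstag het hW hVi hV hanti le_rfl hD,
      setIntegral_control_eq hM hstag het hW hVi hV hanti ((prev_le e).trans het) hD]
  have hC' := hac _ (measurableSet_eq_fun (measurable_condMean _) (measurable_condMean _)) hC
  -- In cohort e only the baseline precedes exposure; there no anticipation applies, while at t the
  -- observed value stays `W e t`. The common baseline `W ⊤ e.prev` cancels at the end.
  have hE : ∀ᵐ s ∂P.restrict (M.cohortEvent e),
      condMean P M.X (M.cohortEvent e) (fun s => V t s - V e.prev s) (M.X s) =
      condMean P M.X (M.cohortEvent e) (fun s => W e t s - W ⊤ e.prev s) (M.X s) := by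
    refine condMean_congr hM.X hiV hi1 fun D hD => ?_
    rw [hsub (hVi t) (hVi _), hsub (hW e t) (hW ⊤ _),
      setIntegral_cohort_eq hM hW hV hanti (WithTop.coe_lt_coe.2 (prev_lt he2)) hD]
    congr 1
    refine setIntegral_congr_ae ((hM.cohortEvent e).inter (hM.X hD)) ?_
    filter_upwards [hV t] with s hs hmem
    rw [hs, show M.E s = e from hmem.1]
  have htel := condMean_trend hM hac he2 (hW ⊤) htrend t het le_rfl
  have hcongr := integral_congr_ae (μ := P.restrict (M.cohortEvent e))
    (f := fun s => condMean P M.X (M.cohortEvent e) (fun s => V t s - V e.prev s) (M.X s) -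
        condMean P M.X (M.controlEvent c e t) (fun s => V t s - V e.prev s) (M.X s))
    (g := fun s => condMean P M.X (M.cohortEvent e) (fun s => W e t s - W ⊤ e.prev s) (M.X s) -
        condMean P M.X (M.cohortEvent e) (fun s => W ⊤ t s - W ⊤ e.prev s) (M.X s)) (by
      filter_upwards [hC', hE, htel] with s h1 h2 h3
      rw [h1, h2, h3])
  rw [hcongr, integral_sub (integrableOn_condMean hM.X hi1) (integrableOn_condMean hM.X hi0)]
  have huniv : ∀ U : S → ℝ, Integrable U P →
      ∫ s in M.cohortEvent e, condMean P M.X (M.cohortEvent e) U (M.X s) ∂P =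
        ∫ s in M.cohortEvent e, U s ∂P := fun U hU => by
    simpa using setIntegral_preimage_condMean (A := M.cohortEvent e) hM.X hU MeasurableSet.univ
  rw [huniv _ hi1, huniv _ hi0, hsub (hW e t) (hW _ _), hsub (hW ⊤ t) (hW _ _),
    hsub (hW e t) (hW _ _)]
  ring

end Exposure

end IDiD

namespace IDiD

section Law

variable {T : ℕ} {S 𝒳 : Type*} [MeasurableSpace S] [MeasurableSpace 𝒳] {P : Measure S}
  [IsProbabilityMeasure P] {M : Model T S 𝒳} {c : ControlGroup} {e t : Period T}

/-! ### The comparison weights -/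

lemma propensity_eq (M : Model T S 𝒳) (P : Measure S) [IsProbabilityMeasure P] (c : ControlGroup)
    (e t : Period T) : M.propensity P c e t =
      condMean P M.X (M.cohortEvent e ∪ M.controlEvent c e t)
        ((M.cohortEvent e).indicator fun _ => (1 : ℝ)) := by
  rw [← cohortInd_eq_indicator]
  rfl

omit [IsProbabilityMeasure P] in
lemma measurable_propensity : Measurable (M.propensity P c e t) := measurable_condMean _

lemma measurable_odds : Measurable odds := measurable_id.div (measurable_const.sub measurable_id)

lemma ae_propensity_nonneg (hM : M.IsMeasurable) :
    ∀ᵐ s ∂P.restrict (M.cohortEvent e ∪ M.controlEvent c e t),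
      0 ≤ M.propensity P c e t (M.X s) := by
  rw [propensity_eq]
  exact condMean_nonneg hM.X ((integrable_const _).indicator (hM.cohortEvent e))
    fun s => Set.indicator_nonneg (fun _ _ => zero_le_one) s

variable {δ : ℝ}

lemma setLIntegral_cohort_eq (hM : M.IsMeasurable) (hδ : 0 < δ)
    (hp : ∀ᵐ s ∂(P[|M.slice c e t]), M.propensity P c e t (M.X s) < 1 - δ)
    {k : 𝒳 → ℝ≥0∞} (hk : Measurable k) :
    ∫⁻ s in M.cohortEvent e, k (M.X s) ∂P =
      ∫⁻ s in M.controlEvent c e t,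
        ENNReal.ofReal (odds (M.propensity P c e t (M.X s))) * k (M.X s) ∂P := by
  refine setLIntegral_odds hM.X (hM.cohortEvent e) (hM.controlEvent c e t)
    (disjoint_events M c e t) (propensity_eq M P c e t) ?_ hk
  filter_upwards [ae_cond_iff.1 hp] with s hs
  linarith

/-- The numerator p is below one and the denominator 1 - p exceeds δ. -/
lemma ae_odds_bounds (hM : M.IsMeasurable) (hδ : 0 < δ)
    (hp : ∀ᵐ s ∂(P[|M.slice c e t]), M.propensity P c e t (M.X s) < 1 - δ) :
    ∀ᵐ s ∂P.restrict (M.controlEvent c e t), 0 ≤ odds (M.propensity P c e t (M.X s)) ∧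
      odds (M.propensity P c e t (M.X s)) ≤ δ⁻¹ := by
  have h1 := ae_restrict_of_ae_restrict_of_subset (Set.subset_union_right
    (s := M.cohortEvent e) (t := M.controlEvent c e t)) (ae_cond_iff.1 hp)
  have h2 := ae_restrict_of_ae_restrict_of_subset (Set.subset_union_right
    (s := M.cohortEvent e) (t := M.controlEvent c e t)) (ae_propensity_nonneg (P := P) hM)
  filter_upwards [h1, h2] with s hs1 hs2
  have h3 : 0 < 1 - M.propensity P c e t (M.X s) := by linarith
  refine ⟨div_nonneg hs2 h3.le, ?_⟩
  rw [odds, div_le_iff₀ h3, inv_mul_eq_div, le_div_iff₀ hδ]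
  nlinarith

lemma ae_cohort_of_ae_control (hM : M.IsMeasurable) (hδ : 0 < δ)
    (hp : ∀ᵐ s ∂(P[|M.slice c e t]), M.propensity P c e t (M.X s) < 1 - δ) :
    ∀ q : 𝒳 → Prop, MeasurableSet {x | q x} →
      (∀ᵐ s ∂P.restrict (M.controlEvent c e t), q (M.X s)) →
      ∀ᵐ s ∂P.restrict (M.cohortEvent e), q (M.X s) := fun _ hq hC =>
  ae_of_setLIntegral_odds hM.X (w := fun x => ENNReal.ofReal (odds (M.propensity P c e t x)))
    (fun _ hk => setLIntegral_cohort_eq hM hδ hp hk) hq hC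

/-! ### Balance and regression under the law of the observed data -/

lemma measurable_pathFun (f : Path T → ℝ) : Measurable fun o : Obs T 𝒳 => f o.2.2.1 :=
  (measurable_of_finite f).comp (measurable_fst.comp (measurable_snd.comp measurable_snd))

lemma measurable_covariates : Measurable fun o : Obs T 𝒳 => o.2.2.2 :=
  measurable_snd.comp (measurable_snd.comp measurable_snd)

lemma isProbabilityMeasure_law (hM : M.IsMeasurable) : IsProbabilityMeasure (M.law P) :=
  Measure.isProbabilityMeasure_map hM.obs.aemeasurable

section Indicator

variable {g : Path T → ℝ} {A : Set S} (hM : M.IsMeasurable) (hA : MeasurableSet A)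
  (hg : (fun s => g (M.zPath s)) = A.indicator fun _ => (1 : ℝ)) {f : Obs T 𝒳 → ℝ}
  (hf : Measurable f)
include hM hA hg

omit [IsProbabilityMeasure P] in
include hf in
lemma integral_indicator_mul :
    ∫ o, g o.2.2.1 * f o ∂(M.law P) = ∫ s in A, f (M.obs s) ∂P := by
  have hm : Measurable fun o : Obs T 𝒳 => g o.2.2.1 * f o := (measurable_pathFun g).mul hf
  rw [Model.law, integral_map hM.obs.aemeasurable hm.aestronglyMeasurable, ← integral_indicator hA]
  refine integral_congr_ae (ae_of_all _ fun s => ?_)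
  change g (M.zPath s) * f (M.obs s) = _
  rw [congrFun hg s]
  by_cases h : s ∈ A <;> simp [h]

omit [IsProbabilityMeasure P] in
include hf in
lemma memLp_indicator_mul :
    MemLp (fun o => g o.2.2.1 * f o) 2 (M.law P) ↔
      MemLp (fun s => f (M.obs s)) 2 (P.restrict A) := by
  have hm : Measurable fun o : Obs T 𝒳 => g o.2.2.1 * f o := (measurable_pathFun g).mul hf
  rw [Model.law, memLp_map_measure_iff hm.aestronglyMeasurable hM.obs.aemeasurable,
    ← memLp_indicator_iff_restrict hA]
  refine iff_of_eq (congrArg (MemLp · 2 P) (funext fun s => ?_))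
  change g (M.zPath s) * f (M.obs s) = _
  rw [congrFun hg s]
  by_cases h : s ∈ A <;> simp [h]

omit [IsProbabilityMeasure P] in
lemma lintegral_indicator_mul {r : 𝒳 → ℝ} (hr : Measurable r) {k : 𝒳 → ℝ≥0∞} (hk : Measurable k) :
    ∫⁻ o, ENNReal.ofReal (g o.2.2.1 * r o.2.2.2) * k o.2.2.2 ∂(M.law P) =
      ∫⁻ s in A, ENNReal.ofReal (r (M.X s)) * k (M.X s) ∂P := by
  have hm : Measurable fun o : Obs T 𝒳 => ENNReal.ofReal (g o.2.2.1 * r o.2.2.2) * k o.2.2.2 :=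
    ((measurable_pathFun g).mul (hr.comp measurable_covariates)).ennreal_ofReal.mul
      (hk.comp measurable_covariates)
  rw [Model.law, lintegral_map hm hM.obs, ← lintegral_indicator hA]
  refine lintegral_congr fun s => ?_
  change ENNReal.ofReal (g (M.zPath s) * r (M.X s)) * k (M.X s) = _
  rw [congrFun hg s]
  by_cases h : s ∈ A <;> simp [h]

end Indicator

omit [IsProbabilityMeasure P] in
lemma ae_law_of_ae_control (hM : M.IsMeasurable) {q : 𝒳 → Prop} (hq : MeasurableSet {x | q x})
    (h : ∀ᵐ s ∂P.restrict (M.controlEvent c e t), q (M.X s)) :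
    ∀ᵐ o ∂(M.law P), controlInd c e t o.2.2.1 ≠ 0 → q o.2.2.2 := by
  rw [Model.law, ae_map_iff hM.obs.aemeasurable]
  · rw [ae_restrict_iff' (hM.controlEvent c e t)] at h
    filter_upwards [h] with s hs hne
    refine hs ?_
    by_contra hcon
    exact hne (if_neg hcon)
  · have h1 : MeasurableSet {o : Obs T 𝒳 | controlInd c e t o.2.2.1 = 0} :=
      measurable_pathFun (fun z => controlInd c e t z) (measurableSet_singleton 0)
    have h2 : MeasurableSet {o : Obs T 𝒳 | q o.2.2.2} := measurable_covariates hq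
    have : {o : Obs T 𝒳 | controlInd c e t o.2.2.1 ≠ 0 → q o.2.2.2} =
        {o | controlInd c e t o.2.2.1 = 0} ∪ {o | q o.2.2.2} := by
      ext o
      simp only [Set.mem_ofPred_eq, Set.mem_union]
      tauto
    rw [this]
    exact h1.union h2

lemma balanced_law (hM : M.IsMeasurable) (hδ : 0 < δ) (hpos : δ < P.real (M.cohortEvent e))
    (hp : ∀ᵐ s ∂(P[|M.slice c e t]), M.propensity P c e t (M.X s) < 1 - δ) :
    Balanced (M.law P) (fun o => cohortInd e o.2.2.1) (fun o => controlInd c e t o.2.2.1)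
      (fun o => o.2.2.2) (fun x => odds (M.propensity P c e t x)) δ⁻¹
      (P.real (M.cohortEvent e)) := by
  have hodds : Measurable fun x => odds (M.propensity P c e t x) :=
    measurable_odds.comp measurable_propensity
  have hb := ae_law_of_ae_control hM (q := fun x => 0 ≤ odds (M.propensity P c e t x) ∧
    odds (M.propensity P c e t x) ≤ δ⁻¹) ((measurableSet_le measurable_const hodds).inter
      (measurableSet_le hodds measurable_const)) (ae_odds_bounds hM hδ hp)
  have hC : ∀ z : Path T, controlInd c e t z = 0 ∨ controlInd c e t z = 1 := fun z => by
    unfold controlInd; split_ifs <;> simp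
  refine
    { measurable_G := measurable_pathFun _
      measurable_C := measurable_pathFun _
      measurable_cov := measurable_covariates
      measurable_r := hodds
      G_eq := fun o => by unfold cohortInd; split_ifs <;> simp
      C_eq := fun o => hC _
      disjoint := fun o => ?_
      nonneg := ?_
      le := ?_
      lintegral_eq := fun h hh => ?_
      pos := hδ.trans hpos
      integral_G := ?_ }
  · by_cases h : exposure o.2.2.1 = (e : Cohort T)
    · exact Or.inr (if_neg (not_isControl h))
    · exact Or.inl (if_neg h)
  · filter_upwards [hb] with o ho
    rcases hC o.2.2.1 with h | h
    · simp [h]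
    · simpa [h] using (ho (by simp [h])).1
  · filter_upwards [hb] with o ho
    rcases hC o.2.2.1 with h | h
    · simp [h, hδ.le]
    · simpa [h] using (ho (by simp [h])).2
  · rw [lintegral_indicator_mul hM (hM.controlEvent c e t) (controlInd_eq_indicator M c e t) hodds
      hh, ← setLIntegral_cohort_eq hM hδ hp hh]
    simpa using lintegral_indicator_mul (P := P) hM (hM.cohortEvent e) (cohortInd_eq_indicator M e)
      (r := fun _ => 1) measurable_const hh
  · have := integral_indicator_mul (P := P) hM (hM.cohortEvent e)
      (cohortInd_eq_indicator M e) (f := fun _ => 1) measurable_const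
    simpa using this

lemma regression_law (hM : M.IsMeasurable) (hδ : 0 < δ)
    (hp : ∀ᵐ s ∂(P[|M.slice c e t]), M.propensity P c e t (M.X s) < 1 - δ)
    {V : Obs T 𝒳 → ℝ} (hV : Measurable V) (hVL : MemLp (fun s => V (M.obs s)) 2 P) :
    Regression (M.law P) (fun o => cohortInd e o.2.2.1) (fun o => controlInd c e t o.2.2.1)
      (fun o => o.2.2.2) V (condMean P M.X (M.controlEvent c e t) fun s => V (M.obs s)) := by
  set f := condMean P M.X (M.controlEvent c e t) fun s => V (M.obs s) with hf
  have hfm : Measurable f := measurable_condMean _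
  have hres : Measurable fun o : Obs T 𝒳 => V o - f o.2.2.2 :=
    hV.sub (hfm.comp measurable_covariates)
  have hfC : MemLp (fun s => f (M.X s)) 2 (P.restrict (M.controlEvent c e t)) :=
    memLp_condMean hM.X hVL
  -- The regression is square-integrable a priori on the control group only. Balance turns its
  -- second moment on the cohort into an odds-weighted one on the controls, and the odds are at most
  -- δ⁻¹.
  have hfE : MemLp (fun s => f (M.X s)) 2 (P.restrict (M.cohortEvent e)) := by
    refine ⟨(hfm.comp hM.X).aestronglyMeasurable, ?_⟩
    suffices eLpNorm (fun s => f (M.X s)) 2 (P.restrict (M.cohortEvent e)) ^ 2 < ∞ by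
      simpa using this
    rw [sq_eLpNorm_two, setLIntegral_cohort_eq hM hδ hp (k := fun x => ‖f x‖ₑ ^ 2)
      (hfm.enorm.pow_const 2)]
    calc _ ≤ ∫⁻ s in M.controlEvent c e t, ENNReal.ofReal δ⁻¹ * ‖f (M.X s)‖ₑ ^ 2 ∂P := by
          refine lintegral_mono_ae ?_
          filter_upwards [ae_odds_bounds hM hδ hp] with s hs
          gcongr
          exact hs.2
      _ = ENNReal.ofReal δ⁻¹ * eLpNorm (fun s => f (M.X s)) 2
            (P.restrict (M.controlEvent c e t)) ^ 2 := by
          rw [sq_eLpNorm_two]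
          exact lintegral_const_mul _ ((hfm.comp hM.X).enorm.pow_const 2)
      _ < ∞ := ENNReal.mul_lt_top ENNReal.ofReal_lt_top (ENNReal.pow_lt_top hfC.2)
  refine ⟨hV, hfm, ?_, ?_, fun h hh hhL => ?_⟩
  · exact (memLp_indicator_mul hM (hM.cohortEvent e) (cohortInd_eq_indicator M e) hres).2
      ((hVL.restrict _).sub hfE)
  · exact (memLp_indicator_mul hM (hM.controlEvent c e t)
      (controlInd_eq_indicator M c e t) hres).2 ((hVL.restrict _).sub hfC)
  · have hhL' := (memLp_indicator_mul hM (hM.controlEvent c e t)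
      (controlInd_eq_indicator M c e t) (hh.comp measurable_covariates)).1 hhL
    have h1 : IntegrableOn (fun s => h (M.X s) * V (M.obs s)) (M.controlEvent c e t) P :=
      hhL'.integrable_mul (hVL.restrict _)
    have h2 : IntegrableOn (fun s => h (M.X s) * f (M.X s)) (M.controlEvent c e t) P :=
      hhL'.integrable_mul hfC
    have h3 := integral_indicator_mul (P := P) hM (hM.controlEvent c e t)
      (controlInd_eq_indicator M c e t)
      ((hh.comp measurable_covariates).mul hres)
    have h4 : (fun o : Obs T 𝒳 => controlInd c e t o.2.2.1 * h o.2.2.2 * (V o - f o.2.2.2)) =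
        fun o => controlInd c e t o.2.2.1 *
          (((h ∘ fun o : Obs T 𝒳 => o.2.2.2) * fun o => V o - f o.2.2.2) o) := by
      ext o; simp only [Pi.mul_apply, Function.comp_apply]; ring
    rw [h4, h3]
    have h5 : (fun s => ((h ∘ fun o : Obs T 𝒳 => o.2.2.2) * fun o => V o - f o.2.2.2) (M.obs s)) =
        fun s => h (M.X s) * V (M.obs s) - h (M.X s) * f (M.X s) := by
      ext s
      change h (M.X s) * (V (M.obs s) - f (M.X s)) = _
      ring
    rw [h5, integral_sub h1 h2, hf,
      setIntegral_mul_condMean hM.X (hVL.integrable one_le_two) hh h1, sub_self]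

/-- The treated term of the score integrates to the difference of the two regressions. -/
lemma integral_cohort_residual (hM : M.IsMeasurable) (hδ : 0 < δ)
    (hp : ∀ᵐ s ∂(P[|M.slice c e t]), M.propensity P c e t (M.X s) < 1 - δ)
    {V : Obs T 𝒳 → ℝ} (hV : Measurable V) (hVL : MemLp (fun s => V (M.obs s)) 2 P) :
    ∫ o, cohortInd e o.2.2.1 * (V o -
        condMean P M.X (M.controlEvent c e t) (fun s => V (M.obs s)) o.2.2.2) ∂(M.law P) =
      ∫ s in M.cohortEvent e, (condMean P M.X (M.cohortEvent e) (fun s => V (M.obs s)) (M.X s) -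
        condMean P M.X (M.controlEvent c e t) (fun s => V (M.obs s)) (M.X s)) ∂P := by
  have hr := regression_law hM hδ hp hV hVL
  have hres : Measurable fun o : Obs T 𝒳 => V o -
      condMean P M.X (M.controlEvent c e t) (fun s => V (M.obs s)) o.2.2.2 :=
    hV.sub ((measurable_condMean _).comp measurable_covariates)
  have h1 := ((memLp_indicator_mul hM (hM.cohortEvent e) (cohortInd_eq_indicator M e) hres).1
    hr.memLp_G).integrable one_le_two
  have hi := hVL.integrable one_le_two
  have h2 : IntegrableOn (fun s => condMean P M.X (M.controlEvent c e t)
      (fun s => V (M.obs s)) (M.X s)) (M.cohortEvent e) P := by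
    refine (hi.integrableOn.sub h1).congr (ae_of_all _ fun s => ?_)
    simp only [Pi.sub_apply]
    change V (M.obs s) - (V (M.obs s) - condMean P M.X (M.controlEvent c e t)
      (fun s => V (M.obs s)) (M.X s)) = _
    ring
  rw [integral_indicator_mul hM (hM.cohortEvent e) (cohortInd_eq_indicator M e) hres,
    integral_sub (integrableOn_condMean hM.X hi) h2]
  have huniv := setIntegral_preimage_condMean (A := M.cohortEvent e) hM.X hi MeasurableSet.univ
  simp only [Set.preimage_univ, Set.inter_univ] at huniv
  rw [huniv]
  exact integral_sub hi.integrableOn h2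

/-! ### The estimand -/

/-- A conditional probability that is almost surely 1 integrates to an unconditional probability 1.
-/
lemma ae_monotone (hM : M.IsMeasurable) (hmono : M.Monotonicity P) (he : e ∈ M.cohorts P)
    (het : e ≤ t) : ∀ᵐ s ∂P, M.Dpot ⊤ t s ≤ M.Dpot e t s := by
  have hmeas : MeasurableSet {s | M.Dpot ⊤ t s ≤ M.Dpot e t s} :=
    ((hM.Dpot ⊤ t).prodMk (hM.Dpot e t)) (Set.toFinite {x : Bool × Bool | x.1 ≤ x.2}).measurableSet
  have h := integral_congr_ae (hmono e he t het)
  rw [integral_condExp hM.X.comap_le, integral_indicator hmeas] at h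
  simp only [integral_const, smul_eq_mul, mul_one, measureReal_restrict_apply_univ,
    probReal_univ] at h
  have h' : P {s | M.Dpot ⊤ t s ≤ M.Dpot e t s} = 1 := by
    rw [← ofReal_measureReal, h, ENNReal.ofReal_one]
  exact (prob_compl_eq_zero_iff hmeas).2 h'

/-- The event of compliance. -/
def Model.compliers (M : Model T S 𝒳) (e t : Period T) : Set S :=
  {s | M.Dpot ⊤ t s < M.Dpot e t s}

lemma measurableSet_compliers (hM : M.IsMeasurable) : MeasurableSet (M.compliers e t) :=
  ((hM.Dpot ⊤ t).prodMk (hM.Dpot e t)) (Set.toFinite {x : Bool × Bool | x.1 < x.2}).measurableSet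

section Assumptions

variable (hM : M.IsMeasurable) (he : e ∈ M.cohorts P) (het : e ≤ t)
  (hstag : M.StaggeredAdoption P) (hmono : M.Monotonicity P) (hanti : M.NoAnticipation P)
  (htrend : M.ParallelTrends P c e t) (hδ : 0 < δ)
  (hp : ∀ᵐ s ∂(P[|M.slice c e t]), M.propensity P c e t (M.X s) < 1 - δ)
include hM he het hstag hmono hanti htrend hδ hp

/-- By monotonicity D_t(e) - D_t(∞) is the indicator of the compliers. -/
lemma integral_treatment_diff :
    ∫ s in M.cohortEvent e, (M.gTrt P e t (M.X s) - M.gCtl P c e t (M.X s)) ∂P =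
      P.real (M.cohortEvent e ∩ M.compliers e t) := by
  have hi : ∀ (D : S → Bool), Measurable D → Integrable (fun s => num (D s)) P :=
    fun D hD => (memLp_num hD).integrable one_le_two
  have h := setIntegral_condMean_diff (W := fun v u s => num (M.Dpot v u s))
    (V := fun u s => num (M.dPath s u)) hM hstag het he.1 (ae_cohort_of_ae_control hM hδ hp)
    (fun v u => hi _ (hM.Dpot v u)) (fun u => hi _ ((measurable_pi_apply u).comp hM.dPath))
    (fun u => ae_of_all _ fun s => rfl) (fun e' he' u hu => (hanti e' he' u hu).1)
    (fun u h1 h2 => (htrend u h1 h2).1)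
  refine h.trans ?_
  have h1 : ∫ s in M.cohortEvent e, (num (M.Dpot e t s) - num (M.Dpot ⊤ t s)) ∂P =
      ∫ s in M.cohortEvent e, (M.compliers e t).indicator (fun _ => (1 : ℝ)) s ∂P := by
    refine integral_congr_ae (ae_restrict_of_ae ?_)
    filter_upwards [ae_monotone hM hmono he het] with s hs
    by_cases hc : s ∈ M.compliers e t
    · obtain ⟨h0, h1⟩ := Bool.lt_iff.1 hc
      simp [hc, h0, h1, num]
    · have : M.Dpot ⊤ t s = M.Dpot e t s := hs.eq_of_not_lt hc
      simp [hc, this]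
  rw [h1, integral_indicator (measurableSet_compliers hM),
    Measure.restrict_restrict (measurableSet_compliers hM), Set.inter_comm]
  simp

/-- Off the compliers both exposure states give the same treatment, hence the same outcome; on them
the difference is Y_t(1) - Y_t(0). -/
lemma integral_outcome_diff (hcarry : M.NoCarryover P)
    (hmom : ∀ (b : Bool) (u : Period T), MemLp (M.Y b u) 2 P) :
    ∫ s in M.cohortEvent e, (M.mTrt P e t (M.X s) - M.mCtl P c e t (M.X s)) ∂P =
      ∫ s in M.cohortEvent e ∩ M.compliers e t, (M.Y true t s - M.Y false t s) ∂P := by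
  have h := setIntegral_condMean_diff (W := M.exposedY)
    (V := fun u s => M.yPath s u) hM hstag het he.1 (ae_cohort_of_ae_control hM hδ hp)
    (fun v u => (memLp_exposedY hM hmom v u).integrable one_le_two)
    (fun u => (memLp_yPath hM hcarry hmom u).integrable one_le_two)
    (fun u => (ae_yPath_eq hcarry).mono fun s hs => hs u)
    (fun e' he' u hu => (hanti e' he' u hu).2)
    (fun u h1 h2 => (htrend u h1 h2).2)
  refine h.trans ?_
  have h1 : ∫ s in M.cohortEvent e, (M.exposedY e t s - M.exposedY ⊤ t s) ∂P =
      ∫ s in M.cohortEvent e,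
        (M.compliers e t).indicator (fun s => M.Y true t s - M.Y false t s) s ∂P := by
    refine integral_congr_ae (ae_restrict_of_ae ?_)
    filter_upwards [ae_monotone hM hmono he het] with s hs
    by_cases hc : s ∈ M.compliers e t
    · obtain ⟨h0, h1⟩ := Bool.lt_iff.1 hc
      simp [hc, h0, h1, Model.exposedY]
    · have : M.Dpot ⊤ t s = M.Dpot e t s := hs.eq_of_not_lt hc
      simp [hc, this, Model.exposedY]
  rw [h1, integral_indicator (measurableSet_compliers hM),
    Measure.restrict_restrict (measurableSet_compliers hM), Set.inter_comm]

lemma tau_eq_div :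
    M.tau P c e t =
      (∫ s in M.cohortEvent e, (M.mTrt P e t (M.X s) - M.mCtl P c e t (M.X s)) ∂P) /
        P.real (M.cohortEvent e ∩ M.compliers e t) := by
  have h0 : P.real (M.cohortEvent e) ≠ 0 := by
    rw [measureReal_def, ENNReal.toReal_ne_zero]
    exact ⟨he.1, measure_ne_top _ _⟩
  rw [← integral_treatment_diff hM he het hstag hmono hanti htrend hδ hp,
    integral_restrict_eq, integral_restrict_eq, mul_div_mul_left _ _ h0]
  rfl

lemma tau_eq_LATT (hcarry : M.NoCarryover P)
    (hmom : ∀ (b : Bool) (u : Period T), MemLp (M.Y b u) 2 P)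
    (hcomp : P (M.cohortEvent e ∩ M.compliers e t) ≠ 0) :
    M.tau P c e t = M.LATT P e t := by
  have h0 : P.real (M.cohortEvent e ∩ M.compliers e t) ≠ 0 := by
    rw [measureReal_def, ENNReal.toReal_ne_zero]
    exact ⟨hcomp, measure_ne_top _ _⟩
  rw [tau_eq_div hM he het hstag hmono hanti htrend hδ hp,
    integral_outcome_diff hM he het hstag hmono hanti htrend hδ hp hcarry hmom,
    integral_restrict_eq, mul_div_cancel_left₀ _ h0]
  rfl

end Assumptions

end Law

end IDiD

namespace IDiD

/-! ### Perturbation of empirical moments -/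

section Perturbation

variable {Ω 𝒪 : Type*}

lemma sq_avg_mul_le (s : Finset ℕ) (w : ℕ → 𝒪) (f g : 𝒪 → ℝ) :
    avg s w (fun o => f o * g o) ^ 2 ≤ avg s w (fun o => f o ^ 2) * avg s w (fun o => g o ^ 2) := by
  rcases s.eq_empty_or_nonempty with rfl | hs
  · simp [avg]
  have hcard : (0 : ℝ) < s.card := by exact_mod_cast hs.card_pos
  simp only [avg]
  rw [div_pow, div_mul_div_comm, ← sq (s.card : ℝ)]
  gcongr
  exact Finset.sum_mul_sq_le_sq_mul_sq _ _ _

lemma sq_avg_le (s : Finset ℕ) (w : ℕ → 𝒪) (f : 𝒪 → ℝ) :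
    avg s w f ^ 2 ≤ avg s w (fun o => f o ^ 2) := by
  rcases s.eq_empty_or_nonempty with rfl | hs
  · simp [avg]
  have hcard : (s.card : ℝ) ≠ 0 := by exact_mod_cast hs.card_pos.ne'
  have h := sq_avg_mul_le s w f fun _ => 1
  have h1 : avg s w (fun _ => (1 : ℝ)) = 1 := by
    simp only [avg, Finset.sum_const, nsmul_eq_mul, mul_one]
    exact div_self hcard
  simp only [mul_one, one_pow] at h
  rwa [h1, mul_one] at h

lemma tendsto_zero_of_sq {β : Type*} {l : Filter β} {f : β → ℝ}
    (h : Tendsto (fun x => f x ^ 2) l (𝓝 0)) : Tendsto f l (𝓝 0) := by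
  have h1 := h.sqrt
  simp only [Real.sqrt_sq_eq_abs, Real.sqrt_zero] at h1
  exact (tendsto_zero_iff_abs_tendsto_zero f).2 h1

variable [MeasurableSpace Ω] {Q : Measure Ω} {O : ℕ → Ω → 𝒪} {s : ℕ → Finset ℕ}
  {f : ℕ × Ω → 𝒪 → ℝ} {f₀ : 𝒪 → ℝ}

lemma tendsto_avg_sub_of_sq
    (h : Tendsto (fun x : ℕ × Ω => avg (s x.1) (O · x.2) fun o => (f x o - f₀ o) ^ 2)
      (inProb Q) (𝓝 0)) :
    Tendsto (fun x : ℕ × Ω => avg (s x.1) (O · x.2) (f x) - avg (s x.1) (O · x.2) f₀)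
      (inProb Q) (𝓝 0) := by
  refine tendsto_zero_of_sq (squeeze_zero (fun x => sq_nonneg _) (fun x => ?_) h)
  rw [← avg_sub]
  exact sq_avg_le _ _ _

/-- f² - f₀² = (f - f₀)² + 2 f₀ (f - f₀), with Cauchy–Schwarz for the cross term. -/
lemma tendsto_avg_sq_sub_of_sq
    (h : Tendsto (fun x : ℕ × Ω => avg (s x.1) (O · x.2) fun o => (f x o - f₀ o) ^ 2)
      (inProb Q) (𝓝 0))
    (h₀ : StochBdd Q fun x => avg (s x.1) (O · x.2) fun o => f₀ o ^ 2) :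
    Tendsto (fun x : ℕ × Ω => avg (s x.1) (O · x.2) (fun o => f x o ^ 2) -
      avg (s x.1) (O · x.2) fun o => f₀ o ^ 2) (inProb Q) (𝓝 0) := by
  have h1 : Tendsto (fun x : ℕ × Ω => avg (s x.1) (O · x.2) fun o => f₀ o * (f x o - f₀ o))
      (inProb Q) (𝓝 0) :=
    tendsto_zero_of_sq (squeeze_zero (fun x => sq_nonneg _) (fun x => sq_avg_mul_le _ _ _ _)
      (h₀.mul_tendsto_zero h))
  have h2 := h.add (h1.const_mul 2)
  simp only [mul_zero, add_zero] at h2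
  refine h2.congr fun x => ?_
  rw [← avg_sub, ← avg_const_mul, ← avg_add]
  congr 1
  ext o
  ring

end Perturbation

/-! ### The score at the estimand -/

section Combination

variable {𝒪 𝒳 Ω : Type*} [MeasurableSpace 𝒪] [MeasurableSpace 𝒳] [MeasurableSpace Ω]
  {ν : Measure 𝒪} [IsProbabilityMeasure ν] {G C : 𝒪 → ℝ} {cov : 𝒪 → 𝒳} {r : 𝒳 → ℝ} {B ρ : ℝ}
  {V V' : 𝒪 → ℝ} {f f' : 𝒳 → ℝ} {Q : Measure Ω} [IsProbabilityMeasure Q] {O : ℕ → Ω → 𝒪}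
  {s : ℕ → Finset ℕ} {𝒲 : ℕ → Type*} [∀ N, MeasurableSpace (𝒲 N)] {W : ∀ N, Ω → 𝒲 N}
  {q u u' : ∀ N, 𝒲 N → 𝒳 → ℝ} {ρ₁ ρ₂ : ℕ × Ω → ℝ} {τ : ℝ}

omit [MeasurableSpace 𝒪] [MeasurableSpace 𝒳] in
lemma score_eq (ρ : ℝ) (o : 𝒪) : score G C cov V ρ ρ r f o =
    ρ⁻¹ * (G o * (V o - f (cov o))) - ρ⁻¹ * (C o * r (cov o) * (V o - f (cov o))) := by
  simp only [score]; ring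

omit [IsProbabilityMeasure ν] in
lemma Regression.memLp_score (hb : Balanced ν G C cov r B ρ) (hr : Regression ν G C cov V f) :
    MemLp (score G C cov V ρ ρ r f) 2 ν := by
  have h := (hr.memLp_G.const_mul ρ⁻¹).sub ((Regression.memLp_weight hb hr).const_mul ρ⁻¹)
  exact h.ae_eq (ae_of_all _ fun o => (score_eq ρ o).symm)

omit [IsProbabilityMeasure ν] in
lemma Regression.measurable_score (hb : Balanced ν G C cov r B ρ) (hr : Regression ν G C cov V f) :
    Measurable (score G C cov V ρ ρ r f) := by
  have hm := Regression.measurable_residual hb hr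
  have : score G C cov V ρ ρ r f = fun o =>
      ρ⁻¹ * (G o * (V o - f (cov o))) - ρ⁻¹ * (C o * r (cov o) * (V o - f (cov o))) :=
    funext fun o => score_eq ρ o
  rw [this]
  exact ((hb.measurable_G.mul hm).const_mul _).sub ((hb.measurable_weight.mul hm).const_mul _)

lemma Regression.integral_score (hb : Balanced ν G C cov r B ρ) (hr : Regression ν G C cov V f) :
    ∫ o, score G C cov V ρ ρ r f o ∂ν = ρ⁻¹ * ∫ o, G o * (V o - f (cov o)) ∂ν := by
  have h1 := hr.memLp_G.integrable one_le_two
  have h2 := (Regression.memLp_weight hb hr).integrable one_le_two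
  simp only [score_eq]
  rw [integral_sub (h1.const_mul _) (h2.const_mul _), integral_const_mul, integral_const_mul,
    Regression.integral_weight hb hr]
  ring

/-- The estimated score at the estimand is first-order equivalent to the true score. -/
lemma tendsto_sqrt_avg_score_sub (hw : FittedWeights Q ν O s 𝒲 W G C cov r B ρ q ρ₁ ρ₂)
    (hr : FittedRegression Q ν 𝒲 W G C cov r ρ q ρ₁ ρ₂ V f u)
    (hr' : FittedRegression Q ν 𝒲 W G C cov r ρ q ρ₁ ρ₂ V' f' u')
    (hτ : ∫ o, G o * (V o - f (cov o)) ∂ν = τ * ∫ o, G o * (V' o - f' (cov o)) ∂ν) :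
    Tendsto (fun x : ℕ × Ω => √(x.1 : ℝ) *
      ((avg (s x.1) (O · x.2) (score G C cov V (ρ₁ x) (ρ₂ x) (q x.1 (W x.1 x.2))
          (u x.1 (W x.1 x.2))) -
        τ * avg (s x.1) (O · x.2) (score G C cov V' (ρ₁ x) (ρ₂ x) (q x.1 (W x.1 x.2))
          (u' x.1 (W x.1 x.2)))) -
      (avg (s x.1) (O · x.2) (score G C cov V ρ ρ r f) -
        τ * avg (s x.1) (O · x.2) (score G C cov V' ρ ρ r f')))) (inProb Q) (𝓝 0) := by
  have hb := hw.balanced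
  have m1 := Regression.measurable_residual hb hr.regression
  have m2 := Regression.measurable_residual hb hr'.regression
  have i1 := hr.regression.memLp_G.integrable one_le_two
  have i2 := hr'.regression.memLp_G.integrable one_le_two
  have j1 := (Regression.memLp_weight hb hr.regression).integrable one_le_two
  have j2 := (Regression.memLp_weight hb hr'.regression).integrable one_le_two
  have hcard : ∀ N, N ≤ (s N).card := fun N => (hw.split.card N).ge
  -- The treated residual of the outcome alone need not be centred; the combination with τ is, by
  -- `hτ`. Its √N-scaled mean is therefore bounded, and multiplying it by 1/ρ₁ - 1/ρ → 0 gives a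
  -- negligible term. For the control terms in `bC` orthogonality already gives mean zero.
  have bG := stochBdd_sqrt_avg_sub_integral (ν := ν)
    (f := fun o => G o * (V o - f (cov o)) - τ * (G o * (V' o - f' (cov o))))
    hw.measurable_obs hw.indep hw.law
    ((hb.measurable_G.mul m1).sub ((hb.measurable_G.mul m2).const_mul τ))
    (hr.regression.memLp_G.sub (hr'.regression.memLp_G.const_mul τ)) hcard
  have bC := stochBdd_sqrt_avg_sub_integral (ν := ν)
    (f := fun o => C o * r (cov o) * (V o - f (cov o)) -
      τ * (C o * r (cov o) * (V' o - f' (cov o))))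
    hw.measurable_obs hw.indep hw.law
    ((hb.measurable_weight.mul m1).sub ((hb.measurable_weight.mul m2).const_mul τ))
    ((Regression.memLp_weight hb hr.regression).sub
      ((Regression.memLp_weight hb hr'.regression).const_mul τ)) hcard
  rw [integral_sub i1 (i2.const_mul τ), integral_const_mul, hτ, sub_self] at bG
  rw [integral_sub j1 (j2.const_mul τ), integral_const_mul,
    Regression.integral_weight hb hr.regression, Regression.integral_weight hb hr'.regression] at bC
  have z1 : Tendsto (fun x => (ρ₁ x)⁻¹ - ρ⁻¹) (inProb Q) (𝓝 0) := by
    simpa using hw.tendsto_inv_treated.sub_const ρ⁻¹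
  have z2 : Tendsto (fun x => (ρ₂ x)⁻¹ - ρ⁻¹) (inProb Q) (𝓝 0) := by
    simpa using hw.tendsto_inv_control.sub_const ρ⁻¹
  have main := ((hr.tendsto_sqrt_avg_score hw).sub
    ((hr'.tendsto_sqrt_avg_score hw).const_mul τ)).add
      ((bG.mul_tendsto_zero z1).sub (bC.mul_tendsto_zero z2))
  simp only [mul_zero, sub_zero, add_zero] at main
  refine main.congr fun x => ?_
  have hs : ∀ (V : 𝒪 → ℝ) (f : 𝒳 → ℝ), avg (s x.1) (O · x.2) (score G C cov V ρ ρ r f) =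
      ρ⁻¹ * avg (s x.1) (O · x.2) (fun o => G o * (V o - f (cov o))) -
      ρ⁻¹ * avg (s x.1) (O · x.2) (fun o => C o * r (cov o) * (V o - f (cov o))) := fun V f => by
    rw [← avg_const_mul, ← avg_const_mul, ← avg_sub]
    exact congrArg _ (funext fun o => score_eq ρ o)
  rw [hs V f, hs V' f']
  simp only [avg_sub, avg_const_mul]
  ring

end Combination

/-! ### Law of large numbers along the sample sizes `K N` -/

section LLN

variable {Ω 𝒪 : Type*} [MeasurableSpace Ω] [MeasurableSpace 𝒪] {Q : Measure Ω}
  [IsProbabilityMeasure Q] {ν : Measure 𝒪} {O : ℕ → Ω → 𝒪}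

omit [IsProbabilityMeasure Q] in
lemma identDistrib_obs (hO : ∀ i, Measurable (O i)) (hlaw : ∀ i, Q.map (O i) = ν) {f : 𝒪 → ℝ}
    (hf : Measurable f) (i : ℕ) :
    IdentDistrib (fun ω => f (O i ω)) (fun ω => f (O 0 ω)) Q Q :=
  IdentDistrib.comp ⟨(hO i).aemeasurable, (hO 0).aemeasurable, by rw [hlaw i, hlaw 0]⟩ hf

lemma tendsto_avg_range (hO : ∀ i, Measurable (O i)) (hindep : iIndepFun O Q)
    (hlaw : ∀ i, Q.map (O i) = ν) {f : 𝒪 → ℝ} (hfm : Measurable f) (hf : Integrable f ν) {K : ℕ}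
    (hK : 0 < K) :
    Tendsto (fun x : ℕ × Ω => avg (Finset.range (K * x.1)) (O · x.2) f) (inProb Q)
      (𝓝 (∫ o, f o ∂ν)) := by
  have hint : Integrable (fun ω => f (O 0 ω)) Q := by
    have : Integrable f (Q.map (O 0)) := by rwa [hlaw 0]
    exact this.comp_measurable (hO 0)
  have h := strong_law_ae_real (fun i ω => f (O i ω)) hint
    (fun i j hij => (hindep.indepFun hij).comp hfm hfm) (identDistrib_obs hO hlaw hfm)
  rw [integral_obs hO hlaw hfm 0] at h
  have hm : TendstoInMeasure Q (fun (n : ℕ) ω => (∑ i ∈ Finset.range n, f (O i ω)) / (n : ℝ)) atTop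
      (fun _ => ∫ o, f o ∂ν) := tendstoInMeasure_of_tendsto_ae (fun n => (Measurable.div_const
    (Finset.measurable_fun_sum (Finset.range n) fun i _ => hfm.comp (hO i))
      (n : ℝ)).aestronglyMeasurable) h
  have hK' : Tendsto (fun N : ℕ => K * N) atTop atTop :=
    tendsto_atTop_mono (fun N => Nat.le_mul_of_pos_left N hK) tendsto_id
  have hm' := tendstoInMeasure_iff_inProb.1
    (show TendstoInMeasure Q (fun (N : ℕ) ω => (∑ i ∈ Finset.range (K * N), f (O i ω)) /
      ((K * N : ℕ) : ℝ)) atTop (fun _ => ∫ o, f o ∂ν) from fun ε hε => (hm ε hε).comp hK')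
  refine hm'.congr fun x => ?_
  rw [avg, Finset.card_range]

end LLN

end IDiD

namespace IDiD

lemma StochBdd.congr' {Ω : Type*} [MeasurableSpace Ω] {Q : Measure Ω} {f g : ℕ × Ω → ℝ}
    (hg : StochBdd Q g) (h : ∀ᶠ x in inProb Q, f x = g x) : StochBdd Q f := by
  have h0 : Tendsto (fun x => f x - g x) (inProb Q) (𝓝 0) :=
    tendsto_const_nhds.congr' (h.mono fun x hx => (sub_eq_zero.2 hx).symm)
  exact (hg.add (stochBdd_of_tendsto h0)).mono fun x => by simp

/-! ### Folds as finite sets of indices -/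

namespace CrossFit

variable {T K : ℕ} {𝒳 : Type*} [MeasurableSpace 𝒳] (F : CrossFit T K 𝒳) (N : ℕ) (k : Fin K)

/-- The indices in fold `k`. -/
def evalSet : Finset ℕ := (Finset.univ.filter fun i => F.fold N i = k).map Fin.valEmbedding

/-- The indices outside fold `k`. -/
def trainSet : Finset ℕ := (Finset.univ.filter fun i => F.fold N i ≠ k).map Fin.valEmbedding

lemma card_evalSet : (F.evalSet N k).card = N := by
  rw [evalSet, Finset.card_map, F.card_fold]

lemma card_trainSet : N + (F.trainSet N k).card = K * N := by
  rw [trainSet, Finset.card_map]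
  have h := Finset.card_filter_add_card_filter_not (s := Finset.univ) fun i => F.fold N i = k
  rwa [F.card_fold, Finset.card_univ, Fintype.card_fin] at h

/-- The training sample has (K - 1) N observations; K ≥ 2 makes its averages accurate to order
N^{-1/2}. -/
lemma le_card_trainSet (hK : 2 ≤ K) : N ≤ (F.trainSet N k).card := by
  have h := F.card_trainSet N k
  nlinarith

lemma disjoint_trainSet_evalSet : Disjoint (F.trainSet N k) (F.evalSet N k) := by
  rw [trainSet, evalSet, Finset.disjoint_map]
  exact (Finset.disjoint_filter_filter_not _ _ _).symm

lemma mem_trainSet (i : {i : Fin (K * N) // F.fold N i ≠ k}) : (i.1 : ℕ) ∈ F.trainSet N k :=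
  Finset.mem_map.2 ⟨i.1, Finset.mem_filter.2 ⟨Finset.mem_univ _, i.2⟩, rfl⟩

variable {N k} (w : ℕ → Obs T 𝒳) (f : Obs T 𝒳 → ℝ)

lemma foldMean_eq_avg : F.foldMean N k w f = avg (F.evalSet N k) w f := by
  rw [avg, card_evalSet, evalSet, Finset.sum_map]
  rfl

lemma trainMean_eq_avg : F.trainMean N k w f = avg (F.trainSet N k) w f := by
  rw [avg, trainSet, Finset.sum_map, Finset.card_map]
  rfl

/-- Equal fold sizes make the mean of fold means the full-sample mean, to which the limit theorems
apply. -/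
lemma inv_mul_sum_avg : (K : ℝ)⁻¹ * ∑ k, avg (F.evalSet N k) w f =
    avg (Finset.range (K * N)) w f := by
  simp only [← foldMean_eq_avg, foldMean]
  rw [← Finset.sum_div, Finset.sum_fiberwise, avg, Finset.card_range, Nat.cast_mul,
    Fin.sum_univ_eq_sum_range (fun i => f (w i)), inv_mul_eq_div, div_div, mul_comm (N : ℝ)]

lemma crossMean_eq (c : ControlGroup) (e t : Period T) (g : Nuisance 𝒳 → Obs T 𝒳 → ℝ) :
    F.crossMean c e t N w g =
      (K : ℝ)⁻¹ * ∑ k, avg (F.evalSet N k) w (g (F.etaHat c e t N k w)) := by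
  simp only [crossMean, foldMean_eq_avg]

lemma measurable_train {Ω : Type*} [MeasurableSpace Ω] {O : ℕ → Ω → Obs T 𝒳}
    (hO : ∀ i, Measurable (O i)) : Measurable fun ω => F.train N k (O · ω) :=
  measurable_pi_lambda _ fun i => hO i.1

lemma split_fold {Ω : Type*} [MeasurableSpace Ω] {Q : Measure Ω} {O : ℕ → Ω → Obs T 𝒳}
    (hO : ∀ i, Measurable (O i)) (hindep : iIndepFun O Q) (k : Fin K) :
    Split Q O (fun N => F.evalSet N k) (fun N => {i : Fin (K * N) // F.fold N i ≠ k} → Obs T 𝒳)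
      (fun N ω => F.train N k (O · ω)) where
  card N := F.card_evalSet N k
  measurable N := F.measurable_train hO
  indep N := by
    have h := hindep.indepFun_finset _ _ (F.disjoint_trainSet_evalSet N k) hO
    have hφ : Measurable fun (v : F.trainSet N k → Obs T 𝒳)
        (i : {i : Fin (K * N) // F.fold N i ≠ k}) => v ⟨i.1, F.mem_trainSet N k i⟩ :=
      measurable_pi_lambda _ fun i => measurable_pi_apply _
    exact h.comp hφ measurable_id

end CrossFit

/-! ### The cross-fitted score in every fold -/

section Fold

variable {T K : ℕ} {S 𝒳 Ω : Type*} [MeasurableSpace S] [MeasurableSpace 𝒳] [MeasurableSpace Ω]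
  {P : Measure S} [IsProbabilityMeasure P] {Q : Measure Ω} [IsProbabilityMeasure Q]
  {M : Model T S 𝒳} {c : ControlGroup} {e t : Period T} {δ : ℝ} {O : ℕ → Ω → Obs T 𝒳}
  {F : CrossFit T K 𝒳}

omit [IsProbabilityMeasure P] in
-- Conditioning divides by a probability at most one. Rates stated in the norm on the comparison
-- slice therefore bound the corresponding norms on each group.
lemma restrict_le_cond [IsZeroOrProbabilityMeasure P] {A B : Set S} (h : A ⊆ B) :
    P.restrict A ≤ P[|B] := by
  refine (Measure.restrict_mono h le_rfl).trans ?_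
  refine Measure.le_iff.2 fun s _ => ?_
  rw [ProbabilityTheory.cond, Measure.smul_apply, smul_eq_mul]
  exact le_mul_of_one_le_left' (ENNReal.one_le_inv.2 prob_le_one)

lemma eLpNorm_indicator_mul_le (hM : M.IsMeasurable) {g : Path T → ℝ} {A B : Set S}
    (hA : MeasurableSet A) (hg : (fun s => g (M.zPath s)) = A.indicator fun _ => (1 : ℝ))
    (hAB : A ⊆ B) {h : 𝒳 → ℝ} (hh : Measurable h) :
    eLpNorm (fun o : Obs T 𝒳 => g o.2.2.1 * h o.2.2.2) 2 (M.law P) ≤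
      eLpNorm (fun s => h (M.X s)) 2 (P[|B]) := by
  have hm : Measurable fun o : Obs T 𝒳 => g o.2.2.1 * h o.2.2.2 :=
    (measurable_pathFun g).mul (hh.comp measurable_covariates)
  have heq : (fun o : Obs T 𝒳 => g o.2.2.1 * h o.2.2.2) ∘ M.obs =
      A.indicator fun s => h (M.X s) := funext fun s => by
    change g (M.zPath s) * h (M.X s) = _
    rw [congrFun hg s]
    by_cases hs : s ∈ A <;> simp [hs]
  rw [Model.law, eLpNorm_map_measure hm.aestronglyMeasurable hM.obs.aemeasurable, heq,
    eLpNorm_indicator_eq_eLpNorm_restrict hA]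
  exact eLpNorm_mono_measure _ (restrict_le_cond hAB)

variable (hM : M.IsMeasurable) (hδ : 0 < δ) (hpos : δ < P.real (M.cohortEvent e))
  (hp : ∀ᵐ s ∂(P[|M.slice c e t]), M.propensity P c e t (M.X s) < 1 - δ)

lemma measurable_deltaY_obs : Measurable fun o : Obs T 𝒳 => o.1 t - o.1 e.prev :=
  ((measurable_pi_apply t).comp measurable_fst).sub
    ((measurable_pi_apply e.prev).comp measurable_fst)

lemma measurable_deltaD_obs :
    Measurable fun o : Obs T 𝒳 => num (o.2.1 t) - num (o.2.1 e.prev) :=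
  (measurable_of_finite fun d : Path T => num (d t) - num (d e.prev)).comp
    (measurable_fst.comp measurable_snd)

include hM hδ hpos hp

lemma rhoTrt_eta : (M.eta P c e t).rhoTrt = P.real (M.cohortEvent e) :=
  (balanced_law hM hδ hpos hp).integral_G

lemma rhoCtl_eta : (M.eta P c e t).rhoCtl = P.real (M.cohortEvent e) :=
  have := isProbabilityMeasure_law (P := P) hM
  (balanced_law hM hδ hpos hp).integral_weight

lemma psiB_eta : psiB c e t (M.eta P c e t) = score (fun o => cohortInd e o.2.2.1)
    (fun o => controlInd c e t o.2.2.1) (fun o => o.2.2.2) (fun o => o.1 t - o.1 e.prev)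
    (P.real (M.cohortEvent e)) (P.real (M.cohortEvent e))
    (fun x => odds (M.propensity P c e t x)) (M.mCtl P c e t) := by
  ext o
  simp only [psiB, weightDiff, rhoTrt_eta hM hδ hpos hp, rhoCtl_eta hM hδ hpos hp]
  rfl

lemma psiA_eta : psiA c e t (M.eta P c e t) = score (fun o => cohortInd e o.2.2.1)
    (fun o => controlInd c e t o.2.2.1) (fun o => o.2.2.2)
    (fun o => num (o.2.1 t) - num (o.2.1 e.prev))
    (P.real (M.cohortEvent e)) (P.real (M.cohortEvent e))
    (fun x => odds (M.propensity P c e t x)) (M.gCtl P c e t) := by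
  ext o
  simp only [psiA, weightDiff, rhoTrt_eta hM hδ hpos hp, rhoCtl_eta hM hδ hpos hp]
  rfl

variable (hO : ∀ i, Measurable (O i)) (hlaw : ∀ i, Q.map (O i) = M.law P)
  (hcons : L2Consistency M P c e t F Q O)

omit hδ hpos hp [IsProbabilityMeasure Q] in
lemma eLpNorm_control_odds_le (N : ℕ) (k : Fin K)
    (w : {i : Fin (K * N) // F.fold N i ≠ k} → Obs T 𝒳) :
    eLpNorm (fun o : Obs T 𝒳 => controlInd c e t o.2.2.1 *
      (odds ((F.learner N k).p w o.2.2.2) - odds (M.propensity P c e t o.2.2.2))) 2 (M.law P) ≤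
      M.covNorm P c e t fun x => odds (M.propensity P c e t x) - odds ((F.learner N k).p w x) := by
  have hm : Measurable fun x => odds ((F.learner N k).p w x) - odds (M.propensity P c e t x) :=
    (measurable_odds.comp ((F.learner N k).measurable_p.comp measurable_prodMk_left)).sub
      (measurable_odds.comp measurable_propensity)
  refine (eLpNorm_indicator_mul_le hM (hM.controlEvent c e t) (controlInd_eq_indicator M c e t)
    (show M.controlEvent c e t ⊆ M.slice c e t from Set.subset_union_right) hm).trans_eq ?_
  exact eLpNorm_sub_comm _ _ 2 _

include hO hlaw hcons in
-- The fluctuation of the control denominator is a hypothesis when it is computed on the training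
-- folds. On the evaluation fold it is proved: C r is a fixed L² function, and C (q - r) has a
-- negligible empirical process given the training data.
lemma fittedWeights_fold (hK : 2 ≤ K) (hindep : iIndepFun O Q)
    (hnorm : F.normalization = .trainingFolds → WeightFluctuation M P c e t F Q O) (k : Fin K) :
    FittedWeights Q (M.law P) O (fun N => F.evalSet N k)
      (fun N => {i : Fin (K * N) // F.fold N i ≠ k} → Obs T 𝒳)
      (fun N ω => F.train N k (O · ω)) (fun o => cohortInd e o.2.2.1)
      (fun o => controlInd c e t o.2.2.1) (fun o => o.2.2.2)
      (fun x => odds (M.propensity P c e t x)) δ⁻¹ (P.real (M.cohortEvent e))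
      (fun N w x => odds ((F.learner N k).p w x))
      (fun x => (F.etaHat c e t x.1 k (O · x.2)).rhoTrt)
      (fun x => (F.etaHat c e t x.1 k (O · x.2)).rhoCtl) := by
  have := isProbabilityMeasure_law (P := P) hM
  have hb := balanced_law hM hδ hpos hp
  have hq : ∀ N, Measurable (Function.uncurry fun
      (w : {i : Fin (K * N) // F.fold N i ≠ k} → Obs T 𝒳) x => odds ((F.learner N k).p w x)) :=
    fun N => measurable_odds.comp (F.learner N k).measurable_p
  have hsp := F.split_fold hO hindep k
  have hcardT := fun N => F.le_card_trainSet N k hK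
  have hcardE := fun N => (F.card_evalSet N k).ge
  have htq : Tendsto (fun x : ℕ × Ω => eLpNorm (fun o : Obs T 𝒳 => controlInd c e t o.2.2.1 *
      (odds ((F.learner x.1 k).p (F.train x.1 k (O · x.2)) o.2.2.2) -
        odds (M.propensity P c e t o.2.2.2))) 2 (M.law P)) (inProb Q) (𝓝 0) :=
    tendsto_of_tendsto_of_tendsto_of_le_of_le tendsto_const_nhds
      (littleOP_iff_tendsto.1 (hcons k).1) (fun _ => zero_le)
      fun x => eLpNorm_control_odds_le hM x.1 k _
  refine ⟨hsp, hO, hindep, hlaw, hb, hq, htq, ?_, ?_⟩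
  · have hG := hb.integral_G
    rcases hn : F.normalization with _ | _
    · have h := stochBdd_sqrt_avg_sub_integral hO hindep hlaw hb.measurable_G hb.memLp_G hcardT
      simpa only [hG, CrossFit.etaHat, CrossFit.normMean, hn, CrossFit.trainMean_eq_avg] using h
    · have h := stochBdd_sqrt_avg_sub_integral hO hindep hlaw hb.measurable_G hb.memLp_G hcardE
      simpa only [hG, CrossFit.etaHat, CrossFit.normMean, hn, CrossFit.foldMean_eq_avg] using h
  · rcases hn : F.normalization with _ | _
    · refine StochBdd.mono (stochBdd_of_bigOP (f := fun x : ℕ × Ω => √((K * x.1 : ℕ) : ℝ) *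
        |(F.etaHat c e t x.1 k (O · x.2)).rhoCtl -
          ∫ o, rawCtl c e t (F.etaHat c e t x.1 k (O · x.2)).p o ∂(M.law P)|) ?_) fun x => ?_
      · simpa only [abs_mul, abs_abs, abs_of_nonneg (Real.sqrt_nonneg _)] using hnorm hn k
      · rw [abs_mul, abs_mul, abs_abs, abs_of_nonneg (Real.sqrt_nonneg _),
          abs_of_nonneg (Real.sqrt_nonneg _)]
        refine mul_le_mul_of_nonneg_right (Real.sqrt_le_sqrt ?_) (abs_nonneg _)
        exact_mod_cast Nat.le_mul_of_pos_left _ (by omega)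
    · have hφ : ∀ N, Measurable (Function.uncurry fun
          (w : {i : Fin (K * N) // F.fold N i ≠ k} → Obs T 𝒳) (o : Obs T 𝒳) =>
          controlInd c e t o.2.2.1 *
            (odds ((F.learner N k).p w o.2.2.2) - odds (M.propensity P c e t o.2.2.2))) :=
        fun N => (hb.measurable_C.comp measurable_snd).mul
          (((hq N).comp (measurable_fst.prodMk (measurable_covariates.comp measurable_snd))).sub
            (hb.measurable_r.comp (measurable_covariates.comp measurable_snd)))
      have h1 := hsp.tendsto_sqrt_avg_sub_integral hO hindep hlaw hφ htq
      have h2 := stochBdd_sqrt_avg_sub_integral hO hindep hlaw hb.measurable_weight hb.memLp_weight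
        hcardE
      -- C q = C r + C (q - r); splitting the integral needs C (q - r) integrable, which holds with
      -- probability tending to one.
      refine (h2.add (stochBdd_of_tendsto h1)).congr' ?_
      filter_upwards [htq.eventually_lt_const ENNReal.zero_lt_top] with x hx
      have hL : MemLp (fun o : Obs T 𝒳 => controlInd c e t o.2.2.1 *
          (odds ((F.learner x.1 k).p (F.train x.1 k (O · x.2)) o.2.2.2) -
            odds (M.propensity P c e t o.2.2.2))) 2 (M.law P) :=
        ⟨((hφ x.1).comp measurable_prodMk_left).aestronglyMeasurable, hx⟩
      rw [← mul_add, sub_add_sub_comm, ← avg_add,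
        ← integral_add (hb.memLp_weight.integrable one_le_two) (hL.integrable one_le_two)]
      have heq : ∀ o : Obs T 𝒳, controlInd c e t o.2.2.1 * odds (M.propensity P c e t o.2.2.2) +
          controlInd c e t o.2.2.1 *
          (odds ((F.learner x.1 k).p (F.train x.1 k (O · x.2)) o.2.2.2) -
            odds (M.propensity P c e t o.2.2.2)) =
          controlInd c e t o.2.2.1 * odds ((F.learner x.1 k).p (F.train x.1 k (O · x.2)) o.2.2.2) :=
        fun o => by ring
      simp only [heq]
      simp only [CrossFit.etaHat, CrossFit.normMean, hn, CrossFit.foldMean_eq_avg]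
      rfl

omit hδ hpos hp [IsProbabilityMeasure Q] in
lemma tendsto_rate {g : Path T → ℝ} {A : Set S} (hA : MeasurableSet A)
    (hg : (fun s => g (M.zPath s)) = A.indicator fun _ => (1 : ℝ)) (hAs : A ⊆ M.slice c e t)
    (hK : 2 ≤ K) (k : Fin K) {f : 𝒳 → ℝ} (hf : Measurable f)
    {u : ∀ N, ({i : Fin (K * N) // F.fold N i ≠ k} → Obs T 𝒳) → 𝒳 → ℝ}
    (hu : ∀ N, Measurable (Function.uncurry (u N)))
    (h : LittleOP Q fun N ω => ENNReal.ofReal √((K * N : ℕ) : ℝ) *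
      (M.oddsError P c e t (F.etaHat c e t N k (O · ω)) *
        M.covNorm P c e t fun x => f x - u N (F.train N k (O · ω)) x)) :
    Tendsto (fun x : ℕ × Ω => ENNReal.ofReal √(x.1 : ℝ) *
      (eLpNorm (fun o : Obs T 𝒳 => controlInd c e t o.2.2.1 *
        (odds ((F.learner x.1 k).p (F.train x.1 k (O · x.2)) o.2.2.2) -
          odds (M.propensity P c e t o.2.2.2))) 2 (M.law P) *
      eLpNorm (fun o : Obs T 𝒳 => g o.2.2.1 *
        (f o.2.2.2 - u x.1 (F.train x.1 k (O · x.2)) o.2.2.2)) 2 (M.law P))) (inProb Q) (𝓝 0) := by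
  refine tendsto_of_tendsto_of_tendsto_of_le_of_le tendsto_const_nhds
    (littleOP_iff_tendsto.1 h) (fun _ => zero_le) fun x => ?_
  have hd : Measurable fun y => f y - u x.1 (F.train x.1 k (O · x.2)) y :=
    hf.sub ((hu x.1).comp measurable_prodMk_left)
  have h1 : ENNReal.ofReal √(x.1 : ℝ) ≤ ENNReal.ofReal √((K * x.1 : ℕ) : ℝ) :=
    ENNReal.ofReal_le_ofReal (Real.sqrt_le_sqrt
      (Nat.cast_le.2 (Nat.le_mul_of_pos_left _ (by omega))))
  have h2 := eLpNorm_indicator_mul_le (P := P) (g := g) hM hA hg hAs hd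
  exact mul_le_mul' h1 (mul_le_mul' (eLpNorm_control_odds_le hM x.1 k _) h2)

variable (hrate : SecondOrderRate M P c e t F Q O)

omit [IsProbabilityMeasure Q] in
include hcons hrate in
lemma fittedRegression_outcome (hK : 2 ≤ K)
    (hY : MemLp (M.deltaY e t) 2 P) (k : Fin K) :
    FittedRegression Q (M.law P)
      (fun N => {i : Fin (K * N) // F.fold N i ≠ k} → Obs T 𝒳)
      (fun N ω => F.train N k (O · ω)) (fun o => cohortInd e o.2.2.1)
      (fun o => controlInd c e t o.2.2.1) (fun o => o.2.2.2)
      (fun x => odds (M.propensity P c e t x)) (P.real (M.cohortEvent e))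
      (fun N w x => odds ((F.learner N k).p w x))
      (fun x => (F.etaHat c e t x.1 k (O · x.2)).rhoTrt)
      (fun x => (F.etaHat c e t x.1 k (O · x.2)).rhoCtl)
      (fun o => o.1 t - o.1 e.prev) (M.mCtl P c e t) (fun N w x => (F.learner N k).m w x) := by
  refine ⟨regression_law hM hδ hp measurable_deltaY_obs hY, fun N => (F.learner N k).measurable_m,
    ?_, ?_, ?_⟩
  · have h := littleOP_iff_tendsto.1 (hcons k).2.2
    rw [psiB_eta hM hδ hpos hp] at h
    exact h
  · exact tendsto_rate (g := cohortInd e) (f := M.mCtl P c e t) (u := fun N => (F.learner N k).m) hM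
      (hM.cohortEvent e) (cohortInd_eq_indicator M e) Set.subset_union_left hK k
      (measurable_condMean _) (fun N => (F.learner N k).measurable_m) (hrate k).1
  · exact tendsto_rate (g := controlInd c e t) (f := M.mCtl P c e t)
      (u := fun N => (F.learner N k).m) hM (hM.controlEvent c e t) (controlInd_eq_indicator M c e t) Set.subset_union_right hK k
      (measurable_condMean _) (fun N => (F.learner N k).measurable_m) (hrate k).1

omit [IsProbabilityMeasure Q] in
include hcons hrate in
lemma fittedRegression_treatment (hK : 2 ≤ K) (k : Fin K) :
    FittedRegression Q (M.law P)
      (fun N => {i : Fin (K * N) // F.fold N i ≠ k} → Obs T 𝒳)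
      (fun N ω => F.train N k (O · ω)) (fun o => cohortInd e o.2.2.1)
      (fun o => controlInd c e t o.2.2.1) (fun o => o.2.2.2)
      (fun x => odds (M.propensity P c e t x)) (P.real (M.cohortEvent e))
      (fun N w x => odds ((F.learner N k).p w x))
      (fun x => (F.etaHat c e t x.1 k (O · x.2)).rhoTrt)
      (fun x => (F.etaHat c e t x.1 k (O · x.2)).rhoCtl)
      (fun o => num (o.2.1 t) - num (o.2.1 e.prev)) (M.gCtl P c e t)
      (fun N w x => (F.learner N k).g w x) := by
  have hD : MemLp (fun s => num (M.dPath s t) - num (M.dPath s e.prev)) 2 P :=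
    (memLp_num ((measurable_pi_apply t).comp hM.dPath)).sub
      (memLp_num ((measurable_pi_apply e.prev).comp hM.dPath))
  refine ⟨regression_law hM hδ hp measurable_deltaD_obs hD, fun N => (F.learner N k).measurable_g,
    ?_, ?_, ?_⟩
  · have h := littleOP_iff_tendsto.1 (hcons k).2.1
    rw [psiA_eta hM hδ hpos hp] at h
    exact h
  · exact tendsto_rate (g := cohortInd e) (f := M.gCtl P c e t) (u := fun N => (F.learner N k).g) hM
      (hM.cohortEvent e) (cohortInd_eq_indicator M e) Set.subset_union_left hK k
      (measurable_condMean _) (fun N => (F.learner N k).measurable_g) (hrate k).2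
  · exact tendsto_rate (g := controlInd c e t) (f := M.gCtl P c e t)
      (u := fun N => (F.learner N k).g) hM (hM.controlEvent c e t) (controlInd_eq_indicator M c e t) Set.subset_union_right hK k
      (measurable_condMean _) (fun N => (F.learner N k).measurable_g) (hrate k).2

end Fold

end IDiD

namespace IDiD

/-! ### Ratios of cross-fitted averages -/

section Ratio

variable {Ω 𝒪 : Type*} {K : ℕ}

/-- The average over folds of fold averages of fold-specific functions. -/
noncomputable def crossAvg (s : Fin K → Finset ℕ) (w : ℕ → 𝒪) (f : Fin K → 𝒪 → ℝ) : ℝ :=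
  (K : ℝ)⁻¹ * ∑ k, avg (s k) w (f k)

variable [MeasurableSpace Ω] [MeasurableSpace 𝒪]

/-- Cross-fitted estimates `b`, `a` of functions `b₀`, `a₀` such that the estimated moment
`b - τ a` is first-order equivalent to `b₀ - τ a₀`, where `τ = ∫ b₀ / ∫ a₀`. -/
structure OrthogonalMoments (Q : Measure Ω) (ν : Measure 𝒪) (O : ℕ → Ω → 𝒪)
    (s : ℕ → Fin K → Finset ℕ) (b a : Fin K → ℕ × Ω → 𝒪 → ℝ) (b₀ a₀ : 𝒪 → ℝ) (τ : ℝ) : Prop where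
  pos : 0 < K
  measurable_obs : ∀ i, Measurable (O i)
  indep : iIndepFun O Q
  law : ∀ i, Q.map (O i) = ν
  crossAvg_const : ∀ (N : ℕ) (w : ℕ → 𝒪) (f : 𝒪 → ℝ),
    crossAvg (s N) w (fun _ => f) = avg (Finset.range (K * N)) w f
  measurable_b : Measurable b₀
  measurable_a : Measurable a₀
  memLp_b : MemLp b₀ 2 ν
  memLp_a : MemLp a₀ 2 ν
  tendsto_b : ∀ k, Tendsto (fun x : ℕ × Ω =>
    avg (s x.1 k) (O · x.2) fun o => (b k x o - b₀ o) ^ 2) (inProb Q) (𝓝 0)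
  tendsto_a : ∀ k, Tendsto (fun x : ℕ × Ω =>
    avg (s x.1 k) (O · x.2) fun o => (a k x o - a₀ o) ^ 2) (inProb Q) (𝓝 0)
  first_order : ∀ k, Tendsto (fun x : ℕ × Ω => √(x.1 : ℝ) *
    ((avg (s x.1 k) (O · x.2) (b k x) - τ * avg (s x.1 k) (O · x.2) (a k x)) -
      (avg (s x.1 k) (O · x.2) b₀ - τ * avg (s x.1 k) (O · x.2) a₀))) (inProb Q) (𝓝 0)
  integral_eq : ∫ o, b₀ o ∂ν = τ * ∫ o, a₀ o ∂ν
  integral_ne_zero : ∫ o, a₀ o ∂ν ≠ 0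

namespace OrthogonalMoments

variable {Q : Measure Ω} [IsProbabilityMeasure Q] {ν : Measure 𝒪} [IsProbabilityMeasure ν]
  {O : ℕ → Ω → 𝒪} {s : ℕ → Fin K → Finset ℕ} {b a : Fin K → ℕ × Ω → 𝒪 → ℝ} {b₀ a₀ : 𝒪 → ℝ} {τ : ℝ}
  (h : OrthogonalMoments Q ν O s b a b₀ a₀ τ)

include h

omit [IsProbabilityMeasure ν] in
-- Once each fold's function may be replaced by the common f₀, the folds recombine into the full
-- sample and the law of large numbers applies.
lemma tendsto_crossAvg {f : Fin K → ℕ × Ω → 𝒪 → ℝ} {f₀ : 𝒪 → ℝ}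
    (hf : ∀ k, Tendsto (fun x : ℕ × Ω => avg (s x.1 k) (O · x.2) (f k x) -
      avg (s x.1 k) (O · x.2) f₀) (inProb Q) (𝓝 0))
    (hm : Measurable f₀) (hi : Integrable f₀ ν) :
    Tendsto (fun x : ℕ × Ω => crossAvg (s x.1) (O · x.2) fun k => f k x) (inProb Q)
      (𝓝 (∫ o, f₀ o ∂ν)) := by
  have h1 := (tendsto_finsetSum Finset.univ fun k _ => hf k).const_mul (K : ℝ)⁻¹
  have h2 := h1.add (tendsto_avg_range h.measurable_obs h.indep h.law hm hi h.pos)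
  simp only [Finset.sum_const_zero, mul_zero, zero_add] at h2
  refine h2.congr fun x => ?_
  rw [← h.crossAvg_const, crossAvg, crossAvg, ← mul_add, ← Finset.sum_add_distrib]
  simp

lemma tendsto_num : Tendsto (fun x : ℕ × Ω => crossAvg (s x.1) (O · x.2) fun k => b k x) (inProb Q)
    (𝓝 (∫ o, b₀ o ∂ν)) :=
  h.tendsto_crossAvg (f := b) (f₀ := b₀) (fun k =>
    tendsto_avg_sub_of_sq (s := fun N => s N k) (f := b k) (f₀ := b₀) (h.tendsto_b k))
    h.measurable_b (h.memLp_b.integrable one_le_two)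

lemma tendsto_den : Tendsto (fun x : ℕ × Ω => crossAvg (s x.1) (O · x.2) fun k => a k x) (inProb Q)
    (𝓝 (∫ o, a₀ o ∂ν)) :=
  h.tendsto_crossAvg (f := a) (f₀ := a₀) (fun k =>
    tendsto_avg_sub_of_sq (s := fun N => s N k) (f := a k) (f₀ := a₀) (h.tendsto_a k))
    h.measurable_a (h.memLp_a.integrable one_le_two)

lemma tendsto_ratio : Tendsto (fun x : ℕ × Ω => (crossAvg (s x.1) (O · x.2) fun k => b k x) /
    crossAvg (s x.1) (O · x.2) fun k => a k x) (inProb Q) (𝓝 τ) := by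
  have := h.tendsto_num.div h.tendsto_den h.integral_ne_zero
  rwa [h.integral_eq, mul_div_cancel_right₀ _ h.integral_ne_zero] at this

omit [IsProbabilityMeasure Q] [IsProbabilityMeasure ν] in
lemma tendsto_sqrt_moment_sub : Tendsto (fun x : ℕ × Ω => √((K * x.1 : ℕ) : ℝ) *
    ((crossAvg (s x.1) (O · x.2) fun k => b k x) -
      τ * (crossAvg (s x.1) (O · x.2) fun k => a k x) -
      avg (Finset.range (K * x.1)) (O · x.2) fun o => b₀ o - τ * a₀ o)) (inProb Q) (𝓝 0) := by
  have h1 := (tendsto_finsetSum Finset.univ fun k _ => h.first_order k).const_mul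
    (√(K : ℝ) * (K : ℝ)⁻¹)
  simp only [Finset.sum_const_zero, mul_zero] at h1
  refine h1.congr fun x => ?_
  rw [← h.crossAvg_const, Nat.cast_mul, Real.sqrt_mul (Nat.cast_nonneg K)]
  simp only [crossAvg, avg_sub, avg_const_mul, ← Finset.mul_sum, Finset.sum_sub_distrib]
  ring

lemma stochBdd_sqrt_moment : StochBdd Q fun x : ℕ × Ω => √((K * x.1 : ℕ) : ℝ) *
    avg (Finset.range (K * x.1)) (O · x.2) fun o => b₀ o - τ * a₀ o := by
  have h1 := stochBdd_sqrt_avg_sub_integral (f := fun o => b₀ o - τ * a₀ o)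
    (s := fun N => Finset.range (K * N)) h.measurable_obs h.indep h.law
    (h.measurable_b.sub (h.measurable_a.const_mul τ)) (h.memLp_b.sub (h.memLp_a.const_mul τ))
    fun N => by
      rw [Finset.card_range]
      exact Nat.le_mul_of_pos_left N h.pos
  rw [integral_sub (h.memLp_b.integrable one_le_two)
    ((h.memLp_a.integrable one_le_two).const_mul τ), integral_const_mul, h.integral_eq,
    sub_self] at h1
  refine (h1.const_mul √(K : ℝ)).mono fun x => le_of_eq (congrArg _ ?_)
  rw [Nat.cast_mul, Real.sqrt_mul (Nat.cast_nonneg K)]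
  ring

/-- The asymptotically linear expansion of the ratio. -/
lemma tendsto_sqrt_ratio_sub : Tendsto (fun x : ℕ × Ω =>
    √((K * x.1 : ℕ) : ℝ) * ((crossAvg (s x.1) (O · x.2) fun k => b k x) /
      (crossAvg (s x.1) (O · x.2) fun k => a k x) - τ) -
    (∫ o, a₀ o ∂ν)⁻¹ * (√((K * x.1 : ℕ) : ℝ) *
      avg (Finset.range (K * x.1)) (O · x.2) fun o => b₀ o - τ * a₀ o)) (inProb Q) (𝓝 0) := by
  have hd := h.tendsto_den
  have hi := hd.inv₀ h.integral_ne_zero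
  -- √n (b/a - τ) = √n (b - τ a) / a. The numerator is exchanged for the true moment and, that
  -- moment being O_P(1), 1/a for its limit.
  have h1 := (h.tendsto_sqrt_moment_sub.mul hi).add
    (h.stochBdd_sqrt_moment.mul_tendsto_zero (by simpa using hi.sub_const (∫ o, a₀ o ∂ν)⁻¹))
  rw [zero_mul, zero_add] at h1
  refine h1.congr' ?_
  filter_upwards [hd.eventually_ne h.integral_ne_zero] with x hx
  have hJ := h.integral_ne_zero
  field_simp
  ring

/-- The influence function J⁻¹ (b₀ - τ a₀) is centred by the choice of τ; the central limit theorem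
along n = K N and a negligible remainder give the limit. -/
lemma tendstoInDistribution_ratio
    (hm : ∀ N, AEMeasurable (fun ω => (crossAvg (s N) (O · ω) fun k => b k (N, ω)) /
      crossAvg (s N) (O · ω) fun k => a k (N, ω)) Q) :
    TendstoInDistribution (fun (N : ℕ) ω => √((K * N : ℕ) : ℝ) *
      ((crossAvg (s N) (O · ω) fun k => b k (N, ω)) /
        (crossAvg (s N) (O · ω) fun k => a k (N, ω)) - τ)) atTop (id : ℝ → ℝ) (fun _ => Q)
      (gaussianReal 0
        (((∫ o, a₀ o ∂ν) ^ 2)⁻¹ * ∫ o, (b₀ o - τ * a₀ o) ^ 2 ∂ν).toNNReal) := by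
  set J := ∫ o, a₀ o ∂ν with hJ
  set f : 𝒪 → ℝ := fun o => J⁻¹ * (b₀ o - τ * a₀ o) with hf
  have hfm : Measurable f := (h.measurable_b.sub (h.measurable_a.const_mul τ)).const_mul _
  have hfL : MemLp f 2 ν := (h.memLp_b.sub (h.memLp_a.const_mul τ)).const_mul _
  have hf0 : ∫ o, f o ∂ν = 0 := by
    simp only [hf]
    rw [integral_const_mul, integral_sub (h.memLp_b.integrable one_le_two)
      ((h.memLp_a.integrable one_le_two).const_mul τ), integral_const_mul, h.integral_eq, sub_self,
      mul_zero]
  have hX0 : ∫ ω, f (O 0 ω) ∂Q = 0 := by rw [integral_obs h.measurable_obs h.law hfm, hf0]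
  have hfO : AEMeasurable (fun ω => f (O 0 ω)) Q := (hfm.comp (h.measurable_obs 0)).aemeasurable
  have hvar : Var[fun ω => f (O 0 ω); Q] = (J ^ 2)⁻¹ * ∫ o, (b₀ o - τ * a₀ o) ^ 2 ∂ν := by
    rw [variance_of_integral_eq_zero hfO hX0,
      integral_obs (f := fun o => f o ^ 2) h.measurable_obs h.law (hfm.pow_const 2),
      ← integral_const_mul]
    simp only [hf, mul_pow, inv_pow]
  have hclt := tendstoInDistribution_inv_sqrt_mul_sum_sub (X := fun i ω => f (O i ω)) (P := Q)
    (P' := gaussianReal 0 Var[fun ω => f (O 0 ω); Q].toNNReal) (Y := id) HasLaw.id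
    (memLp_obs h.measurable_obs h.law hfL 0) (h.indep.comp _ fun _ => hfm)
    (identDistrib_obs h.measurable_obs h.law hfm)
  rw [hX0, hvar] at hclt
  have hK' : Tendsto (fun N : ℕ => K * N) atTop atTop :=
    tendsto_atTop_mono (fun N => Nat.le_mul_of_pos_left N h.pos) tendsto_id
  have hsub : TendstoInDistribution (fun (N : ℕ) ω => (√((K * N : ℕ) : ℝ))⁻¹ *
      (∑ k ∈ Finset.range (K * N), f (O k ω) - ((K * N : ℕ) : ℝ) * 0)) atTop (id : ℝ → ℝ)
      (fun _ => Q) (gaussianReal 0 ((J ^ 2)⁻¹ * ∫ o, (b₀ o - τ * a₀ o) ^ 2 ∂ν).toNNReal) :=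
    ⟨fun N => hclt.forall_aemeasurable (K * N), hclt.aemeasurable_limit, hclt.tendsto.comp hK'⟩
  refine tendstoInDistribution_of_tendstoInMeasure_sub _ _ hsub ?_
    fun N => ((hm N).sub_const τ).const_mul _
  refine tendstoInMeasure_iff_inProb.2 (h.tendsto_sqrt_ratio_sub.congr fun x => ?_)
  simp only [Pi.sub_apply, mul_zero, sub_zero]
  congr 1
  simp only [hf, avg, ← Finset.mul_sum, Finset.card_range]
  have hsqrt : √((K * x.1 : ℕ) : ℝ) / ((K * x.1 : ℕ) : ℝ) = (√((K * x.1 : ℕ) : ℝ))⁻¹ := by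
    rw [Real.sqrt_div_self', one_div]
  rw [← hsqrt]
  ring

lemma tendsto_variance : Tendsto (fun x : ℕ × Ω =>
    ((crossAvg (s x.1) (O · x.2) fun k => a k x) ^ 2)⁻¹ *
      crossAvg (s x.1) (O · x.2) fun k o => (b k x o -
        ((crossAvg (s x.1) (O · x.2) fun k => b k x) /
          crossAvg (s x.1) (O · x.2) fun k => a k x) * a k x o) ^ 2) (inProb Q)
    (𝓝 (((∫ o, a₀ o ∂ν) ^ 2)⁻¹ * ∫ o, (b₀ o - τ * a₀ o) ^ 2 ∂ν)) := by
  have hr := h.tendsto_ratio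
  set r : ℕ × Ω → ℝ := fun x => (crossAvg (s x.1) (O · x.2) fun k => b k x) /
    crossAvg (s x.1) (O · x.2) fun k => a k x with hrdef
  have hL : MemLp (fun o => b₀ o - τ * a₀ o) 2 ν := h.memLp_b.sub (h.memLp_a.const_mul τ)
  have hLm : Measurable fun o => b₀ o - τ * a₀ o := h.measurable_b.sub (h.measurable_a.const_mul τ)
  have hbdd : ∀ {f : 𝒪 → ℝ}, Measurable f → MemLp f 2 ν → ∀ k,
      StochBdd Q fun x => avg (s x.1 k) (O · x.2) fun o => f o ^ 2 := fun {f} hm hf k => by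
    have := stochBdd_avg_abs (f := fun o => f o ^ 2) h.measurable_obs h.law (hm.pow_const 2)
      hf.integrable_sq fun N => s N k
    exact this.mono fun x => le_of_eq (by simp only [abs_sq])
  -- (b - r a) - (b₀ - τ a₀) = (b - b₀) - r (a - a₀) - (r - τ) a₀; the factor 3 below bounds the
  -- square of a sum of three terms.
  have hsq : ∀ k, Tendsto (fun x : ℕ × Ω => avg (s x.1 k) (O · x.2) fun o =>
      ((b k x o - r x * a k x o) - (b₀ o - τ * a₀ o)) ^ 2) (inProb Q) (𝓝 0) := fun k => by
    have hz : Tendsto (fun x => (r x - τ) ^ 2) (inProb Q) (𝓝 0) := by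
      simpa using (hr.sub_const τ).pow 2
    have h1 := (((h.tendsto_b k).add ((hr.pow 2).mul (h.tendsto_a k))).add
      ((hbdd h.measurable_a h.memLp_a k).mul_tendsto_zero hz)).const_mul 3
    simp only [mul_zero, add_zero] at h1
    refine squeeze_zero (fun x => avg_nonneg _ _ fun o => sq_nonneg _) (fun x => ?_) h1
    rw [mul_comm (avg _ _ fun o => a₀ o ^ 2), ← avg_const_mul, ← avg_const_mul, ← avg_add,
      ← avg_add, ← avg_const_mul]
    refine avg_mono _ _ fun o => ?_
    nlinarith [sq_nonneg ((b k x o - b₀ o) + r x * (a k x o - a₀ o)),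
      sq_nonneg ((b k x o - b₀ o) + (r x - τ) * a₀ o),
      sq_nonneg (r x * (a k x o - a₀ o) - (r x - τ) * a₀ o)]
  have hv := h.tendsto_crossAvg (f := fun k x o => (b k x o - r x * a k x o) ^ 2)
    (f₀ := fun o => (b₀ o - τ * a₀ o) ^ 2) (fun k =>
      tendsto_avg_sq_sub_of_sq (s := fun N => s N k) (f := fun x o => b k x o - r x * a k x o)
        (f₀ := fun o => b₀ o - τ * a₀ o) (hsq k) (hbdd hLm hL k)) (hLm.pow_const 2) hL.integrable_sq
  exact ((h.tendsto_den.pow 2).inv₀ (pow_ne_zero 2 h.integral_ne_zero)).mul hv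

end OrthogonalMoments

end Ratio

end IDiD

namespace IDiD

/-! ### Normal quantiles and coverage -/

/-- Right continuity at the infimum gives ≥. Below the infimum the cdf is under u, and having no
atom it equals its left limit there, which gives ≤. -/
lemma cdf_normalQuantile {u : ℝ} (h0 : 0 < u) (h1 : u < 1) :
    cdf (gaussianReal 0 1) (normalQuantile u) = u := by
  have : NullSingletonClass (gaussianReal 0 1) := nullSingletonClass_gaussianReal one_ne_zero
  set F := cdf (gaussianReal 0 1) with hF
  set A := {x : ℝ | u ≤ F x} with hA
  have hne : A.Nonempty := by
    obtain ⟨x, hx⟩ := ((tendsto_cdf_atTop (gaussianReal 0 1)).eventually_const_lt h1).exists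
    exact ⟨x, hx.le⟩
  have hbdd : BddBelow A := by
    obtain ⟨y, hy⟩ := ((tendsto_cdf_atBot (gaussianReal 0 1)).eventually_lt_const h0).exists
    exact ⟨y, fun x hx => le_of_not_gt fun hxy =>
      (lt_of_le_of_lt (monotone_cdf _ hxy.le) hy).not_ge hx⟩
  have hz : normalQuantile u = sInf A := rfl
  apply le_antisymm
  · have hatom : F.measure {sInf A} = 0 := by
      rw [hF, measure_cdf]
      exact measure_singleton _
    rw [StieltjesFunction.measure_singleton, ENNReal.ofReal_eq_zero, sub_nonpos] at hatom
    rw [hz]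
    refine hatom.trans (le_of_tendsto (F.mono.tendsto_leftLim (sInf A)) ?_)
    filter_upwards [self_mem_nhdsWithin] with y hy
    exact le_of_not_ge fun hle => (notMem_of_lt_csInf hy hbdd) hle
  · rw [hz]
    have hc := (F.right_continuous (sInf A)).mono Set.Ioi_subset_Ici_self
    refine ge_of_tendsto hc ?_
    filter_upwards [self_mem_nhdsWithin] with y hy
    obtain ⟨x, hx, hxy⟩ := exists_lt_of_csInf_lt hne hy
    exact le_trans hx (F.mono hxy.le)

lemma gaussianReal_Icc_normalQuantile {α : ℝ} (h0 : 0 < α) (h1 : α < 1) :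
    (gaussianReal 0 1).real (Set.Icc (-normalQuantile (1 - α / 2)) (normalQuantile (1 - α / 2))) =
      1 - α := by
  have : NullSingletonClass (gaussianReal 0 1) := nullSingletonClass_gaussianReal one_ne_zero
  have hcdf := cdf_normalQuantile (u := 1 - α / 2) (by linarith) (by linarith)
  set z := normalQuantile (1 - α / 2)
  have hz := hcdf
  rw [cdf_eq_real] at hz
  have hsymm : (gaussianReal 0 1).real (Set.Iio (-z)) = 1 - (1 - α / 2) := by
    have hmap : (gaussianReal 0 1).map (fun x => -x) = gaussianReal 0 1 := by
      rw [gaussianReal_map_neg, neg_zero]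
    rw [← hz, ← probReal_compl_eq_one_sub measurableSet_Iic, Set.compl_Iic]
    conv_lhs => rw [← hmap]
    rw [map_measureReal_apply measurable_neg measurableSet_Iio]
    congr 1
    ext x
    simp
  -- If z < 0, monotonicity of the cdf at z ≤ -z would give 1 - α/2 ≤ α/2, contrary to α < 1.
  -- Nonnegativity makes the set difference below a subtraction of nested sets.
  have hnonneg : 0 ≤ z := by
    by_contra! hneg
    have h2 := monotone_cdf (gaussianReal 0 1) (show z ≤ -z by linarith)
    rw [hcdf, cdf_eq_real, ← measureReal_congr Iio_ae_eq_Iic, hsymm] at h2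
    linarith
  have hdiff : Set.Icc (-z) z = Set.Iic z \ Set.Iio (-z) := by
    ext x
    simp [and_comm]
  have hsub : Set.Iio (-z) ⊆ Set.Iic z := fun x hx => (Set.mem_Iio.1 hx).le.trans (by linarith)
  rw [hdiff, measureReal_sdiff hsub measurableSet_Iio, hz, hsymm]
  ring

variable {Ω : Type*} [MeasurableSpace Ω] {Q : Measure Ω} [IsProbabilityMeasure Q]

/-- Asymptotic level of the two-sided test based on a studentized asymptotically normal
statistic. -/
lemma tendsto_coverage {U V : ℕ → Ω → ℝ} {v : ℝ}
    (hU : TendstoInDistribution U atTop (id : ℝ → ℝ) (fun _ => Q) (gaussianReal 0 v.toNNReal))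
    (hV : TendstoInMeasure Q V atTop fun _ => v) (hVm : ∀ N, AEMeasurable (V N) Q) (hv : 0 < v)
    {α : ℝ} (h0 : 0 < α) (h1 : α < 1) :
    Tendsto (fun N => Q.real {ω | |U N ω| ≤ normalQuantile (1 - α / 2) * √(V N ω)}) atTop
      (𝓝 (1 - α)) := by
  have hα := gaussianReal_Icc_normalQuantile h0 h1
  set z := normalQuantile (1 - α / 2)
  have hsv : 0 < √v := Real.sqrt_pos.2 hv
  have hv' : v.toNNReal ≠ 0 := by simpa using hv
  have : NullSingletonClass (gaussianReal 0 v.toNNReal) := nullSingletonClass_gaussianReal hv'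
  -- The event is kept as |U| - z √V ≤ 0 instead of being studentized, so no division by a possibly
  -- vanishing √V occurs.
  have hg : Continuous fun x : ℝ × ℝ => |x.1| - z * √x.2 := by fun_prop
  have hd := hU.continuous_comp_prodMk_of_tendstoInMeasure_const hg hV hVm
  have hgv : Measurable fun x : ℝ => |id x| - z * √v := by fun_prop
  -- The boundary event consists of two points, which are null because the limit variance is
  -- positive.
  have hfr : (gaussianReal 0 v.toNNReal).map (fun x : ℝ => |id x| - z * √v)
      (frontier (Set.Iic 0)) = 0 := by
    rw [frontier_Iic, Measure.map_apply hgv (measurableSet_singleton 0)]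
    refine measure_mono_null (t := {z * √v, -(z * √v)}) (fun x hx => ?_)
      ((Set.toFinite _).measure_zero _)
    have hx' : |x| = z * √v := sub_eq_zero.1 hx
    rcases abs_choice x with h | h
    · exact Or.inl (h ▸ hx')
    · exact Or.inr (by rw [Set.mem_singleton_iff, ← hx', h, neg_neg])
  have hlim : Tendsto (fun N => Q.map (fun ω => |U N ω| - z * √(V N ω)) (Set.Iic 0)) atTop
      (𝓝 ((gaussianReal 0 v.toNNReal).map (fun x : ℝ => |id x| - z * √v) (Set.Iic 0))) :=
    ProbabilityMeasure.tendsto_measure_of_null_frontier_of_tendsto' hd.tendsto hfr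
  have hval : (gaussianReal 0 v.toNNReal).map (fun x : ℝ => |id x| - z * √v) (Set.Iic 0) =
      gaussianReal 0 1 (Set.Icc (-z) z) := by
    have hmap : gaussianReal 0 v.toNNReal = (gaussianReal 0 1).map (√v * ·) := by
      rw [gaussianReal_map_const_mul, mul_zero, mul_one]
      congr 1
      ext
      simp [Real.sq_sqrt hv.le, hv.le]
    rw [Measure.map_apply hgv measurableSet_Iic, hmap,
      Measure.map_apply (measurable_const_mul _) (hgv measurableSet_Iic)]
    congr 1
    ext x
    simp only [Set.mem_preimage, Set.mem_Iic, id, sub_nonpos, abs_mul, abs_of_pos hsv, Set.mem_Icc]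
    rw [mul_comm z, mul_le_mul_iff_right₀ hsv, abs_le]
  rw [hval] at hlim
  have hreal := (ENNReal.tendsto_toReal (measure_ne_top _ _)).comp hlim
  change Tendsto _ _ (𝓝 ((gaussianReal 0 1).real (Set.Icc (-z) z))) at hreal
  rw [hα] at hreal
  refine hreal.congr fun N => ?_
  change (Q.map _ (Set.Iic 0)).toReal = _
  rw [Measure.map_apply_of_aemeasurable (hd.forall_aemeasurable N) measurableSet_Iic,
    Measure.real]
  congr 2
  ext ω
  simp

end IDiD

namespace IDiD

/-! ### Measurability of the estimators -/

section Measurability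

variable {T K : ℕ} {𝒳 Ω : Type*} [MeasurableSpace 𝒳] [MeasurableSpace Ω] {O : ℕ → Ω → Obs T 𝒳}
  {F : CrossFit T K 𝒳} {c : ControlGroup} {e t : Period T}

lemma measurable_avg (hO : ∀ i, Measurable (O i)) {φ : Ω → Obs T 𝒳 → ℝ}
    (hφ : Measurable (Function.uncurry φ)) (s : Finset ℕ) :
    Measurable fun ω => avg s (O · ω) (φ ω) :=
  (Finset.measurable_fun_sum s fun i _ => hφ.comp (measurable_id.prodMk (hO i))).div_const _

namespace CrossFit

lemma measurable_normMean (hO : ∀ i, Measurable (O i)) {φ : Ω → Obs T 𝒳 → ℝ}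
    (hφ : Measurable (Function.uncurry φ)) (N : ℕ) (k : Fin K) :
    Measurable fun ω => F.normMean N k (O · ω) (φ ω) := by
  rcases hn : F.normalization with _ | _
  · simpa only [normMean, hn, trainMean_eq_avg] using measurable_avg hO hφ (F.trainSet N k)
  · simpa only [normMean, hn, foldMean_eq_avg] using measurable_avg hO hφ (F.evalSet N k)

lemma measurable_learner {ι : Type} {v : Ω → ι → Obs T 𝒳} (hv : Measurable v)
    {q : (ι → Obs T 𝒳) → 𝒳 → ℝ} (hq : Measurable (Function.uncurry q)) :
    Measurable fun x : Ω × Obs T 𝒳 => q (v x.1) x.2.2.2.2 :=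
  hq.comp ((hv.comp measurable_fst).prodMk (measurable_covariates.comp measurable_snd))

lemma measurable_weightDiff (hO : ∀ i, Measurable (O i)) (N : ℕ) (k : Fin K) :
    Measurable fun x : Ω × Obs T 𝒳 => weightDiff c e t (F.etaHat c e t N k (O · x.1)) x.2 := by
  have hraw : Measurable fun x : Ω × Obs T 𝒳 =>
      rawCtl c e t ((F.learner N k).p (F.train N k (O · x.1))) x.2 :=
    ((measurable_pathFun (controlInd c e t)).comp measurable_snd).mul
      (measurable_odds.comp (measurable_learner (F.measurable_train hO) (F.learner N k).measurable_p))
  have hG : Measurable fun x : Ω × Obs T 𝒳 => cohortInd e x.2.2.2.1 :=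
    (measurable_pathFun (cohortInd e)).comp measurable_snd
  have h1 := (measurable_normMean (F := F) hO (φ := fun _ o => cohortInd e o.2.2.1) hG N k)
  have h2 := (measurable_normMean (F := F) hO
    (φ := fun ω => rawCtl c e t ((F.learner N k).p (F.train N k (O · ω)))) hraw N k)
  exact (hG.div (h1.comp measurable_fst)).sub (hraw.div (h2.comp measurable_fst))

lemma measurable_psiB (hO : ∀ i, Measurable (O i)) (N : ℕ) (k : Fin K) :
    Measurable fun x : Ω × Obs T 𝒳 => psiB c e t (F.etaHat c e t N k (O · x.1)) x.2 :=
  (measurable_weightDiff hO N k).mul ((measurable_deltaY_obs.comp measurable_snd).sub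
    (measurable_learner (F.measurable_train hO) (F.learner N k).measurable_m))

lemma measurable_psiA (hO : ∀ i, Measurable (O i)) (N : ℕ) (k : Fin K) :
    Measurable fun x : Ω × Obs T 𝒳 => psiA c e t (F.etaHat c e t N k (O · x.1)) x.2 :=
  (measurable_weightDiff hO N k).mul ((measurable_deltaD_obs.comp measurable_snd).sub
    (measurable_learner (F.measurable_train hO) (F.learner N k).measurable_g))

lemma measurable_crossMean (hO : ∀ i, Measurable (O i)) {g : Ω → Nuisance 𝒳 → Obs T 𝒳 → ℝ} {N : ℕ}
    (hg : ∀ k, Measurable fun x : Ω × Obs T 𝒳 => g x.1 (F.etaHat c e t N k (O · x.1)) x.2) :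
    Measurable fun ω => F.crossMean c e t N (O · ω) (g ω) := by
  simp only [crossMean_eq]
  exact (Finset.measurable_fun_sum _ fun k _ => measurable_avg hO
    (φ := fun ω => g ω (F.etaHat c e t N k (O · ω))) (hg k) _).const_mul _

lemma measurable_JHat (hO : ∀ i, Measurable (O i)) (N : ℕ) :
    Measurable fun ω => F.JHat c e t N (O · ω) :=
  measurable_crossMean (g := fun _ => psiA c e t) hO fun k => measurable_psiA hO N k

lemma measurable_tauHat (hO : ∀ i, Measurable (O i)) (N : ℕ) :
    Measurable fun ω => F.tauHat c e t N (O · ω) :=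
  (measurable_crossMean (g := fun _ => psiB c e t) hO fun k => measurable_psiB hO N k).div
    (measurable_JHat hO N)

lemma measurable_sigmaSqHat (hO : ∀ i, Measurable (O i)) (N : ℕ) :
    Measurable fun ω => F.sigmaSqHat c e t N (O · ω) :=
  ((measurable_JHat hO N).pow_const 2).inv.mul
    (measurable_crossMean (g := fun ω η o => psi c e t (F.tauHat c e t N (O · ω)) η o ^ 2) hO
      fun k => ((measurable_psiB hO N k).sub
        (((measurable_tauHat hO N).comp measurable_fst).mul (measurable_psiA hO N k))).pow_const 2)

end CrossFit

end Measurability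

/-! ### The cross-fitted moments -/

section Combination

variable {𝒪 𝒳 Ω : Type*} [MeasurableSpace 𝒪] [MeasurableSpace 𝒳] [MeasurableSpace Ω]
  {ν : Measure 𝒪} [IsProbabilityMeasure ν] {G C : 𝒪 → ℝ} {cov : 𝒪 → 𝒳} {r : 𝒳 → ℝ} {B ρ : ℝ}
  {V V' : 𝒪 → ℝ} {f f' : 𝒳 → ℝ} {Q : Measure Ω} [IsProbabilityMeasure Q] {O : ℕ → Ω → 𝒪}
  {K : ℕ} {s : ℕ → Fin K → Finset ℕ} {𝒲 : Fin K → ℕ → Type*} [∀ k N, MeasurableSpace (𝒲 k N)]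
  {W : ∀ k N, Ω → 𝒲 k N} {q u u' : ∀ k N, 𝒲 k N → 𝒳 → ℝ} {ρ₁ ρ₂ : Fin K → ℕ × Ω → ℝ} {τ : ℝ}

lemma orthogonalMoments_of_fitted (hK : 0 < K)
    (hs : ∀ (N : ℕ) (w : ℕ → 𝒪) (f : 𝒪 → ℝ),
      crossAvg (s N) w (fun _ => f) = avg (Finset.range (K * N)) w f)
    (hw : ∀ k, FittedWeights Q ν O (fun N => s N k) (𝒲 k) (W k) G C cov r B ρ (q k) (ρ₁ k) (ρ₂ k))
    (hr : ∀ k, FittedRegression Q ν (𝒲 k) (W k) G C cov r ρ (q k) (ρ₁ k) (ρ₂ k) V f (u k))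
    (hr' : ∀ k, FittedRegression Q ν (𝒲 k) (W k) G C cov r ρ (q k) (ρ₁ k) (ρ₂ k) V' f' (u' k))
    (hτ : ∫ o, G o * (V o - f (cov o)) ∂ν = τ * ∫ o, G o * (V' o - f' (cov o)) ∂ν)
    (hne : ∫ o, G o * (V' o - f' (cov o)) ∂ν ≠ 0) :
    OrthogonalMoments Q ν O s
      (fun k x => score G C cov V (ρ₁ k x) (ρ₂ k x) (q k x.1 (W k x.1 x.2)) (u k x.1 (W k x.1 x.2)))
      (fun k x => score G C cov V' (ρ₁ k x) (ρ₂ k x) (q k x.1 (W k x.1 x.2))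
        (u' k x.1 (W k x.1 x.2)))
      (score G C cov V ρ ρ r f) (score G C cov V' ρ ρ r f') τ := by
  have hb := (hw ⟨0, hK⟩).balanced
  have hg := (hr ⟨0, hK⟩).regression
  have hg' := (hr' ⟨0, hK⟩).regression
  refine ⟨hK, (hw ⟨0, hK⟩).measurable_obs, (hw ⟨0, hK⟩).indep, (hw ⟨0, hK⟩).law, hs,
    Regression.measurable_score hb hg, Regression.measurable_score hb hg',
    Regression.memLp_score hb hg, Regression.memLp_score hb hg',
    fun k => FittedRegression.tendsto_avg_sq_score_sub (s := fun N => s N k) (W := W k) (q := q k)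
      (u := u k) (ρ₁ := ρ₁ k) (ρ₂ := ρ₂ k) (hw k) (hr k),
    fun k => FittedRegression.tendsto_avg_sq_score_sub (s := fun N => s N k) (W := W k) (q := q k)
      (u := u' k) (ρ₁ := ρ₁ k) (ρ₂ := ρ₂ k) (hw k) (hr' k),
    fun k => tendsto_sqrt_avg_score_sub (s := fun N => s N k) (ρ₁ := ρ₁ k) (ρ₂ := ρ₂ k) (W := W k)
      (q := q k) (u := u k) (u' := u' k) (hw k) (hr k) (hr' k) hτ, ?_, ?_⟩
  · rw [Regression.integral_score hb hg, Regression.integral_score hb hg', hτ, mul_left_comm]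
  · rw [Regression.integral_score hb hg']
    exact mul_ne_zero (inv_ne_zero hb.pos.ne') hne

end Combination

section Moments

variable {T K : ℕ} {S 𝒳 Ω : Type*} [MeasurableSpace S] [MeasurableSpace 𝒳] [MeasurableSpace Ω]
  {P : Measure S} [IsProbabilityMeasure P] {Q : Measure Ω} [IsProbabilityMeasure Q]
  {M : Model T S 𝒳} {c : ControlGroup} {e t : Period T} {δ : ℝ} {O : ℕ → Ω → Obs T 𝒳}
  {F : CrossFit T K 𝒳}

omit [IsProbabilityMeasure P] in
lemma memLp_deltaY (hM : M.IsMeasurable) (hcarry : M.NoCarryover P)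
    (hmom : ∀ (b : Bool) (u : Period T), MemLp (M.Y b u) 2 P) : MemLp (M.deltaY e t) 2 P :=
  (memLp_yPath hM hcarry hmom t).sub (memLp_yPath hM hcarry hmom e.prev)

lemma memLp_deltaD (hM : M.IsMeasurable) : MemLp (M.deltaD e t) 2 P :=
  (memLp_num ((measurable_pi_apply t).comp hM.dPath)).sub
    (memLp_num ((measurable_pi_apply e.prev).comp hM.dPath))

variable (hM : M.IsMeasurable) (he : e ∈ M.cohorts P) (het : e ≤ t)
  (hstag : M.StaggeredAdoption P) (hmono : M.Monotonicity P) (hanti : M.NoAnticipation P)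
  (htrend : M.ParallelTrends P c e t) (hδ : 0 < δ) (hpos : δ < P.real (M.cohortEvent e))
  (hp : ∀ᵐ s ∂(P[|M.slice c e t]), M.propensity P c e t (M.X s) < 1 - δ)
  (hcomp : P (M.cohortEvent e ∩ M.compliers e t) ≠ 0)

include hM he het hstag hmono hanti htrend hδ hp in
lemma integral_cohort_residual_treatment :
    ∫ o, cohortInd e o.2.2.1 * (num (o.2.1 t) - num (o.2.1 e.prev) - M.gCtl P c e t o.2.2.2)
      ∂(M.law P) = P.real (M.cohortEvent e ∩ M.compliers e t) :=
  (integral_cohort_residual (e := e) hM hδ hp measurable_deltaD_obs (memLp_deltaD hM)).trans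
    (integral_treatment_diff hM he het hstag hmono hanti htrend hδ hp)

include hM he het hstag hmono hanti htrend hδ hp hcomp in
lemma integral_cohort_residual_outcome (hcarry : M.NoCarryover P)
    (hmom : ∀ (b : Bool) (u : Period T), MemLp (M.Y b u) 2 P) :
    ∫ o, cohortInd e o.2.2.1 * (o.1 t - o.1 e.prev - M.mCtl P c e t o.2.2.2) ∂(M.law P) =
      M.tau P c e t * P.real (M.cohortEvent e ∩ M.compliers e t) := by
  have hne : P.real (M.cohortEvent e ∩ M.compliers e t) ≠ 0 :=
    ENNReal.toReal_ne_zero.2 ⟨hcomp, measure_ne_top _ _⟩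
  rw [tau_eq_div hM he het hstag hmono hanti htrend hδ hp, div_mul_cancel₀ _ hne]
  exact integral_cohort_residual (e := e) hM hδ hp measurable_deltaY_obs
    (memLp_deltaY hM hcarry hmom)

include hM he het hstag hmono hanti htrend hδ hpos hp hcomp in
-- Joins the two halves of the argument: identification provides the moment equation defining τ and,
-- through a positive share of compliers, a nonzero denominator; the fold expansions provide the
-- rest.
lemma orthogonalMoments_score (hcarry : M.NoCarryover P)
    (hmom : ∀ (b : Bool) (u : Period T), MemLp (M.Y b u) 2 P) (hK : 2 ≤ K)
    (hO : ∀ i, Measurable (O i)) (hindep : iIndepFun O Q) (hlaw : ∀ i, Q.map (O i) = M.law P)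
    (hrate : SecondOrderRate M P c e t F Q O) (hcons : L2Consistency M P c e t F Q O)
    (hnorm : F.normalization = .trainingFolds → WeightFluctuation M P c e t F Q O) :
    OrthogonalMoments Q (M.law P) O F.evalSet
      (fun k x => psiB c e t (F.etaHat c e t x.1 k (O · x.2)))
      (fun k x => psiA c e t (F.etaHat c e t x.1 k (O · x.2)))
      (psiB c e t (M.eta P c e t)) (psiA c e t (M.eta P c e t)) (M.tau P c e t) := by
  have := isProbabilityMeasure_law (P := P) hM
  have hY := memLp_deltaY (e := e) (t := t) hM hcarry hmom
  have hw := fittedWeights_fold hM hδ hpos hp hO hlaw hcons hK hindep hnorm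
  have hfY := fittedRegression_outcome hM hδ hpos hp hcons hrate hK hY
  have hfD := fittedRegression_treatment hM hδ hpos hp hcons hrate hK
  have hD := integral_cohort_residual_treatment hM he het hstag hmono hanti htrend hδ hp
  have hresid : ∫ o, cohortInd e o.2.2.1 * (o.1 t - o.1 e.prev - M.mCtl P c e t o.2.2.2)
      ∂(M.law P) = M.tau P c e t * ∫ o, cohortInd e o.2.2.1 *
        (num (o.2.1 t) - num (o.2.1 e.prev) - M.gCtl P c e t o.2.2.2) ∂(M.law P) := by
    rw [integral_cohort_residual_outcome hM he het hstag hmono hanti htrend hδ hp hcomp hcarry hmom,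
      hD]
  have hne : ∫ o, cohortInd e o.2.2.1 *
      (num (o.2.1 t) - num (o.2.1 e.prev) - M.gCtl P c e t o.2.2.2) ∂(M.law P) ≠ 0 := by
    rw [hD]
    exact ENNReal.toReal_ne_zero.2 ⟨hcomp, measure_ne_top _ _⟩
  rw [psiA_eta hM hδ hpos hp, psiB_eta hM hδ hpos hp]
  exact orthogonalMoments_of_fitted (by omega) (fun N w f => F.inv_mul_sum_avg w f) hw hfY hfD
    hresid hne

end Moments

/-! ### The estimators as ratios of cross-fitted averages -/

namespace CrossFit

variable {T K : ℕ} {𝒳 : Type*} [MeasurableSpace 𝒳] (F : CrossFit T K 𝒳) (c : ControlGroup)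
  (e t : Period T) (N : ℕ) (w : ℕ → Obs T 𝒳)

lemma tauHat_eq : F.tauHat c e t N w =
    (crossAvg (F.evalSet N) w fun k => psiB c e t (F.etaHat c e t N k w)) /
      crossAvg (F.evalSet N) w fun k => psiA c e t (F.etaHat c e t N k w) := by
  simp only [tauHat, JHat, crossMean_eq, crossAvg]

lemma sigmaSqHat_eq : F.sigmaSqHat c e t N w =
    ((crossAvg (F.evalSet N) w fun k => psiA c e t (F.etaHat c e t N k w)) ^ 2)⁻¹ *
      crossAvg (F.evalSet N) w fun k o => (psiB c e t (F.etaHat c e t N k w) o -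
        ((crossAvg (F.evalSet N) w fun k => psiB c e t (F.etaHat c e t N k w)) /
          crossAvg (F.evalSet N) w fun k => psiA c e t (F.etaHat c e t N k w)) *
            psiA c e t (F.etaHat c e t N k w) o) ^ 2 := by
  simp only [sigmaSqHat, JHat, crossMean_eq, psi, tauHat_eq, crossAvg]

end CrossFit

/-! ### The confidence interval -/

/-- Coverage becomes a bound on the √n-scaled error. `hN` is needed because division by √0 would
collapse the interval to a point. -/
lemma CrossFit.mem_confInt_iff {T K : ℕ} {𝒳 : Type*} [MeasurableSpace 𝒳] (F : CrossFit T K 𝒳)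
    {c : ControlGroup} {e t : Period T} {α τ : ℝ} {N : ℕ} (hN : 0 < K * N) (w : ℕ → Obs T 𝒳) :
    τ ∈ F.confInt c e t α N w ↔ |√((K * N : ℕ) : ℝ) * (F.tauHat c e t N w - τ)| ≤
      normalQuantile (1 - α / 2) * √(F.sigmaSqHat c e t N w) := by
  have hn : 0 < √((K * N : ℕ) : ℝ) := Real.sqrt_pos.2 (by exact_mod_cast hN)
  rw [CrossFit.confInt, Set.mem_Icc, abs_mul, abs_of_pos hn, mul_comm (√((K * N : ℕ) : ℝ)),
    ← le_div_iff₀ hn, abs_le]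
  constructor <;> rintro ⟨h1, h2⟩ <;> constructor <;> linarith

end IDiD

/-! ### The theorem: identification, asymptotic normality, variance and coverage. -/

theorem mainTheorem11 {T K : ℕ} (hK : 2 ≤ K)
    {S 𝒳 Ω : Type*} [MeasurableSpace S] [MeasurableSpace 𝒳] [MeasurableSpace Ω]
    (P : Measure S) [IsProbabilityMeasure P] (Q : Measure Ω) [IsProbabilityMeasure Q]
    -- the population, the cohort, the period and the control group
    (M : Model T S 𝒳) (hM : M.IsMeasurable) (c : ControlGroup) (e t : Period T)
    (he : e ∈ M.cohorts P) (het : e ≤ t)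
    (hmom : ∀ (b : Bool) (u : Period T), MemLp (M.Y b u) 2 P)
    -- identifying assumptions
    (hstag : M.StaggeredAdoption P) (hcarry : M.NoCarryover P) (hmono : M.Monotonicity P)
    (hanti : M.NoAnticipation P) (htrend : M.ParallelTrends P c e t)
    (hoverlap : M.Overlap P c e t)
    (hcomp : P (M.cohortEvent e ∩ {s | M.Dpot ⊤ t s < M.Dpot e t s}) ≠ 0)
    -- independent and identically distributed panel data
    (O : ℕ → Ω → Obs T 𝒳) (hO : ∀ i, Measurable (O i)) (hindep : iIndepFun O Q)
    (hlaw : ∀ i, Q.map (O i) = M.law P)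
    -- cross-fitted nuisance estimators
    (F : CrossFit T K 𝒳)
    (hrate : SecondOrderRate M P c e t F Q O)
    (hcons : L2Consistency M P c e t F Q O)
    (hnorm : F.normalization = .trainingFolds → WeightFluctuation M P c e t F Q O) :
    -- the estimand is the causal parameter
    M.tau P c e t = M.LATT P e t ∧
    -- asymptotic normality
    M.J P c e t ≠ 0 ∧
    MemLp (psi c e t (M.tau P c e t) (M.eta P c e t)) 2 (M.law P) ∧
    TendstoInDistribution
      (fun (N : ℕ) (ω : Ω) =>
        √((K * N : ℕ) : ℝ) * (F.tauHat c e t N (O · ω) - M.tau P c e t))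
      atTop (id : ℝ → ℝ) (fun _ => Q) (gaussianReal 0 (M.sigmaSq P c e t).toNNReal) ∧
    -- consistency of the variance estimator
    TendstoInMeasure Q (fun (N : ℕ) (ω : Ω) => F.sigmaSqHat c e t N (O · ω)) atTop
      (fun _ => M.sigmaSq P c e t) ∧
    -- asymptotic coverage of the confidence interval
    (0 < M.sigmaSq P c e t → ∀ α : ℝ, 0 < α → α < 1 →
      Tendsto (fun N : ℕ => Q.real {ω | M.tau P c e t ∈ F.confInt c e t α N (O · ω)})
        atTop (𝓝 (1 - α))) := by
  obtain ⟨δ, hδ, hpos, hp⟩ := hoverlap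
  have := isProbabilityMeasure_law (P := P) hM
  have hmain := orthogonalMoments_score hM he het hstag hmono hanti htrend hδ hpos hp hcomp hcarry
    hmom hK hO hindep hlaw hrate hcons hnorm
  have hdist := hmain.tendstoInDistribution_ratio fun N => by
    simpa only [CrossFit.tauHat_eq] using (CrossFit.measurable_tauHat (F := F) (c := c) (e := e)
      (t := t) hO N).aemeasurable
  have hvar := hmain.tendsto_variance
  -- The general limit theorems speak of ratios of fold averages; they are folded back into the
  -- estimators, the limits being `M.J` and `M.sigmaSq` by definition.
  simp only [← CrossFit.tauHat_eq] at hdist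
  simp only [← CrossFit.sigmaSqHat_eq] at hvar
  replace hvar := (tendstoInMeasure_iff_inProb (f := fun (N : ℕ) (ω : Ω) =>
    F.sigmaSqHat c e t N (O · ω))).2 hvar
  refine ⟨tau_eq_LATT hM he het hstag hmono hanti htrend hδ hp hcarry hmom hcomp,
    hmain.integral_ne_zero, hmain.memLp_b.sub (hmain.memLp_a.const_mul _), hdist, hvar,
    fun hσ α h0 h1 => ?_⟩
  refine (tendsto_coverage hdist hvar
    (fun N => (CrossFit.measurable_sigmaSqHat hO N).aemeasurable) hσ h0 h1).congr' ?_
  filter_upwards [eventually_gt_atTop 0] with N hN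
  simp only [F.mem_confInt_iff (Nat.mul_pos (by omega) hN)]
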